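/- Let $d\ge 3$ and $\alpha\ge 5$ be integers and let $q$ be a prime power. Put $\theta_n:=\frac{q^{n+1}-1}{q-1}$. Dimensions are projective. A flag of type $\{d-1,d\}$ in $\mathrm{PG}(2d,q)$ is a pair $(\pi,\tau)$ of subspaces with $\dim\pi=d-1$, $\dim\tau=d$ and $\pi\subseteq\tau$. Two flags $(\pi,\tau),(\pi',\tau')$ are in general position if $\pi\cap\tau'=\pi'\cap\tau=\emptyset$; a set of flags is independent if no two of its elements are in general position. We use the following examples of independent sets. (1) For a point $P$ and a set $\mathcal U$ of $d$-dimensional subspaces through $P$ with $\dim(\tau\cap\tau')\ge 1$ for all $\tau,\tau'\in\mathcal U$, let $F(P,\mathcal U)$ be the set of all flags $(\pi,\tau)$ with $P\in\pi$ or $\tau\in\mathcal U$. This set is said to be based on the point $P$, and its generic part consists of its flags $(\pi,\tau)$ with $P\in\pi$. (2) For a hyperplane $H$ and a set $\mathcal E$ of $(d-1)$-dimensional subspaces of $H$ with pairwise non-empty intersection, let $F(H,\mathcal E)$ be the set of all flags $(\pi,\tau)$ with $\tau\subseteq H$ or $\pi\in\mathcal E$. This set is said to be based on the hyperplane $H$,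 and its generic part consists of its flags $(\pi,\tau)$ with $\tau\subseteq H$. **Theorem.** Let $F_1,\dots,F_N$, where $N:=\theta_{d+1}-q$, be (not necessarily distinct) independent sets of flags of type $\{d-1,d\}$ in $\mathrm{PG}(2d,q)$ whose union consists of all flags of this type. Put $e_1:=\alpha q^{d^2+d-2}$ and $S:=\{i : |F_i|>e_1\}$, and suppose the following: (I) $q>3\cdot 112^{2^{d+1}-1}\cdot 2^{-d-1}$ and $q\ge\frac32\alpha^2+\frac{21}2\alpha+17$. (II) For every $i\in S$ the set $F_i$ is one of the examples in (1) and (2). (III) For distinct $i,j\in S$ the sets $F_i$ and $F_j$ have distinct generic parts. (IV) For at least $\frac12|S|$ indices $i\in S$ the set $F_i$ is based on a point. Then every $F_i$, $1\le i\le N$, is a set as in (1), based on a point $P_i$, and $P_1,\dots,P_N$ are $N$ mutually distinct points of a subspace of dimension $d+1$. -/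

import Mathlib

open Module

/-- A flag of (projective) type `{d-1, d}`: a pair of incident subspaces `pi ≤ tau` of ranks
`d` and `d + 1`, that is, of projective dimensions `d - 1` and `d`. -/
@[ext]
structure TypeFlag (K V : Type*) [Field K] [AddCommGroup V] [Module K V] (d : ℕ) where
  pi : Submodule K V
  tau : Submodule K V
  finrank_pi : finrank K pi = d
  finrank_tau : finrank K tau = d + 1
  pi_le_tau : pi ≤ tau

/-- The Kneser graph on the flags of type `{d-1, d}`: two flags are adjacent if they are in general
position. (The clause `f ≠ g` is automatic for `d ≥ 1`.) -/
def flagKneserGraph (K V : Type*) [Field K] [AddCommGroup V] [Module K V] (d : ℕ) :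
    SimpleGraph (TypeFlag K V d) where
  Adj f g := f ≠ g ∧ f.pi ⊓ g.tau = ⊥ ∧ g.pi ⊓ f.tau = ⊥
  symm := ⟨fun _ _ h => ⟨h.1.symm, h.2.2, h.2.1⟩⟩
  loopless := ⟨fun _ h => h.1 rfl⟩

/-- `θ_n = q^n + ⋯ + q + 1`, the number of points of an `n`-dimensional projective space of
order `q`; it is the Gaussian coefficient `[n + 1, 1]_q`. -/
def theta (q n : ℕ) : ℕ := ∑ i ∈ Finset.range (n + 1), q ^ i

section Examples

variable {K V : Type*} [Field K] [AddCommGroup V] [Module K V] {d : ℕ}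

/-- The set `F(P, 𝒰)` of all flags `(π, τ)` with `P ∈ π` or `τ ∈ 𝒰`. -/
def pointExample (d : ℕ) (P : Submodule K V) (𝒰 : Set (Submodule K V)) :
    Set (TypeFlag K V d) :=
  {f | P ≤ f.pi ∨ f.tau ∈ 𝒰}

/-- The set `F(H, ℰ)` of all flags `(π, τ)` with `τ ⊆ H` or `π ∈ ℰ`. -/
def hyperplaneExample (d : ℕ) (H : Submodule K V) (ℰ : Set (Submodule K V)) :
    Set (TypeFlag K V d) :=
  {f | f.tau ≤ H ∨ f.pi ∈ ℰ}

/-- `F` is an example based on the point `P`: `F = F(P, 𝒰)` for a set `𝒰` of subspaces of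
projective dimension `d` through `P`, any two of which meet in projective dimension at least `1`
(rank at least `2`). -/
def IsBasedOnPoint (F : Set (TypeFlag K V d)) (P : Submodule K V) : Prop :=
  finrank K P = 1 ∧ ∃ 𝒰 : Set (Submodule K V),
    (∀ τ ∈ 𝒰, finrank K τ = d + 1 ∧ P ≤ τ) ∧
    (∀ τ ∈ 𝒰, ∀ τ' ∈ 𝒰, 2 ≤ finrank K ↥(τ ⊓ τ')) ∧
    F = pointExample d P 𝒰

/-- `F` is an example based on the hyperplane `H` (of a space of rank `2d + 1`): `F = F(H, ℰ)` for
a set `ℰ` of subspaces of `H` of projective dimension `d - 1` with pairwise non-trivial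
intersection. -/
def IsBasedOnHyperplane (F : Set (TypeFlag K V d)) (H : Submodule K V) : Prop :=
  finrank K H = 2 * d ∧ ∃ ℰ : Set (Submodule K V),
    (∀ π ∈ ℰ, finrank K π = d ∧ π ≤ H) ∧
    (∀ π ∈ ℰ, ∀ π' ∈ ℰ, π ⊓ π' ≠ ⊥) ∧
    F = hyperplaneExample d H ℰ

/-- `G` is the generic part of the example `F`: the flags of `F` whose `pi` contains the base point
of `F`, respectively the flags of `F` whose `tau` lies in the base hyperplane of `F`. -/
def IsGenericPart (F G : Set (TypeFlag K V d)) : Prop :=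
  (∃ P, IsBasedOnPoint F P ∧ G = {f ∈ F | P ≤ f.pi}) ∨
    (∃ H, IsBasedOnHyperplane F H ∧ G = {f ∈ F | f.tau ≤ H})

end Examples

set_option linter.unusedSectionVars false

/-! Write q for the order of `K` and g for `genericCard`, the common size of all generic parts.
Outside its generic part an example has only O(q^(d²)) flags (`ncard_intersecting_le`), less than g
by a factor of order q^(d-1), and a set with index outside `S` has at most g/8 flags. As there are
at least q^(d+1) g flags and N ≤ q^(d+1) + 2q^d, the generic parts almost form a partition: |S| ≥
(2/3) q^(d+1), and the multiply covered flags number at most 6 q^d g, counted with multiplicity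
(`generic_cover`).

Hence at least q^(d+1)/3 base points occur, and on average a base point shares few flags with other
base points. So most base points see the others along fewer than 80 q^d lines. Spanning by such
points one at a time keeps the base points concentrated and ends in a subspace U of rank d+2 that
contains a positive proportion c of q^(d+1) base points (`exists_dense_subspace`).

Let J be the indices based in U, m the number of remaining indices, and Z the set of points of U
that are not base points for J. Since U has N + q points, |Z| = m + q. The flags whose π meets U
exactly in a point of Z are covered by members of J only through their small non-generic parts.
Every other set covers at most a fraction 1 - c/2 of one point's worth of them, except for a few
hyperplanes controlled by a variance argument. Comparing with |Z| gives m = O(q²)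
(`IsClassified.few_others`).

To finish, test flags are restricted to those where τ meets U in a line meeting Z and π meets this
line in one chosen point of Z. A member of J covers O(B) of these, where B is the number of such
flags on one line; this gives |Z| = O(q). For so small a Z the O(B) improves to B
(`ncard_le_of_meets_line`), and then the count is sharp enough to force m = 0
(`IsClassified.no_others`). -/

/-! ### Double counting. -/

theorem ncard_mul_eq_ncard_mul {α β : Type*} [Finite α] [Finite β] {s : Set α} {t : Set β}
    (r : α → β → Prop) {m n : ℕ} (hm : ∀ a ∈ s, {b ∈ t | r a b}.ncard = m)
    (hn : ∀ b ∈ t, {a ∈ s | r a b}.ncard = n) : s.ncard * m = t.ncard * n := by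
  classical
  have := Fintype.ofFinite α
  have := Fintype.ofFinite β
  simp only [Set.ncard_eq_toFinset_card'] at *
  refine Finset.card_mul_eq_card_mul r (fun a ha => ?_) (fun b hb => ?_)
  · rw [← hm a (by simpa using ha)]
    congr 1; ext; simp [Finset.bipartiteAbove]
  · rw [← hn b (by simpa using hb)]
    congr 1; ext; simp [Finset.bipartiteBelow]

theorem ncard_eq_mul_of_fibers {α β : Type*} [Finite α] [Finite β] {s : Set α} {t : Set β}
    (f : α → β) {n : ℕ} (hf : ∀ a ∈ s, f a ∈ t)
    (hn : ∀ b ∈ t, {a ∈ s | f a = b}.ncard = n) : s.ncard = t.ncard * n := by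
  rw [← ncard_mul_eq_ncard_mul (fun a b => f a = b) (m := 1) _ hn, mul_one]
  intro a ha
  rw [Set.ncard_eq_one]
  refine ⟨f a, ?_⟩
  ext b
  constructor
  · rintro ⟨_, h⟩
    exact h.symm
  · rintro rfl
    exact ⟨hf a ha, rfl⟩

theorem ncard_le_mul_of_cover {α β : Type*} [Finite α] [Finite β] {s : Set α} {t : Set β}
    (r : β → α → Prop) {n : ℕ} (h1 : ∀ a ∈ s, ∃ b ∈ t, r b a)
    (h2 : ∀ b ∈ t, {a ∈ s | r b a}.ncard ≤ n) : s.ncard ≤ t.ncard * n := by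
  classical
  have := Fintype.ofFinite α
  have := Fintype.ofFinite β
  simp only [Set.ncard_eq_toFinset_card'] at *
  refine le_trans (Finset.card_le_card (t := t.toFinset.biUnion fun b => s.toFinset.filter (r b))
    ?_) (Finset.card_biUnion_le_card_mul _ _ _ fun b hb => ?_)
  · intro a ha
    obtain ⟨b, hb, hr⟩ := h1 a (by simpa using ha)
    simp only [Finset.mem_biUnion, Finset.mem_filter, Set.mem_toFinset]
    exact ⟨b, hb, by simpa using ha, hr⟩
  · convert h2 b (by simpa using hb) using 2
    ext; simp

/-! ### Gaussian coefficients and numbers of subspaces. -/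

/-- `1 + q + ⋯ + q ^ (n - 1)`, the number of points of a space of rank `n`, where `q` is the
order of `K`. -/
noncomputable def qNum (K : Type*) (n : ℕ) : ℕ := ∑ i ∈ Finset.range n, Nat.card K ^ i

/-- The number of subspaces of rank `k` of a space of rank `n` over `K`. -/
noncomputable def grassCard (K : Type*) [Field K] (n k : ℕ) : ℕ :=
  {W : Submodule K (Fin n → K) | finrank K W = k}.ncard

section Counting

variable {K V : Type*} [Field K] [Finite K] [AddCommGroup V] [Module K V] [FiniteDimensional K V]

instance finite_submodule : Finite (Submodule K V) := by
  have : Finite V := Module.finite_of_finite K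
  exact Finite.of_injective (fun W : Submodule K V => (W : Set V)) SetLike.coe_injective

theorem ncard_submodule (k : ℕ) :
    {W : Submodule K V | finrank K W = k}.ncard = grassCard K (finrank K V) k := by
  let e : V ≃ₗ[K] (Fin (finrank K V) → K) := (finBasis K V).equivFun
  refine Set.ncard_congr (fun W _ => W.map (e : V →ₗ[K] _)) ?_ ?_ ?_
  · intro W hW
    simp only [Set.mem_ofPred_eq] at *
    rw [← hW]
    exact LinearEquiv.finrank_map_eq e W
  · intro W W' _ _ h
    exact Submodule.map_injective_of_injective e.injective h
  · intro W hW
    refine ⟨W.map (e.symm : _ →ₗ[K] V), ?_, ?_⟩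
    · simp only [Set.mem_ofPred_eq] at *
      rw [← hW]
      exact LinearEquiv.finrank_map_eq e.symm W
    · rw [← Submodule.map_comp]; simp

theorem ncard_le (B : Submodule K V) (k : ℕ) :
    {W : Submodule K V | W ≤ B ∧ finrank K W = k}.ncard = grassCard K (finrank K B) k := by
  rw [← ncard_submodule (V := B)]
  refine (Set.ncard_congr (fun W _ => W.map B.subtype) ?_ ?_ ?_).symm
  · intro W hW
    simp only [Set.mem_ofPred_eq] at *
    exact ⟨Submodule.map_subtype_le _ _, by rw [← hW, Submodule.finrank_map_subtype_eq]⟩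
  · intro W W' _ _ h
    exact Submodule.map_injective_of_injective B.subtype_injective h
  · rintro W ⟨hW, hk⟩
    have h : (W.comap B.subtype).map B.subtype = W := by
      rw [Submodule.map_comap_subtype, inf_eq_right.2 hW]
    refine ⟨W.comap B.subtype, ?_, h⟩
    rw [Set.mem_ofPred_eq, ← hk, ← Submodule.finrank_map_subtype_eq, h]

theorem finrank_comap_mkQ (A : Submodule K V) (W : Submodule K (V ⧸ A)) :
    finrank K (W.comap A.mkQ) = finrank K A + finrank K W := by
  have h1 := LinearMap.finrank_range_add_finrank_ker (A.mkQ.domRestrict (W.comap A.mkQ))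
  have h2 : LinearMap.range (A.mkQ.domRestrict (W.comap A.mkQ)) = W := by
    rw [LinearMap.range_domRestrict, Submodule.map_comap_eq_of_surjective A.mkQ_surjective]
  have hA : A ≤ W.comap A.mkQ := Submodule.le_comap_mkQ A W
  have h3 : finrank K (LinearMap.ker (A.mkQ.domRestrict (W.comap A.mkQ))) = finrank K A := by
    rw [LinearMap.ker_domRestrict, Submodule.ker_mkQ]
    exact (Submodule.comapSubtypeEquivOfLe hA).finrank_eq
  rw [h2, h3] at h1
  omega

theorem ncard_ge (A : Submodule K V) (k : ℕ) :
    {W : Submodule K V | A ≤ W ∧ finrank K W = finrank K A + k}.ncard =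
      grassCard K (finrank K V - finrank K A) k := by
  have hr : finrank K (V ⧸ A) = finrank K V - finrank K A := by
    have := A.finrank_quotient_add_finrank; omega
  rw [← hr, ← ncard_submodule (V := V ⧸ A)]
  refine (Set.ncard_congr (fun W _ => W.comap A.mkQ) ?_ ?_ ?_).symm
  · intro W hW
    simp only [Set.mem_ofPred_eq] at *
    exact ⟨Submodule.le_comap_mkQ _ _, by rw [finrank_comap_mkQ, hW]⟩
  · intro W W' _ _ h
    exact Submodule.comap_injective_of_surjective A.mkQ_surjective h
  · rintro W ⟨hW, hk⟩
    have h : (W.map A.mkQ).comap A.mkQ = W := by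
      rw [Submodule.comap_map_mkQ, sup_eq_right.2 hW]
    refine ⟨W.map A.mkQ, ?_, h⟩
    have := finrank_comap_mkQ A (W.map A.mkQ)
    rw [h] at this
    rw [Set.mem_ofPred_eq]; omega

/-- The number of subspaces between `A` and `B` of given rank. -/
theorem ncard_interval {A B : Submodule K V} (hAB : A ≤ B) (k : ℕ) :
    {W : Submodule K V | A ≤ W ∧ W ≤ B ∧ finrank K W = finrank K A + k}.ncard =
      grassCard K (finrank K B - finrank K A) k := by
  have hA : finrank K (A.comap B.subtype) = finrank K A :=
    (Submodule.comapSubtypeEquivOfLe hAB).finrank_eq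
  have := ncard_ge (A.comap B.subtype) k
  rw [hA] at this
  rw [← this]
  refine (Set.ncard_congr (fun W _ => W.map B.subtype) ?_ ?_ ?_).symm
  · rintro W ⟨hW1, hW⟩
    refine ⟨?_, Submodule.map_subtype_le _ _, by rw [← hW, Submodule.finrank_map_subtype_eq]⟩
    have := Submodule.map_mono (f := B.subtype) hW1
    rwa [Submodule.map_comap_subtype, inf_eq_right.2 hAB] at this
  · intro W W' _ _ h
    exact Submodule.map_injective_of_injective B.subtype_injective h
  · rintro W ⟨hAW, hW, hk⟩
    have h : (W.comap B.subtype).map B.subtype = W := by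
      rw [Submodule.map_comap_subtype, inf_eq_right.2 hW]
    refine ⟨W.comap B.subtype, ⟨Submodule.comap_mono hAW, ?_⟩, h⟩
    rw [← hk, ← Submodule.finrank_map_subtype_eq, h]

theorem grassCard_one (n : ℕ) : grassCard K n 1 = qNum K n := by
  have h := ncard_submodule (K := K) (V := Fin n → K) 1
  rw [finrank_fin_fun] at h
  rw [← h, qNum, ← Projectivization.card_of_finrank K (Fin n → K) (finrank_fin_fun K),
    Nat.card_congr (Projectivization.equivSubmodule K (Fin n → K))]
  rfl

theorem grassCard_zero (n : ℕ) : grassCard K n 0 = 1 := by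
  rw [grassCard, Set.ncard_eq_one]
  refine ⟨⊥, ?_⟩
  ext W
  simp

/-- Incidences of points with subspaces of rank `k + 1`, counted from both sides. The recursion
avoids division, and the upper and lower estimates of `grassCard` follow from it. -/
theorem grassCard_mul_qNum (n k : ℕ) :
    grassCard K (n + 1) (k + 1) * qNum K (k + 1) = qNum K (n + 1) * grassCard K n k := by
  rw [← grassCard_one (n + 1)]
  change {W : Submodule K (Fin (n + 1) → K) | finrank K W = k + 1}.ncard * _ =
    {P : Submodule K (Fin (n + 1) → K) | finrank K P = 1}.ncard * _
  refine ncard_mul_eq_ncard_mul (fun W P => P ≤ W) ?_ ?_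
  · rintro W (hW : finrank K W = k + 1)
    rw [← grassCard_one, ← hW, ← ncard_le]
    congr 1; ext; simp [and_comm]
  · rintro P (hP : finrank K P = 1)
    have := ncard_ge P k
    rw [hP, finrank_fin_fun, Nat.add_sub_cancel] at this
    rw [← this]
    congr 1; ext; simp [and_comm, add_comm]

theorem qNum_pos (n : ℕ) : 0 < qNum K (n + 1) := by
  rw [qNum, Finset.sum_range_succ']; simp

theorem grassCard_succ_self (m : ℕ) : grassCard K (m + 1) m = qNum K (m + 1) := by
  induction m with
  | zero => simp [grassCard_zero, qNum]
  | succ m ih =>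
    have h := grassCard_mul_qNum (K := K) (m + 1) m
    rw [ih] at h
    exact Nat.eq_of_mul_eq_mul_right (qNum_pos m) h

theorem grassCard_mul_qNum_sub (n k : ℕ) :
    grassCard K n k * qNum K (n - k) = grassCard K n (k + 1) * qNum K (k + 1) := by
  change {W : Submodule K (Fin n → K) | finrank K W = k}.ncard * _ =
    {W : Submodule K (Fin n → K) | finrank K W = k + 1}.ncard * _
  refine ncard_mul_eq_ncard_mul (fun W W' => W ≤ W') ?_ ?_
  · rintro W (hW : finrank K W = k)
    have := ncard_ge W 1
    rw [hW, finrank_fin_fun, grassCard_one] at this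
    rw [← this]
    congr 1; ext; simp [and_comm]
  · rintro W (hW : finrank K W = k + 1)
    rw [← grassCard_succ_self, ← hW, ← ncard_le]
    congr 1; ext; simp [and_comm]


theorem qNum_succ (n : ℕ) : qNum K (n + 1) = qNum K n + Nat.card K ^ n := by
  rw [qNum, Finset.sum_range_succ]; rfl

theorem qNum_succ' (n : ℕ) : qNum K (n + 1) = Nat.card K * qNum K n + 1 := by
  rw [qNum, Finset.sum_range_succ', qNum, Finset.mul_sum]
  simp [pow_succ']

theorem qNum_mul_pred (n : ℕ) : (qNum K n : ℝ) * ((Nat.card K : ℝ) - 1) = (Nat.card K : ℝ) ^ n - 1 := by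
  induction n with
  | zero => simp [qNum]
  | succ n ih => rw [qNum_succ]; push_cast; rw [add_mul, ih]; ring

theorem pow_le_qNum (n : ℕ) : Nat.card K ^ n ≤ qNum K (n + 1) := by
  rw [qNum_succ]; omega

theorem qNum_add_one_le (n : ℕ) : qNum K n + 1 ≤ Nat.card K ^ n := by
  have h2 : 2 ≤ Nat.card K := Finite.one_lt_card
  induction n with
  | zero => simp [qNum]
  | succ n ih => rw [qNum_succ, pow_succ]; nlinarith

theorem qNum_succ_le (n : ℕ) : qNum K (n + 1) ≤ 2 * Nat.card K ^ n := by
  have := qNum_add_one_le (K := K) n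
  rw [qNum_succ]; omega

theorem pow_mul_qNum_le (n k : ℕ) : Nat.card K ^ n * qNum K k ≤ qNum K (n + k) := by
  induction n with
  | zero => simp
  | succ n ih => rw [add_right_comm, qNum_succ', pow_succ']; nlinarith

theorem pow_le_grassCard (n k : ℕ) : Nat.card K ^ (k * n) ≤ grassCard K (n + k) k := by
  induction k with
  | zero => simp [grassCard_zero]
  | succ k ih =>
    have h := grassCard_mul_qNum (K := K) (n + k) k
    have h1 := pow_mul_qNum_le (K := K) n (k + 1)
    refine Nat.le_of_mul_le_mul_right (c := qNum K (k + 1)) ?_ (qNum_pos k)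
    rw [← add_assoc] at h1
    rw [← add_assoc, h, add_mul, one_mul, pow_add]
    nlinarith [Nat.mul_le_mul ih h1]

/-- The Gaussian coefficient is at most q^(kn) divided by the product of the factors 1 - q^(-i), i =
1, ..., k. That product is at least 1 - ∑ q^(-i), which is (q^k - `qNum K k`)/q^k; the induction
adds one factor at a time. -/
theorem grassCard_mul_pow_sub_le (n k : ℕ) :
    (grassCard K (n + k) k : ℝ) * ((Nat.card K : ℝ) ^ k - qNum K k) ≤
      (Nat.card K : ℝ) ^ (k * n + k) := by
  have h2 : (2 : ℝ) ≤ Nat.card K := by exact_mod_cast (Finite.one_lt_card : 1 < Nat.card K)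
  set Q : ℝ := (Nat.card K : ℝ) with hQ
  induction k with
  | zero => simp [grassCard_zero, qNum]
  | succ k ih =>
    have h : (grassCard K (n + k + 1) (k + 1) : ℝ) * qNum K (k + 1) =
      qNum K (n + k + 1) * grassCard K (n + k) k := by exact_mod_cast grassCard_mul_qNum (n + k) k
    have e1 := qNum_mul_pred (K := K) (k + 1)
    have e2 := qNum_mul_pred (K := K) (n + k + 1)
    rw [← hQ] at e1 e2
    have h' : (grassCard K (n + k + 1) (k + 1) : ℝ) * (Q ^ (k + 1) - 1) =
        (Q ^ (n + k + 1) - 1) * grassCard K (n + k) k := by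
      rw [← e1, ← e2]; linear_combination (Q - 1) * h
    have hq : (qNum K (k + 1) : ℝ) = Q * qNum K k + 1 := by rw [qNum_succ']; push_cast; rfl
    have hk : (qNum K k : ℝ) + 1 ≤ Q ^ k := by
      rw [hQ]; exact_mod_cast qNum_add_one_le k
    have hpos : 0 < Q ^ (k + 1) - 1 := by
      have : 1 ≤ Q ^ k := one_le_pow₀ (by linarith)
      rw [pow_succ]; nlinarith
    rw [← add_assoc]
    refine le_of_mul_le_mul_right ?_ hpos
    have hG : (0 : ℝ) ≤ grassCard K (n + k) k := by positivity
    have hle : (Q ^ (k + 1) - (Q * qNum K k + 1)) * Q ^ k ≤ (Q ^ (k + 1) - 1) * (Q ^ k - qNum K k) := by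
      have : (0 : ℝ) ≤ qNum K k := by positivity
      rw [pow_succ]; nlinarith
    have hQk : 0 < Q ^ k := by positivity
    have step : (Q ^ (k + 1) - (Q * qNum K k + 1)) * Q ^ k * grassCard K (n + k) k ≤
        (Q ^ (k + 1) - 1) * Q ^ (k * n + k) := by
      calc _ ≤ (Q ^ (k + 1) - 1) * (Q ^ k - qNum K k) * grassCard K (n + k) k := by gcongr
        _ = (Q ^ (k + 1) - 1) * (grassCard K (n + k) k * (Q ^ k - qNum K k)) := by ring
        _ ≤ _ := by gcongr
    have hnn : 0 ≤ Q ^ (k + 1) - (Q * qNum K k + 1) := by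
      rw [pow_succ]; nlinarith
    calc (grassCard K (n + k + 1) (k + 1) : ℝ) * (Q ^ (k + 1) - qNum K (k + 1)) * (Q ^ (k + 1) - 1)
        = (Q ^ (k + 1) - (Q * qNum K k + 1)) * ((Q ^ (n + k + 1) - 1) * grassCard K (n + k) k) := by
          rw [← h', hq]; ring
      _ ≤ (Q ^ (k + 1) - (Q * qNum K k + 1)) * ((Q ^ (n + 1) * Q ^ k) * grassCard K (n + k) k) := by
          gcongr
          rw [← pow_add]
          have : n + 1 + k = n + k + 1 := by ring
          rw [this]; linarith
      _ = Q ^ (n + 1) * ((Q ^ (k + 1) - (Q * qNum K k + 1)) * Q ^ k * grassCard K (n + k) k) := by ring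
      _ ≤ Q ^ (n + 1) * ((Q ^ (k + 1) - 1) * Q ^ (k * n + k)) := by gcongr
      _ = Q ^ ((k + 1) * n + (k + 1)) * (Q ^ (k + 1) - 1) := by ring

/-- The geometric series gives the factor (q-1)/(q-2), and this is at most 1 + 2/q precisely from q
= 4 on. -/
theorem grassCard_le (n k : ℕ) (h4 : 4 ≤ Nat.card K) :
    (grassCard K (n + k) k : ℝ) ≤ (1 + 2 / (Nat.card K : ℝ)) * (Nat.card K : ℝ) ^ (k * n) := by
  have h := grassCard_mul_pow_sub_le (K := K) n k
  have e := qNum_mul_pred (K := K) k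
  have hQ : (4 : ℝ) ≤ Nat.card K := by exact_mod_cast h4
  set Q : ℝ := (Nat.card K : ℝ)
  have hG : (0 : ℝ) ≤ grassCard K (n + k) k := by positivity
  have hk : 0 < Q ^ k := by positivity
  have h1 : (grassCard K (n + k) k : ℝ) * (Q - 2) ≤ (Q - 1) * Q ^ (k * n) := by
    refine le_of_mul_le_mul_right ?_ hk
    calc (grassCard K (n + k) k : ℝ) * (Q - 2) * Q ^ k
        ≤ grassCard K (n + k) k * ((Q - 1) * (Q ^ k - qNum K k)) := by
          rw [mul_assoc]; exact mul_le_mul_of_nonneg_left (by nlinarith) hG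
      _ = (Q - 1) * (grassCard K (n + k) k * (Q ^ k - qNum K k)) := by ring
      _ ≤ (Q - 1) * Q ^ (k * n + k) := by gcongr; linarith
      _ = _ := by ring
  refine le_of_mul_le_mul_right (h1.trans ?_) (by linarith : 0 < Q - 2)
  have h3 : Q - 1 ≤ (1 + 2 / Q) * (Q - 2) := by
    rw [one_add_div (by linarith), div_mul_eq_mul_div, le_div_iff₀ (by linarith)]; nlinarith
  have : 0 ≤ Q ^ (k * n) := by positivity
  nlinarith

theorem grassCard_le_two_mul (n k : ℕ) (h4 : 4 ≤ Nat.card K) :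
    grassCard K (n + k) k ≤ 2 * Nat.card K ^ (k * n) := by
  have h := grassCard_le (K := K) n k h4
  have hQ : (4 : ℝ) ≤ Nat.card K := by exact_mod_cast h4
  have : (2 : ℝ) / Nat.card K ≤ 1 := by rw [div_le_one (by linarith)]; linarith
  have h5 : (0 : ℝ) ≤ (Nat.card K : ℝ) ^ (k * n) := by positivity
  have : (grassCard K (n + k) k : ℝ) ≤ 2 * (Nat.card K : ℝ) ^ (k * n) := by nlinarith
  exact_mod_cast this

/-- The number of complements of a subspace. -/
theorem ncard_isCompl (U : Submodule K V) :
    {W : Submodule K V | IsCompl U W}.ncard =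
      Nat.card K ^ (finrank K U * (finrank K V - finrank K U)) := by
  have e1 : {W : Submodule K V | IsCompl U W}.ncard =
      Nat.card {f : V →ₗ[K] U // ∀ x : U, f x = x} := Nat.card_congr U.isComplEquivProj
  obtain ⟨W, hW⟩ := U.exists_isCompl
  obtain ⟨p, hp⟩ := U.isComplEquivProj ⟨W, hW⟩
  -- Complements of `U` correspond to projections onto `U`. Two projections differ by a map that
  -- vanishes on `U`, so fixing `p` identifies them with Hom(V/U, U).
  have e2 : {f : V →ₗ[K] U // ∀ x : U, f x = x} ≃ ((V ⧸ U) →ₗ[K] U) :=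
    { toFun := fun f => U.liftQ (f.1 - p) (by
        intro x hx
        have h1 := f.2 ⟨x, hx⟩
        have h2 := hp ⟨x, hx⟩
        simp only [LinearMap.mem_ker, LinearMap.sub_apply] at *
        rw [h1, h2, sub_self])
      invFun := fun g => ⟨g ∘ₗ U.mkQ + p, by
        intro x
        have h2 := hp x
        have : U.mkQ (x : V) = 0 := by simp
        rw [LinearMap.add_apply, LinearMap.comp_apply, this, map_zero, zero_add, h2]⟩
      left_inv := by
        intro f
        ext x
        simp
      right_inv := by
        intro g
        ext x
        simp }
  rw [e1, Nat.card_congr e2]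
  have : Finite V := Module.finite_of_finite K
  have : Fintype K := Fintype.ofFinite K
  rw [Module.natCard_eq_pow_finrank (K := K), Module.finrank_linearMap, mul_comm]
  have := U.finrank_quotient_add_finrank
  congr 2; omega

/-- Modulo `A` the condition says that the two images are disjoint, and `hk` makes their ranks
complementary; so this counts complements in the quotient. -/
theorem ncard_inf_eq {A U : Submodule K V} (hAU : A ≤ U) {k : ℕ}
    (hk : finrank K V + finrank K A = finrank K U + k) :
    {W : Submodule K V | W ⊓ U = A ∧ finrank K W = k}.ncard =
      Nat.card K ^ ((finrank K U - finrank K A) * (k - finrank K A)) := by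
  have hr := A.finrank_quotient_add_finrank
  have hU : (U.map A.mkQ).comap A.mkQ = U := by rw [Submodule.comap_map_mkQ, sup_eq_right.2 hAU]
  have hU' := finrank_comap_mkQ A (U.map A.mkQ)
  rw [hU] at hU'
  have hc := ncard_isCompl (U.map A.mkQ)
  have e1 : finrank K (U.map A.mkQ) = finrank K U - finrank K A := by omega
  have hUV := U.finrank_le
  have e2 : finrank K (V ⧸ A) - (finrank K U - finrank K A) = k - finrank K A := by omega
  rw [e1, e2] at hc
  rw [← hc]
  refine (Set.ncard_congr (fun W _ => W.comap A.mkQ) ?_ ?_ ?_).symm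
  · intro W hW
    rw [Set.mem_ofPred_eq] at hW
    have h1 := Submodule.finrank_add_eq_of_isCompl hW
    refine ⟨?_, by rw [finrank_comap_mkQ]; omega⟩
    rw [← hU, ← Submodule.comap_inf, inf_comm, hW.inf_eq_bot, Submodule.comap_bot,
      Submodule.ker_mkQ]
  · intro W W' _ _ h
    exact Submodule.comap_injective_of_surjective A.mkQ_surjective h
  · rintro W ⟨hW, hkW⟩
    have hAW : A ≤ W := by rw [← hW]; exact inf_le_left
    have h : (W.map A.mkQ).comap A.mkQ = W := by
      rw [Submodule.comap_map_mkQ, sup_eq_right.2 hAW]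
    refine ⟨W.map A.mkQ, ?_, h⟩
    have hW' := finrank_comap_mkQ A (W.map A.mkQ)
    rw [h] at hW'
    have hinf : U.map A.mkQ ⊓ W.map A.mkQ = ⊥ := by
      apply Submodule.comap_injective_of_surjective A.mkQ_surjective
      change (U.map A.mkQ ⊓ W.map A.mkQ).comap A.mkQ = (⊥ : Submodule K (V ⧸ A)).comap A.mkQ
      rw [Submodule.comap_inf, h, hU, inf_comm, hW, Submodule.comap_bot, Submodule.ker_mkQ]
    refine (Submodule.isCompl_iff_disjoint _ _ ?_).2 (disjoint_iff.2 hinf)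
    omega

end Counting

/-! ### Numbers of flags. -/

section Flags

variable {K V : Type*} [Field K] [Finite K] [AddCommGroup V] [Module K V] [FiniteDimensional K V]
  {d : ℕ}

instance finite_typeFlag : Finite (TypeFlag K V d) :=
  Finite.of_injective (fun f : TypeFlag K V d => (f.pi, f.tau)) (by
    intro f g h
    exact TypeFlag.ext (congrArg Prod.fst h) (congrArg Prod.snd h))

theorem ncard_flags_pi_eq {H π : Submodule K V} (hπ : finrank K π = d) (hπH : π ≤ H) :
    {f : TypeFlag K V d | f.pi = π ∧ f.tau ≤ H}.ncard = qNum K (finrank K H - d) := by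
  have h := ncard_interval hπH 1
  rw [hπ, grassCard_one] at h
  rw [← h]
  refine Set.ncard_congr (fun f _ => f.tau) ?_ ?_ ?_
  · rintro f ⟨rfl, hf⟩
    exact ⟨f.pi_le_tau, hf, f.finrank_tau⟩
  · rintro f g ⟨hf, _⟩ ⟨hg, _⟩ h
    exact TypeFlag.ext (hf.trans hg.symm) h
  · rintro τ ⟨h1, h2, h3⟩
    exact ⟨⟨π, τ, hπ, h3, h1⟩, ⟨rfl, h2⟩, rfl⟩

theorem ncard_flags_tau_eq {R τ : Submodule K V} (hτ : finrank K τ = d + 1) (hRτ : R ≤ τ)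
    (hR : finrank K R ≤ d) :
    {f : TypeFlag K V d | f.tau = τ ∧ R ≤ f.pi}.ncard = qNum K (d + 1 - finrank K R) := by
  have h := ncard_interval hRτ (d - finrank K R)
  have e : d + 1 - finrank K R = (d - finrank K R) + 1 := by omega
  rw [hτ, e, grassCard_succ_self] at h
  rw [e, ← h]
  refine Set.ncard_congr (fun f _ => f.pi) ?_ ?_ ?_
  · rintro f ⟨rfl, hf⟩
    exact ⟨hf, f.pi_le_tau, by rw [f.finrank_pi]; omega⟩
  · rintro f g ⟨hf, _⟩ ⟨hg, _⟩ h
    exact TypeFlag.ext h (hf.trans hg.symm)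
  · rintro π ⟨h1, h2, h3⟩
    exact ⟨⟨π, τ, by omega, hτ, h2⟩, ⟨rfl, h1⟩, rfl⟩

theorem ncard_flags_pi_mem (hV : finrank K V = 2 * d + 1) (s : Set (Submodule K V))
    (hs : ∀ π ∈ s, finrank K π = d) :
    {f : TypeFlag K V d | f.pi ∈ s}.ncard = s.ncard * qNum K (d + 1) := by
  refine ncard_eq_mul_of_fibers (fun f => f.pi) (fun f hf => hf) fun π hπ => ?_
  have h := ncard_flags_pi_eq (H := ⊤) (hs π hπ) le_top
  rw [finrank_top, hV, show 2 * d + 1 - d = d + 1 by omega] at h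
  rw [← h]
  congr 1; ext f
  constructor
  · rintro ⟨_, h⟩
    exact ⟨h, le_top⟩
  · rintro ⟨rfl, _⟩
    exact ⟨hπ, rfl⟩

theorem ncard_flags_tau_mem (s : Set (Submodule K V)) (hs : ∀ τ ∈ s, finrank K τ = d + 1) :
    {f : TypeFlag K V d | f.tau ∈ s}.ncard = s.ncard * qNum K (d + 1) := by
  refine ncard_eq_mul_of_fibers (fun f => f.tau) (fun f hf => hf) fun τ hτ => ?_
  have h := ncard_flags_tau_eq (R := ⊥) (hs τ hτ) bot_le (by simp)
  rw [finrank_bot, Nat.sub_zero] at h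
  rw [← h]
  congr 1; ext f
  constructor
  · rintro ⟨_, h⟩
    exact ⟨h, bot_le⟩
  · rintro ⟨rfl, _⟩
    exact ⟨hτ, rfl⟩

/-- The number of flags in an interval of subspaces. -/
theorem ncard_flags_between {R H : Submodule K V} (hRH : R ≤ H) (hR : finrank K R ≤ d) :
    {f : TypeFlag K V d | R ≤ f.pi ∧ f.tau ≤ H}.ncard =
      grassCard K (finrank K H - finrank K R) (d - finrank K R) * qNum K (finrank K H - d) := by
  rw [← ncard_interval hRH]
  refine ncard_eq_mul_of_fibers (fun f => f.pi) ?_ fun π hπ => ?_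
  · rintro f ⟨h1, h2⟩
    exact ⟨h1, f.pi_le_tau.trans h2, by rw [f.finrank_pi]; omega⟩
  · obtain ⟨h1, h2, h3⟩ := hπ
    rw [← ncard_flags_pi_eq (by omega) h2]
    congr 1; ext f
    constructor
    · rintro ⟨⟨_, h⟩, h'⟩
      exact ⟨h', h⟩
    · rintro ⟨rfl, h⟩
      exact ⟨⟨h1, h⟩, rfl⟩

theorem ncard_flags_ge (hV : finrank K V = 2 * d + 1) {R : Submodule K V} (hR : finrank K R ≤ d) :
    {f : TypeFlag K V d | R ≤ f.pi}.ncard =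
      grassCard K (2 * d + 1 - finrank K R) (d - finrank K R) * qNum K (d + 1) := by
  have h := ncard_flags_between (R := R) (H := ⊤) le_top hR
  rw [finrank_top, hV, show 2 * d + 1 - d = d + 1 by omega] at h
  rw [← h]
  simp

theorem ncard_flags (hV : finrank K V = 2 * d + 1) :
    (Set.univ : Set (TypeFlag K V d)).ncard = grassCard K (2 * d + 1) d * qNum K (d + 1) := by
  have h := ncard_flags_ge (d := d) hV (R := ⊥) (by simp)
  rw [finrank_bot, Nat.sub_zero, Nat.sub_zero] at h
  rw [← h]
  simp

/-- The number of flags `(π, τ)` with a given point in `π`. -/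
noncomputable def genericCard (K : Type*) [Field K] (d : ℕ) : ℕ :=
  grassCard K (2 * d) (d - 1) * qNum K (d + 1)

theorem ncard_flags_point (hd : 1 ≤ d) (hV : finrank K V = 2 * d + 1) {P : Submodule K V}
    (hP : finrank K P = 1) : {f : TypeFlag K V d | P ≤ f.pi}.ncard = genericCard K d := by
  rw [ncard_flags_ge hV (by omega), hP]; rfl

/-- Point-based and hyperplane-based generic parts have the same size, so one constant serves for
both. An identity of Gaussian coefficients takes the place of duality. -/
theorem ncard_flags_hyperplane (hd : 1 ≤ d) {H : Submodule K V} (hH : finrank K H = 2 * d) :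
    {f : TypeFlag K V d | f.tau ≤ H}.ncard = genericCard K d := by
  have h := ncard_flags_between (d := d) (R := ⊥) (H := H) bot_le (by simp)
  have e := grassCard_mul_qNum_sub (K := K) (2 * d) (d - 1)
  rw [show 2 * d - (d - 1) = d + 1 by omega, show d - 1 + 1 = d by omega] at e
  rw [finrank_bot, hH, Nat.sub_zero, Nat.sub_zero, show 2 * d - d = d by omega, ← e] at h
  rw [genericCard, ← h]
  simp

theorem ncard_flags_mul_qNum (hd : 1 ≤ d) (hV : finrank K V = 2 * d + 1) :
    (Set.univ : Set (TypeFlag K V d)).ncard * qNum K d = qNum K (2 * d + 1) * genericCard K d := by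
  have e := grassCard_mul_qNum (K := K) (2 * d) (d - 1)
  rw [show d - 1 + 1 = d by omega] at e
  rw [ncard_flags hV, genericCard]
  linear_combination qNum K (d + 1) * e

/-! ### Families of subspaces that pairwise meet beyond a fixed subspace. -/

theorem finrank_sup_of_inf_eq {A R Q : Submodule K V} {k : ℕ} (h : R ⊓ Q = A)
    (hQ : finrank K Q = finrank K A + k) : finrank K ↥(R ⊔ Q) = finrank K R + k := by
  have := Submodule.finrank_sup_add_finrank_inf_eq R Q
  rw [h] at this; omega

theorem exists_finrank_succ {A X : Submodule K V} (hAX : A ≤ X) (h : X ≠ A) :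
    ∃ Q, A ≤ Q ∧ Q ≤ X ∧ finrank K Q = finrank K A + 1 := by
  obtain ⟨v, hv, hvA⟩ := SetLike.exists_of_lt (lt_of_le_of_ne hAX h.symm)
  have hs : K ∙ v ≤ X := by simpa using hv
  refine ⟨A ⊔ K ∙ v, le_sup_left, sup_le hAX hs, ?_⟩
  have hv0 : v ≠ 0 := fun h => hvA (h ▸ A.zero_mem)
  refine (finrank_sup_of_inf_eq (A := ⊥) ?_ (k := 1) ?_)
  · exact disjoint_iff.1 ((Submodule.disjoint_span_singleton' hv0).2 hvA)
  · rw [finrank_span_singleton hv0, finrank_bot]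

/-- If every member of a family contains one of the minimal proper overspaces of `A` in `X`, the
family is small as soon as the members containing a given one of these are few. -/
theorem ncard_le_qNum_mul {A X : Submodule K V} {m n : ℕ} (hAX : A ≤ X)
    (hX : finrank K X = finrank K A + m) {s : Set (Submodule K V)} (c : Submodule K V → Prop)
    (h : ∀ τ ∈ s, ∃ Q, A ≤ Q ∧ Q ≤ X ∧ finrank K Q = finrank K A + 1 ∧ Q ≤ τ ∧ c Q)
    (hn : ∀ Q, A ≤ Q → Q ≤ X → finrank K Q = finrank K A + 1 → c Q →
      {τ ∈ s | Q ≤ τ}.ncard ≤ n) : s.ncard ≤ qNum K m * n := by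
  have e := ncard_interval hAX 1
  rw [grassCard_one, hX, Nat.add_sub_cancel_left] at e
  rw [← e]
  refine (ncard_le_mul_of_cover (fun Q τ => Q ≤ τ ∧ c Q) (fun τ hτ => ?_) (fun Q hQ => ?_))
  · obtain ⟨Q, h1, h2, h3, h4⟩ := h τ hτ
    exact ⟨Q, ⟨h1, h2, h3⟩, h4⟩
  · by_cases hc : c Q
    · refine le_trans (Set.ncard_le_ncard ?_ (Set.toFinite _)) (hn Q hQ.1 hQ.2.1 hQ.2.2 hc)
      exact fun τ hτ => ⟨hτ.1, hτ.2.1⟩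
    · have : {a | a ∈ s ∧ Q ≤ a ∧ c Q} = ∅ := by
        ext; simp [hc]
      rw [this]; simp

theorem ncard_ge_le {R : Submodule K V} {s : Set (Submodule K V)} {n k : ℕ}
    (h4 : 4 ≤ Nat.card K) (hn : finrank K V = finrank K R + (n + k))
    (hs : ∀ τ ∈ s, R ≤ τ ∧ finrank K τ = finrank K R + k) :
    s.ncard ≤ 2 * Nat.card K ^ (k * n) := by
  have h := ncard_ge R k
  rw [show finrank K V - finrank K R = n + k by omega] at h
  exact (Set.ncard_le_ncard (fun τ hτ => hs τ hτ) (Set.toFinite _)).trans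
    (h.trans_le (grassCard_le_two_mul n k h4))

/-- A family of rank `d` subspaces of a space of rank `2d` that pairwise intersect nontrivially
has size `O(q ^ (d ^ 2 - d))`, stated for an interval of subspaces. -/
theorem ncard_intersecting_le {A B : Submodule K V} (hB : finrank K B = finrank K A + 2 * d)
    (h4 : 4 ≤ Nat.card K) (𝒰 : Set (Submodule K V))
    (h1 : ∀ τ ∈ 𝒰, A ≤ τ ∧ τ ≤ B ∧ finrank K τ = finrank K A + d)
    (h2 : ∀ τ ∈ 𝒰, ∀ τ' ∈ 𝒰, τ ⊓ τ' ≠ A) :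
    𝒰.ncard ≤ 2 ^ (d + 1) * Nat.card K ^ (d * (d - 1)) := by
  classical
  rcases 𝒰.eq_empty_or_nonempty with rfl | ⟨τ₁, hτ₁⟩
  · simp
  -- `t` is the least rank modulo `A` of a subspace that meets every member beyond `A`; any member
  -- is such a subspace, whence `t ≤ d`.
  have hex : ∃ t, ∃ W, A ≤ W ∧ finrank K W = finrank K A + t ∧ ∀ τ ∈ 𝒰, τ ⊓ W ≠ A :=
    ⟨d, τ₁, (h1 _ hτ₁).1, (h1 _ hτ₁).2.2, fun τ hτ => h2 τ hτ τ₁ hτ₁⟩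
  set t := Nat.find hex with ht
  obtain ⟨W, hAW, hW, hWc⟩ := Nat.find_spec hex
  rw [← ht] at hW
  have htd : t ≤ d := Nat.find_min' hex
    ⟨τ₁, (h1 _ hτ₁).1, (h1 _ hτ₁).2.2, fun τ hτ => h2 τ hτ τ₁ hτ₁⟩
  have ht1 : 1 ≤ t := by
    by_contra h0
    have : finrank K W = finrank K A := by omega
    have hWA : A = W := Submodule.eq_of_le_of_finrank_eq hAW this.symm
    exact hWc τ₁ hτ₁ (by rw [← hWA]; exact inf_eq_right.2 (h1 _ hτ₁).1)
  have hmin : ∀ R, A ≤ R → finrank K R < finrank K A + t → ∃ τ ∈ 𝒰, τ ⊓ R = A := by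
    intro R hAR hR
    by_contra hcon
    push Not at hcon
    have hle := Submodule.finrank_mono hAR
    exact Nat.find_min hex (m := finrank K R - finrank K A) (by omega) ⟨R, hAR, by omega, hcon⟩
  -- By minimality of `t`, an `R` of smaller rank meets some member `τ₀` only in `A`. Every member
  -- through `R` meets `τ₀` beyond `A`, so it contains one of `qNum K d` extensions of `R`. After
  -- `j` extensions the rank is `t` modulo `A`, and at most 2 q^((d-t)d) members remain.
  have key : ∀ j, j ≤ t → ∀ R, A ≤ R → finrank K R + j = finrank K A + t →
      {τ ∈ 𝒰 | R ≤ τ}.ncard ≤ qNum K d ^ j * (2 * Nat.card K ^ ((d - t) * d)) := by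
    intro j
    induction j with
    | zero =>
      intro _ R hAR hR
      rw [pow_zero, one_mul]
      by_cases hRB : R ≤ B
      · have h := ncard_interval hRB (d - t)
        rw [show finrank K B - finrank K R = d + (d - t) by omega] at h
        refine (Set.ncard_le_ncard ?_ (Set.toFinite _)).trans
          (h.trans_le (grassCard_le_two_mul d (d - t) h4))
        rintro τ ⟨hτ, hRτ⟩
        obtain ⟨_, h5, h6⟩ := h1 τ hτ
        exact ⟨hRτ, h5, by omega⟩
      · have : {τ ∈ 𝒰 | R ≤ τ} = ∅ := by
          ext τ
          simp only [Set.mem_ofPred_eq, Set.mem_empty_iff_false, iff_false, not_and]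
          exact fun hτ h => hRB (h.trans (h1 τ hτ).2.1)
        rw [this]; simp
    | succ j ih =>
      intro hj R hAR hR
      obtain ⟨τ₀, hτ₀, hR0⟩ := hmin R hAR (by omega)
      obtain ⟨h5, _, h6⟩ := h1 τ₀ hτ₀
      rw [pow_succ', mul_assoc]
      refine ncard_le_qNum_mul h5 h6 (fun _ => True) ?_ ?_
      · rintro τ ⟨hτ, hRτ⟩
        obtain ⟨Q, hQ1, hQ2, hQ3⟩ := exists_finrank_succ (le_inf h5 (h1 τ hτ).1) (h2 τ₀ hτ₀ τ hτ)
        exact ⟨Q, hQ1, hQ2.trans inf_le_left, hQ3, hQ2.trans inf_le_right, trivial⟩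
      · intro Q hQ1 hQ2 hQ3 _
        have hinf : R ⊓ Q = A := by
          refine le_antisymm ?_ (le_inf hAR hQ1)
          rw [← hR0, inf_comm]
          exact inf_le_inf_right _ hQ2
        have hrk := finrank_sup_of_inf_eq hinf hQ3
        refine le_trans (Set.ncard_le_ncard ?_ (Set.toFinite _))
          (ih (by omega) (R ⊔ Q) (hAR.trans le_sup_left) (by omega))
        rintro τ ⟨⟨hτ, h7⟩, h8⟩
        exact ⟨hτ, sup_le h7 h8⟩
  have hfin : 𝒰.ncard ≤ qNum K t * (qNum K d ^ (t - 1) * (2 * Nat.card K ^ ((d - t) * d))) := by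
    refine ncard_le_qNum_mul hAW hW (fun _ => True) ?_ ?_
    · intro τ hτ
      obtain ⟨Q, hQ1, hQ2, hQ3⟩ := exists_finrank_succ (le_inf (h1 τ hτ).1 hAW) (hWc τ hτ)
      exact ⟨Q, hQ1, hQ2.trans inf_le_right, hQ3, hQ2.trans inf_le_left, trivial⟩
    · intro Q hQ1 hQ2 hQ3 _
      exact key (t - 1) (by omega) Q hQ1 (by omega)
  clear_value t
  obtain ⟨s, rfl⟩ : ∃ s, t = s + 1 := ⟨t - 1, by omega⟩
  obtain ⟨e, rfl⟩ : ∃ e, d = s + 1 + e := ⟨d - (s + 1), by omega⟩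
  rw [Nat.add_sub_cancel, Nat.add_sub_cancel_left] at hfin
  have hq : 0 < Nat.card K := by omega
  -- The exponents add up to (t-1) + (d-1)(t-1) + (d-t)d = d(d-1), whatever `t` is.
  calc 𝒰.ncard ≤ _ := hfin
    _ ≤ (2 * Nat.card K ^ s) * ((2 * Nat.card K ^ (s + e)) ^ s *
        (2 * Nat.card K ^ (e * (s + 1 + e)))) := by
        have h5 := qNum_succ_le (K := K) s
        have h6 := qNum_succ_le (K := K) (s + e)
        rw [show s + e + 1 = s + 1 + e by ring] at h6
        gcongr
    _ = 2 ^ (s + 2) * Nat.card K ^ ((s + 1 + e) * (s + e)) := by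
        rw [mul_pow, ← pow_mul]; ring
    _ ≤ _ := by
        rw [show s + 1 + e - 1 = s + e by omega]
        exact Nat.mul_le_mul_right _ (Nat.pow_le_pow_right (by norm_num) (by omega))

end Flags

/-! ### The sharp bound for families through a point with prescribed traces on a subspace. -/

section TwoLines

variable {K V : Type*} [Field K] [Finite K] [AddCommGroup V] [Module K V] [FiniteDimensional K V]
  {d : ℕ}

theorem eq_of_rank_succ {P L X : Submodule K V} (hPL : P ≤ L) (hPX : P ≤ X)
    (hL : finrank K L = finrank K P + 1) (h : ¬ L ≤ X) : L ⊓ X = P := by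
  have h1 : P ≤ L ⊓ X := le_inf hPL hPX
  have h2 : finrank K ↥(L ⊓ X) < finrank K L :=
    Submodule.finrank_lt_finrank_of_lt (lt_of_le_of_ne inf_le_left (by simpa using h))
  have h3 := Submodule.finrank_mono h1
  exact (Submodule.eq_of_le_of_finrank_eq h1 (by omega)).symm

/-- A family of rank `d + 1` subspaces through a point `P` of `U`, any two of which share a line,
such that each of them meets `U` in a line that meets a small set `Z`, has at most as many members
as there are subspaces meeting `U` in a fixed line. -/
theorem ncard_le_of_meets_line (hd : 3 ≤ d) (hV : finrank K V = 2 * d + 1)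
    (h8 : 8 ≤ Nat.card K) {P U : Submodule K V} (hP : finrank K P = 1) (hPU : P ≤ U)
    (hU : finrank K U = d + 2) {Z : Set (Submodule K V)} (hZ : ∀ z ∈ Z, finrank K z = 1 ∧ z ≤ U)
    (hPZ : P ∉ Z) (hZc : 8 * Z.ncard ≤ Nat.card K ^ 2) (𝒯 : Set (Submodule K V))
    (h1 : ∀ τ ∈ 𝒯, finrank K τ = d + 1 ∧ P ≤ τ ∧ finrank K ↥(τ ⊓ U) = 2 ∧ ∃ z ∈ Z, z ≤ τ)
    (h2 : ∀ τ ∈ 𝒯, ∀ τ' ∈ 𝒯, 2 ≤ finrank K ↥(τ ⊓ τ')) :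
    𝒯.ncard ≤ Nat.card K ^ (d * (d - 1)) := by
  classical
  obtain ⟨e, rfl⟩ : ∃ e, d = e + 3 := ⟨d - 3, by omega⟩
  have h4 : 4 ≤ Nat.card K := by omega
  set q := Nat.card K with hq
  rcases 𝒯.eq_empty_or_nonempty with rfl | ⟨τ₁, hτ₁⟩
  · simp
  -- If all traces on `U` are one line, the subspaces with this trace number exactly q^(d(d-1)).
  -- Otherwise a second trace imposes extra intersections, which make every trace rare.
  by_cases hall : ∀ τ ∈ 𝒯, τ ⊓ U = τ₁ ⊓ U
  · have h := ncard_inf_eq (A := τ₁ ⊓ U) (U := U) inf_le_right (k := e + 4)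
      (by rw [(h1 _ hτ₁).2.2.1]; omega)
    rw [(h1 _ hτ₁).2.2.1, hU] at h
    refine (Set.ncard_le_ncard ?_ (Set.toFinite _)).trans (h.trans_le (le_of_eq rfl))
    exact fun τ hτ => ⟨hall τ hτ, (h1 τ hτ).1⟩
  push Not at hall
  obtain ⟨τ₂, hτ₂, h12⟩ := hall
  have hother : ∀ L, ∃ τ ∈ 𝒯, τ ⊓ U ≠ L := by
    intro L
    by_cases h : τ₁ ⊓ U = L
    · exact ⟨τ₂, hτ₂, h ▸ h12⟩
    · exact ⟨τ₁, hτ₁, h⟩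
  have hPL : ∀ τ ∈ 𝒯, P ≤ τ ⊓ U := fun τ hτ => le_inf (h1 τ hτ).2.1 hPU
  have hLL : ∀ τ ∈ 𝒯, ∀ τ' ∈ 𝒯, τ ⊓ U ≠ τ' ⊓ U → (τ ⊓ U) ⊓ (τ' ⊓ U) = P := by
    intro τ hτ τ' hτ' hne
    refine eq_of_rank_succ (hPL τ hτ) (hPL τ' hτ') (by rw [(h1 τ hτ).2.2.1, hP]) fun h => hne ?_
    exact Submodule.eq_of_le_of_finrank_eq h (by rw [(h1 τ hτ).2.2.1, (h1 τ' hτ').2.2.1])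
  have hneP : ∀ τ ∈ 𝒯, ∀ τ' ∈ 𝒯, τ ⊓ τ' ≠ P := by
    intro τ hτ τ' hτ' h
    have := h2 τ hτ τ' hτ'
    rw [h, hP] at this; omega
  have hmeet : ∀ τ ∈ 𝒯, ∀ τ' ∈ 𝒯, τ ⊓ U ≠ τ' ⊓ U → ∃ Q, P ≤ Q ∧ Q ≤ τ' ∧
      finrank K Q = finrank K P + 1 ∧ Q ≤ τ ∧ Q ⊓ U = P := by
    intro τ hτ τ' hτ' hne
    obtain ⟨Q, hQ1, hQ2, hQ3⟩ := exists_finrank_succ (le_inf (h1 τ hτ).2.1 (h1 τ' hτ').2.1)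
      (hneP τ hτ τ' hτ')
    refine ⟨Q, hQ1, hQ2.trans inf_le_right, hQ3, hQ2.trans inf_le_left, ?_⟩
    refine le_antisymm ?_ (le_inf hQ1 hPU)
    rw [← hLL τ hτ τ' hτ' hne]
    exact le_inf (inf_le_inf_right _ (hQ2.trans inf_le_left))
      (inf_le_inf_right _ (hQ2.trans inf_le_right))
  have hτX : ∀ τ ∈ 𝒯, finrank K τ = finrank K P + (e + 3) := by
    intro τ hτ
    rw [(h1 τ hτ).1, hP]; omega
  set 𝓛 : Set (Submodule K V) := (fun τ => τ ⊓ U) '' 𝒯 with h𝓛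
  -- A trace is spanned by `P` and any of its points in `Z`, as `P ∉ Z`.
  have h𝓛c : 𝓛.ncard ≤ Z.ncard := by
    refine le_trans (Set.ncard_le_ncard (t := (fun z => P ⊔ z) '' Z) ?_ (Set.toFinite _))
      (Set.ncard_image_le (Set.toFinite _))
    rintro _ ⟨τ, hτ, rfl⟩
    obtain ⟨hr, hPτ, hrL, z, hz, hzτ⟩ := h1 τ hτ
    refine ⟨z, hz, ?_⟩
    have hle : P ⊔ z ≤ τ ⊓ U := sup_le (hPL τ hτ) (le_inf hzτ (hZ z hz).2)
    refine Submodule.eq_of_le_of_finrank_eq hle ?_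
    rw [hrL]
    refine (finrank_sup_of_inf_eq (A := ⊥) ?_ (k := 1) (by rw [(hZ z hz).1, finrank_bot])).trans
      (by rw [hP])
    refine eq_of_rank_succ bot_le bot_le (by rw [hP, finrank_bot]) fun h => hPZ ?_
    rwa [Submodule.eq_of_le_of_finrank_eq h (by rw [hP, (hZ z hz).1])]
  have h3 : ∀ τ ∈ 𝒯, ∀ Q, P ≤ Q → finrank K Q = finrank K P + 1 → Q ⊓ (τ ⊓ U) = P →
      finrank K ↥((τ ⊓ U) ⊔ Q) = 3 := by
    intro τ hτ Q _ hQ h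
    rw [finrank_sup_of_inf_eq (by rw [inf_comm]; exact h) hQ, (h1 τ hτ).2.2.1]
  have hplane : ∀ τ ∈ 𝒯, ∀ Q, P ≤ Q → finrank K Q = finrank K P + 1 → Q ⊓ (τ ⊓ U) = P →
      {τ' ∈ 𝒯 | τ' ⊓ U = τ ⊓ U ∧ Q ≤ τ'}.ncard ≤ 2 * q ^ ((e + 1) * (e + 3)) := by
    intro τ hτ Q hPQ hQ h
    have hr := h3 τ hτ Q hPQ hQ h
    refine ncard_ge_le (R := (τ ⊓ U) ⊔ Q) h4 (by omega) ?_
    rintro τ' ⟨hτ', hL, hQ'⟩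
    refine ⟨sup_le (hL ▸ inf_le_left) hQ', ?_⟩
    rw [hr, (h1 τ' hτ').1]; omega
  have hsplit : q ^ ((e + 3) * (e + 3 - 1)) = q ^ ((e + 1) * (e + 3)) * q ^ (e + 3) := by
    rw [← pow_add]; congr 1
    rw [show e + 3 - 1 = e + 2 by omega]; ring
  -- Members with different traces share a line through `P` not in `U`. Fixing a member `τ'` with
  -- another trace, each member with the given trace contains a plane spanned by this trace and a
  -- line of `τ'` through `P`. This bounds their number by 4 q^(d(d-1)-1).
  have hL_le : ∀ τ ∈ 𝒯, {τ' ∈ 𝒯 | τ' ⊓ U = τ ⊓ U}.ncard ≤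
      qNum K (e + 3) * (2 * q ^ ((e + 1) * (e + 3))) := by
    intro τ hτ
    obtain ⟨τ', hτ', hne⟩ := hother (τ ⊓ U)
    refine ncard_le_qNum_mul (h1 τ' hτ').2.1 (hτX τ' hτ') (fun Q => Q ⊓ U = P) ?_ ?_
    · rintro τ'' ⟨hτ'', hL⟩
      exact hmeet τ'' hτ'' τ' hτ' (by rw [hL]; exact hne.symm)
    · intro Q hQ1 _ hQ3 hQU
      refine le_trans (Set.ncard_le_ncard ?_ (Set.toFinite _)) (hplane τ hτ Q hQ1 hQ3 ?_)
      · rintro τ'' ⟨⟨h5, h6⟩, h7⟩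
        exact ⟨h5, h6, h7⟩
      · exact le_antisymm (by rw [← hQU]; exact inf_le_inf_left _ inf_le_right)
          (le_inf hQ1 (hPL τ hτ))
  have hq1 : q ^ 2 ≤ q ^ (e + 2) := Nat.pow_le_pow_right (by omega) (by omega)
  have hqn := qNum_succ_le (K := K) (e + 2)
  -- Either some plane `(τ ⊓ U) ⊔ Q` is met beyond `P` by every member with another trace, so that
  -- such a member contains one of only q + 1 lines of the plane; or each such plane meets some
  -- member with another trace only in `P`, which forces one more line into the members through the
  -- plane and saves a further factor of order q for every trace.
  by_cases hb : ∃ τ ∈ 𝒯, ∃ Q, P ≤ Q ∧ finrank K Q = finrank K P + 1 ∧ Q ⊓ U = P ∧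
      ∀ τ' ∈ 𝒯, τ' ⊓ U ≠ τ ⊓ U → τ' ⊓ ((τ ⊓ U) ⊔ Q) ≠ P
  · obtain ⟨τ, hτ, Q, hQ1, hQ2, hQU, hall⟩ := hb
    have hQL : Q ⊓ (τ ⊓ U) = P :=
      le_antisymm (by rw [← hQU]; exact inf_le_inf_left _ inf_le_right) (le_inf hQ1 (hPL τ hτ))
    have hE := h3 τ hτ Q hQ1 hQ2 hQL
    have hEU : ((τ ⊓ U) ⊔ Q) ⊓ U = τ ⊓ U := by
      rw [sup_inf_assoc_of_le Q (inf_le_right : τ ⊓ U ≤ U), hQU, sup_eq_left.2 (hPL τ hτ)]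
    have hA := hL_le τ hτ
    have hB : {τ' ∈ 𝒯 | τ' ⊓ U ≠ τ ⊓ U}.ncard ≤
        𝓛.ncard * (qNum K 2 * (2 * q ^ ((e + 1) * (e + 3)))) := by
      refine ncard_le_mul_of_cover (fun L τ' => τ' ⊓ U = L) ?_ ?_
      · rintro τ' ⟨hτ', _⟩
        exact ⟨_, ⟨τ', hτ', rfl⟩, rfl⟩
      · rintro _ ⟨τ₀, hτ₀, rfl⟩
        refine ncard_le_qNum_mul (A := P) (X := (τ ⊓ U) ⊔ Q) ((hPL τ hτ).trans le_sup_left)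
          (by rw [hE, hP]) (fun Q' => Q' ⊓ (τ₀ ⊓ U) = P) ?_ ?_
        · rintro τ' ⟨⟨hτ', hne⟩, hL⟩
          obtain ⟨Q', h5, h6, h7⟩ := exists_finrank_succ
            (le_inf (h1 τ' hτ').2.1 ((hPL τ hτ).trans le_sup_left)) (hall τ' hτ' hne)
          refine ⟨Q', h5, h6.trans inf_le_right, h7, h6.trans inf_le_left, ?_⟩
          refine le_antisymm ?_ (le_inf h5 (hPL τ₀ hτ₀))
          simp only at hL
          rw [← hL, ← hLL τ' hτ' τ hτ hne, ← hEU]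
          refine le_inf inf_le_right (le_inf (inf_le_left.trans (h6.trans inf_le_right))
            (inf_le_right.trans inf_le_right))
        · intro Q' h5 _ h6 h7
          refine le_trans (Set.ncard_le_ncard ?_ (Set.toFinite _)) (hplane τ₀ hτ₀ Q' h5 h6 h7)
          rintro τ' ⟨⟨⟨h8, _⟩, h9⟩, h10⟩
          exact ⟨h8, h9, h10⟩
    have hcov : 𝒯.ncard ≤ {τ' ∈ 𝒯 | τ' ⊓ U = τ ⊓ U}.ncard + {τ' ∈ 𝒯 | τ' ⊓ U ≠ τ ⊓ U}.ncard := by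
      refine le_trans (Set.ncard_le_ncard ?_ (Set.toFinite _)) (Set.ncard_union_le _ _)
      intro τ' hτ'
      by_cases h : τ' ⊓ U = τ ⊓ U
      · exact Or.inl ⟨hτ', h⟩
      · exact Or.inr ⟨hτ', h⟩
    have h2n := qNum_succ_le (K := K) 1
    rw [pow_one] at h2n
    rw [hsplit]
    set G := q ^ ((e + 1) * (e + 3))
    calc 𝒯.ncard ≤ qNum K (e + 3) * (2 * G) + 𝓛.ncard * (qNum K 2 * (2 * G)) := by omega
      _ ≤ (2 * q ^ (e + 2)) * (2 * G) + Z.ncard * ((2 * q) * (2 * G)) := by gcongr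
      _ = G * (4 * q ^ (e + 2) + 4 * Z.ncard * q) := by ring
      _ ≤ G * q ^ (e + 3) := by
          gcongr
          rw [pow_succ q (e + 2)]
          nlinarith
  · push Not at hb
    have hL2 : ∀ τ ∈ 𝒯, {τ' ∈ 𝒯 | τ' ⊓ U = τ ⊓ U}.ncard ≤
        qNum K (e + 3) * (qNum K (e + 3) * (2 * q ^ (e * (e + 3)))) := by
      intro τ hτ
      obtain ⟨τ', hτ', hne⟩ := hother (τ ⊓ U)
      refine ncard_le_qNum_mul (h1 τ' hτ').2.1 (hτX τ' hτ') (fun Q => Q ⊓ U = P) ?_ ?_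
      · rintro τ'' ⟨hτ'', hL⟩
        exact hmeet τ'' hτ'' τ' hτ' (by rw [hL]; exact hne.symm)
      · intro Q hQ1 _ hQ3 hQU
        obtain ⟨τ₀, hτ₀, hne₀, hinf⟩ := hb τ hτ Q hQ1 hQ3 hQU
        have hQL : Q ⊓ (τ ⊓ U) = P :=
          le_antisymm (by rw [← hQU]; exact inf_le_inf_left _ inf_le_right) (le_inf hQ1 (hPL τ hτ))
        have hE := h3 τ hτ Q hQ1 hQ3 hQL
        refine ncard_le_qNum_mul (h1 τ₀ hτ₀).2.1 (hτX τ₀ hτ₀) (fun _ => True) ?_ ?_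
        · rintro τ'' ⟨⟨hτ'', hL⟩, _⟩
          obtain ⟨Q', a1, a2, a3, a4, _⟩ := hmeet τ'' hτ'' τ₀ hτ₀ (by rw [hL]; exact hne₀.symm)
          exact ⟨Q', a1, a2, a3, a4, trivial⟩
        · intro Q' a1 a2 a3 _
          have hinf' : ((τ ⊓ U) ⊔ Q) ⊓ Q' = P := by
            refine le_antisymm ?_ (le_inf (hQ1.trans le_sup_right) a1)
            rw [← hinf, inf_comm]
            exact inf_le_inf_right _ a2
          have hr := finrank_sup_of_inf_eq hinf' a3
          refine ncard_ge_le (R := ((τ ⊓ U) ⊔ Q) ⊔ Q') h4 (by omega) ?_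
          rintro τ'' ⟨⟨⟨h5, h6⟩, h7⟩, h9⟩
          refine ⟨sup_le (sup_le (h6 ▸ inf_le_left) h7) h9, ?_⟩
          rw [hr, hE, (h1 τ'' h5).1]; omega
    have hcov : 𝒯.ncard ≤ 𝓛.ncard * (qNum K (e + 3) * (qNum K (e + 3) * (2 * q ^ (e * (e + 3))))) := by
      refine ncard_le_mul_of_cover (fun L τ' => τ' ⊓ U = L) ?_ ?_
      · intro τ' hτ'
        exact ⟨_, ⟨τ', hτ', rfl⟩, rfl⟩
      · rintro _ ⟨τ₀, hτ₀, rfl⟩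
        exact hL2 τ₀ hτ₀
    calc 𝒯.ncard ≤ _ := hcov
      _ ≤ Z.ncard * ((2 * q ^ (e + 2)) * ((2 * q ^ (e + 2)) * (2 * q ^ (e * (e + 3))))) := by
          gcongr
      _ = 8 * Z.ncard * (q ^ (e + 2) * q ^ (e + 2) * q ^ (e * (e + 3))) := by ring
      _ ≤ q ^ 2 * (q ^ (e + 2) * q ^ (e + 2) * q ^ (e * (e + 3))) := by gcongr
      _ = q ^ ((e + 3) * (e + 3 - 1)) := by
          rw [← pow_add, ← pow_add, ← pow_add]; congr 1
          rw [show e + 3 - 1 = e + 2 by omega]; ring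

end TwoLines

/-! ### Unions with small overlaps. -/

/-- The Bonferroni inequality, with the number of pairs bounded crudely by `T.card ^ 2`. -/
theorem sum_ncard_le_biUnion {ι α : Type*} [Finite ι] [Finite α] (T : Finset ι) (A : ι → Set α)
    (m : ℕ) (h : ∀ i ∈ T, ∀ j ∈ T, i ≠ j → (A i ∩ A j).ncard ≤ m) :
    ∑ i ∈ T, (A i).ncard ≤ (⋃ i ∈ T, A i).ncard + T.card ^ 2 * m := by
  classical
  induction T using Finset.induction_on with
  | empty => simp
  | insert a T ha ih =>
    have ih' := ih fun i hi j hj => h i (Finset.mem_insert_of_mem hi) j (Finset.mem_insert_of_mem hj)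
    rw [Finset.sum_insert ha, Finset.set_biUnion_insert, Finset.card_insert_of_notMem ha]
    have h1 := Set.ncard_union_add_ncard_inter (A a) (⋃ i ∈ T, A i)
    have h2 : (A a ∩ ⋃ i ∈ T, A i).ncard ≤ T.card * m := by
      rw [← Set.ncard_coe_finset]
      refine ncard_le_mul_of_cover (fun i f => f ∈ A i) ?_ ?_
      · rintro f ⟨_, hf⟩
        simpa using hf
      · intro i hi
        refine le_trans (Set.ncard_le_ncard ?_ (Set.toFinite _))
          (h a (Finset.mem_insert_self _ _) i (Finset.mem_insert_of_mem hi) ?_)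
        · rintro f ⟨⟨h3, _⟩, h4⟩
          exact ⟨h3, h4⟩
        · rintro rfl; exact ha hi
    nlinarith

theorem sum_ncard_eq_sum_card {ι α : Type*} [Fintype α] (T : Finset ι) (A : ι → Set α)
    [∀ f, DecidablePred fun i => f ∈ A i] :
    ∑ i ∈ T, (A i).ncard = ∑ f : α, (T.filter fun i => f ∈ A i).card := by
  classical
  have : ∀ i, (A i).ncard = (Finset.univ.filter fun f => f ∈ A i).card := by
    intro i
    rw [← Set.ncard_coe_finset]; congr 1; ext; simp
  simp only [this]
  exact Finset.sum_card_bipartiteAbove_eq_sum_card_bipartiteBelow (fun i f => f ∈ A i)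

/-- Elements covered more than once are controlled by the excess of the total size of a family of
sets over the size of the union. -/
theorem sum_ncard_multiple_le {ι α : Type*} [Finite α] (T : Finset ι) (A : ι → Set α) :
    ∑ i ∈ T, {f ∈ A i | ∃ j ∈ T, j ≠ i ∧ f ∈ A j}.ncard + 2 * (⋃ i ∈ T, A i).ncard ≤
      2 * ∑ i ∈ T, (A i).ncard := by
  classical
  have := Fintype.ofFinite α
  have hU : (⋃ i ∈ T, A i).ncard =
      ∑ f : α, if (T.filter fun i => f ∈ A i).card = 0 then 0 else 1 := by
    have hset : (⋃ i ∈ T, A i) =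
        ↑(Finset.univ.filter fun f => ¬ (T.filter fun i => f ∈ A i).card = 0) := by
      ext f
      simp [Finset.filter_eq_empty_iff]
    rw [hset, Set.ncard_coe_finset, Finset.card_filter]
    exact Finset.sum_congr rfl fun f _ => by split_ifs <;> rfl
  rw [sum_ncard_eq_sum_card, sum_ncard_eq_sum_card, hU, Finset.mul_sum, Finset.mul_sum,
    ← Finset.sum_add_distrib]
  refine Finset.sum_le_sum fun f _ => ?_
  -- An element covered k times contributes 2 on both sides if k = 1, and at most k + 2 ≤ 2k on the
  -- left if k ≥ 2.
  by_cases h : (T.filter fun i => f ∈ A i).card ≤ 1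
  · have h0 : (T.filter fun i => f ∈ {f ∈ A i | ∃ j ∈ T, j ≠ i ∧ f ∈ A j}) = ∅ := by
      rw [Finset.filter_eq_empty_iff]
      rintro i hi ⟨h1, j, hj, hne, h2⟩
      exact hne (Finset.card_le_one.1 h j (by simp [hj, h2]) i (by simp [hi, h1]))
    rw [h0, Finset.card_empty]
    split_ifs <;> omega
  · have h1 : (T.filter fun i => f ∈ {f ∈ A i | ∃ j ∈ T, j ≠ i ∧ f ∈ A j}).card ≤
        (T.filter fun i => f ∈ A i).card := by
      refine Finset.card_le_card fun i hi => ?_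
      rw [Finset.mem_filter] at hi ⊢
      exact ⟨hi.1, hi.2.1⟩
    split_ifs <;> omega

/-! ### A subspace of rank d + 2 that contains many base points. -/

section Dense

variable {K V : Type*} [Field K] [Finite K] [AddCommGroup V] [Module K V] [FiniteDimensional K V]
  {d : ℕ}

/-- The lines through `p` that contain another point of `X`. -/
def linesThrough (X : Set (Submodule K V)) (p : Submodule K V) : Set (Submodule K V) :=
  {L | p ≤ L ∧ finrank K L = 2 ∧ ∃ x ∈ X, x ≠ p ∧ x ≤ L}

/-- The flags `(π, τ)` such that `π` contains `p` and another point of `X`. -/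
def multipleFlags (d : ℕ) (X : Set (Submodule K V)) (p : Submodule K V) :
    Set (TypeFlag K V d) :=
  {f | p ≤ f.pi ∧ ∃ x ∈ X, x ≠ p ∧ x ≤ f.pi}

theorem finrank_sup_point {A p : Submodule K V} (hp : finrank K p = 1) (h : ¬ p ≤ A) :
    finrank K ↥(A ⊔ p) = finrank K A + 1 :=
  finrank_sup_of_inf_eq (A := ⊥) (by
    rw [inf_comm]
    exact eq_of_rank_succ bot_le bot_le (by rw [hp, finrank_bot]) h) (by rw [hp, finrank_bot])

theorem eq_of_point_le {x p : Submodule K V} (hx : finrank K x = 1) (hp : finrank K p = 1)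
    (h : x ≤ p) : x = p := Submodule.eq_of_le_of_finrank_eq h (by rw [hx, hp])

/-- Passing from a line to a plane in π costs a factor of at least q^(d+1). This controls the
overlaps of the flag sets of two lines through a common point. -/
theorem lineFlags_le (hd : 3 ≤ d) :
    Nat.card K ^ (d + 1) * (grassCard K (2 * d - 2) (d - 3) * qNum K (d + 1)) ≤
      grassCard K (2 * d - 1) (d - 2) * qNum K (d + 1) := by
  obtain ⟨e, rfl⟩ : ∃ e, d = e + 3 := ⟨d - 3, by omega⟩
  rw [show 2 * (e + 3) - 2 = 2 * e + 4 by omega, show 2 * (e + 3) - 1 = 2 * e + 5 by omega,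
    show e + 3 - 3 = e by omega, show e + 3 - 2 = e + 1 by omega, ← mul_assoc]
  refine Nat.mul_le_mul_right _ ?_
  have h := grassCard_mul_qNum (K := K) (2 * e + 4) e
  have h1 := pow_mul_qNum_le (K := K) (e + 4) (e + 1)
  rw [show e + 4 + (e + 1) = 2 * e + 4 + 1 by ring] at h1
  refine Nat.le_of_mul_le_mul_right (c := qNum K (e + 1)) ?_ (qNum_pos e)
  rw [show 2 * e + 5 = 2 * e + 4 + 1 by ring, h]
  calc _ = Nat.card K ^ (e + 4) * qNum K (e + 1) * grassCard K (2 * e + 4) e := by ring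
    _ ≤ _ := by gcongr

theorem genericCard_le (hd : 3 ≤ d) :
    genericCard K d ≤
      2 * Nat.card K ^ (d + 1) * (grassCard K (2 * d - 1) (d - 2) * qNum K (d + 1)) := by
  obtain ⟨e, rfl⟩ : ∃ e, d = e + 3 := ⟨d - 3, by omega⟩
  rw [genericCard, show 2 * (e + 3) = 2 * e + 5 + 1 by omega,
    show 2 * e + 5 + 1 - 1 = 2 * e + 5 by omega,
    show e + 3 - 1 = e + 1 + 1 by omega, show e + 3 - 2 = e + 1 by omega, ← mul_assoc]
  refine Nat.mul_le_mul_right _ ?_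
  have h := grassCard_mul_qNum (K := K) (2 * e + 5) (e + 1)
  refine Nat.le_of_mul_le_mul_right (c := qNum K (e + 2)) ?_ (qNum_pos _)
  rw [show e + 2 = e + 1 + 1 by ring] at *
  rw [h]
  have h1 : qNum K (2 * e + 5 + 1) ≤ 2 * Nat.card K ^ (e + 3 + 1) * qNum K (e + 1 + 1) := by
    calc _ ≤ 2 * Nat.card K ^ (2 * e + 5) := qNum_succ_le _
      _ = 2 * Nat.card K ^ (e + 3 + 1) * Nat.card K ^ (e + 1) := by
        rw [mul_assoc, ← pow_add]; congr 2; ring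
      _ ≤ _ := by gcongr; exact pow_le_qNum _
  calc _ ≤ 2 * Nat.card K ^ (e + 3 + 1) * qNum K (e + 1 + 1) * grassCard K (2 * e + 5) (e + 1) := by
        gcongr
    _ = _ := by ring

/-- Only `80 * q ^ d` lines are kept. By Bonferroni their flag sets lose at most (80 q^d)² g₂, and
this is at most half of the total 80 q^d g₁ because g₁ ≥ q^(d+1) g₂ and q ≥ 160. -/
theorem le_ncard_multipleFlags (hd : 3 ≤ d) (hV : finrank K V = 2 * d + 1)
    (hq : 160 ≤ Nat.card K) {X : Set (Submodule K V)} {p : Submodule K V}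
    (hp : finrank K p = 1) (hΛ : 80 * Nat.card K ^ d ≤ (linesThrough X p).ncard) :
    40 * Nat.card K ^ d * (grassCard K (2 * d - 1) (d - 2) * qNum K (d + 1)) ≤
      (multipleFlags d X p).ncard := by
  classical
  obtain ⟨T, hT, hTc⟩ := Set.exists_subset_card_eq hΛ
  lift T to Finset (Submodule K V) using Set.toFinite T
  rw [Set.ncard_coe_finset] at hTc
  have hT' : ∀ L ∈ T, L ∈ linesThrough X p := fun L hL => hT hL
  set g₁ := grassCard K (2 * d - 1) (d - 2) * qNum K (d + 1) with hg₁
  set g₂ := grassCard K (2 * d - 2) (d - 3) * qNum K (d + 1) with hg₂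
  have h := sum_ncard_le_biUnion T (fun L => {f : TypeFlag K V d | L ≤ f.pi}) g₂ (by
    intro L hL L' hL' hne
    obtain ⟨h1, h2, _⟩ := hT' L hL
    obtain ⟨h1', h2', _⟩ := hT' L' hL'
    have hinf : L ⊓ L' = p := eq_of_rank_succ h1 h1' (by rw [h2, hp]) fun hle =>
      hne (Submodule.eq_of_le_of_finrank_eq hle (by rw [h2, h2']))
    have hr := finrank_sup_of_inf_eq hinf (k := 1) (by rw [h2', hp])
    have hc := ncard_flags_ge (d := d) hV (R := L ⊔ L') (by omega)
    rw [hr, h2, show 2 * d + 1 - (2 + 1) = 2 * d - 2 by omega] at hc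
    rw [hg₂, ← hc]
    refine Set.ncard_le_ncard ?_ (Set.toFinite _)
    rintro f ⟨h3, h4⟩
    exact sup_le (show L ≤ f.pi from h3) (show L' ≤ f.pi from h4))
  have hsum : ∑ L ∈ T, {f : TypeFlag K V d | L ≤ f.pi}.ncard = T.card * g₁ := by
    refine Finset.sum_const_nat fun L hL => ?_
    have h2 : finrank K L = 2 := (hT' L hL).2.1
    have hc := ncard_flags_ge (d := d) hV (R := L) (by omega)
    rw [hc, h2, show 2 * d + 1 - 2 = 2 * d - 1 by omega]
  have hsub : (⋃ L ∈ T, {f : TypeFlag K V d | L ≤ f.pi}) ⊆ multipleFlags d X p := by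
    intro f hf
    simp only [Set.mem_iUnion, exists_prop] at hf
    obtain ⟨L, hL, hLf⟩ := hf
    obtain ⟨h1, h2, x, hx, hne, hxL⟩ := hT' L hL
    exact ⟨h1.trans hLf, x, hx, hne, hxL.trans hLf⟩
  have hle := Set.ncard_le_ncard hsub (Set.toFinite _)
  have h12 : Nat.card K ^ (d + 1) * g₂ ≤ g₁ := lineFlags_le hd
  rw [hsum, hTc] at h
  have h6 : 80 * 80 * Nat.card K ^ d * g₂ ≤ 40 * g₁ := by
    calc _ = 40 * (160 * Nat.card K ^ d * g₂) := by ring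
      _ ≤ 40 * (Nat.card K * Nat.card K ^ d * g₂) := by gcongr
      _ = 40 * (Nat.card K ^ (d + 1) * g₂) := by rw [pow_succ']
      _ ≤ _ := by gcongr
  have h7 : (80 * Nat.card K ^ d) ^ 2 * g₂ ≤ 40 * Nat.card K ^ d * g₁ := by
    calc _ = Nat.card K ^ d * (80 * 80 * Nat.card K ^ d * g₂) := by ring
      _ ≤ Nat.card K ^ d * (40 * g₁) := by gcongr
      _ = _ := by ring
  have h8 : 80 * Nat.card K ^ d * g₁ = 40 * Nat.card K ^ d * g₁ + 40 * Nat.card K ^ d * g₁ := by ring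
  omega

end Dense

section Dense

variable {K V : Type*} [Field K] [Finite K] [AddCommGroup V] [Module K V] [FiniteDimensional K V]
  {d : ℕ}

/-- If the points of `X` on average lie in few flags containing a further point of `X`, then many
points of `X` see the other points of `X` in few directions. -/
theorem ncard_many_lines_le (hd : 3 ≤ d) (hV : finrank K V = 2 * d + 1)
    (hq : 160 ≤ Nat.card K) (X : Finset (Submodule K V)) (hX : ∀ p ∈ X, finrank K p = 1)
    (hB : ∑ p ∈ X, (multipleFlags d (X : Set (Submodule K V)) p).ncard ≤
      6 * Nat.card K ^ d * genericCard K d) :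
    10 * {p | p ∈ X ∧ 80 * Nat.card K ^ d ≤ (linesThrough (X : Set (Submodule K V)) p).ncard}.ncard
      ≤ 3 * Nat.card K ^ (d + 1) := by
  classical
  set g₁ := grassCard K (2 * d - 1) (d - 2) * qNum K (d + 1) with hg₁
  have hgen : genericCard K d ≤ 2 * Nat.card K ^ (d + 1) * g₁ := genericCard_le hd
  set B := X.filter fun p =>
    80 * Nat.card K ^ d ≤ (linesThrough (X : Set (Submodule K V)) p).ncard with hBdef
  have hBe : {p | p ∈ X ∧ 80 * Nat.card K ^ d ≤
      (linesThrough (X : Set (Submodule K V)) p).ncard} = (B : Set (Submodule K V)) := by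
    ext; simp [hBdef]
  rw [hBe, Set.ncard_coe_finset]
  -- Each bad point accounts for 40 q^d g₁ flags, while the allowed total is 6 q^d · 2 q^(d+1) g₁.
  -- So at most (3/10) q^(d+1) points are bad, fewer than the q^(d+1)/3 points available in the
  -- application.
  have h1 : B.card * (40 * Nat.card K ^ d * g₁) ≤
      ∑ p ∈ X, (multipleFlags d (X : Set (Submodule K V)) p).ncard := by
    rw [← smul_eq_mul]
    refine (Finset.card_nsmul_le_sum B _ _ fun p hp => ?_).trans
      (Finset.sum_le_sum_of_subset (Finset.filter_subset _ _))
    rw [Finset.mem_filter] at hp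
    exact le_ncard_multipleFlags hd hV hq (hX p hp.1) hp.2
  have hg₁pos : 0 < g₁ := by
    refine Nat.mul_pos ?_ (qNum_pos d)
    have := pow_le_grassCard (K := K) (d + 1) (d - 2)
    rw [show d + 1 + (d - 2) = 2 * d - 1 by omega] at this
    exact lt_of_lt_of_le (Nat.pow_pos (by omega)) this
  have hpos : 0 < 4 * Nat.card K ^ d * g₁ := by
    have : 0 < Nat.card K ^ d := Nat.pow_pos (by omega)
    positivity
  refine Nat.le_of_mul_le_mul_right ?_ hpos
  calc 10 * B.card * (4 * Nat.card K ^ d * g₁) = B.card * (40 * Nat.card K ^ d * g₁) := by ring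
    _ ≤ 6 * Nat.card K ^ d * genericCard K d := h1.trans hB
    _ ≤ 6 * Nat.card K ^ d * (2 * Nat.card K ^ (d + 1) * g₁) := by gcongr
    _ = _ := by ring

theorem points_ncard (A : Submodule K V) :
    {x : Submodule K V | x ≤ A ∧ finrank K x = 1}.ncard = qNum K (finrank K A) := by
  rw [ncard_le, grassCard_one]

/-- The inductive step for `exists_dense_subspace`. -/
theorem dense_step {X : Set (Submodule K V)} (hX : ∀ p ∈ X, finrank K p = 1)
    {A p : Submodule K V} (hp : p ∈ X) (hpA : ¬ p ≤ A) {a b : ℝ} (ha : 0 < a) (hb : 0 ≤ b)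
    {G : Set (Submodule K V)} (hG : G ⊆ X)
    (hGA : ∀ x ∈ G, a ≤ {y ∈ X | ¬ y ≤ A ∧ y ≤ A ⊔ x}.ncard) {n : ℕ}
    (hΛ : (linesThrough X p).ncard ≤ n) :
    ({x ∈ G | ¬ x ≤ A ⊔ p ∧
      ({y ∈ X | ¬ y ≤ A ⊔ p ∧ y ≤ (A ⊔ p) ⊔ x}.ncard : ℝ) < b * a}.ncard : ℝ) ≤ n * b := by
  classical
  set E := A ⊔ p with hE
  set s := {x ∈ G | ¬ x ≤ E ∧ ({y ∈ X | ¬ y ≤ E ∧ y ≤ E ⊔ x}.ncard : ℝ) < b * a} with hs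
  have hp1 := hX p hp
  have hpE : p ≤ E := le_sup_right
  have hAE : A ≤ E := le_sup_left
  have hsX : ∀ x ∈ s, x ∈ X := fun x hx => hG hx.1
  have hxA : ∀ x ∈ s, ¬ x ≤ A := fun x hx h => hx.2.1 (h.trans hAE)
  have hpt : ∀ x y : Submodule K V, finrank K x = 1 → ¬ x ≤ y → ∀ z, z ≤ x → z ≤ y → z = ⊥ := by
    intro x y hx hxy z hzx hzy
    by_contra hz
    have h1 : finrank K z ≠ 0 := fun h => hz (Submodule.finrank_eq_zero.1 h)
    have h2 := Submodule.finrank_mono hzx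
    have h3 : z = x := Submodule.eq_of_le_of_finrank_eq hzx (by omega)
    exact hxy (h3 ▸ hzy)
  -- All points `x` of `s` on a line `L` through `p` yield the same subspace `E ⊔ x = A ⊔ L`,
  -- whereas the parts of `A ⊔ x` outside `A` are pairwise disjoint and avoid `E`. So k such points
  -- give at least k·a points of `X` in `A ⊔ L` outside `E`. There are fewer than b·a of these, and
  -- k ≤ b follows.
  have hfib : ∀ L ∈ linesThrough X p, {x ∈ s | p ⊔ x = L}.ncard ≤ ⌊b⌋₊ := by
    intro L hL
    refine Nat.le_floor ?_
    set t := {x ∈ s | p ⊔ x = L} with ht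
    rcases t.eq_empty_or_nonempty with h0 | ⟨x₀, hx₀⟩
    · rw [h0]; simpa using hb
    have hEx : ∀ x ∈ t, E ⊔ x = A ⊔ L := by
      rintro x ⟨_, hx⟩
      rw [hE, sup_assoc, hx]
    have hbound := hx₀.1.2.2
    rw [hEx x₀ hx₀] at hbound
    have htf : (t.toFinite.toFinset : Set (Submodule K V)) = t := by simp
    have hdisj : ∀ x ∈ t.toFinite.toFinset, ∀ x' ∈ t.toFinite.toFinset, x ≠ x' →
        ({y ∈ X | ¬ y ≤ A ∧ y ≤ A ⊔ x} ∩ {y ∈ X | ¬ y ≤ A ∧ y ≤ A ⊔ x'}).ncard ≤ 0 := by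
      intro x hx x' hx' hne
      rw [Set.Finite.mem_toFinset] at hx hx'
      refine le_of_eq ?_
      rw [Set.ncard_eq_zero (Set.toFinite _)]
      ext y
      simp only [Set.mem_inter_iff, Set.mem_ofPred_eq, Set.mem_empty_iff_false, iff_false]
      rintro ⟨⟨hy, hyA, hyx⟩, _, _, hyx'⟩
      have hy1 := finrank_sup_point (hX y hy) hyA
      have hx1 := finrank_sup_point (hX x (hsX x hx.1)) (hxA x hx.1)
      have hx1' := finrank_sup_point (hX x' (hsX x' hx'.1)) (hxA x' hx'.1)
      have e1 : A ⊔ y = A ⊔ x :=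
        Submodule.eq_of_le_of_finrank_eq (sup_le le_sup_left hyx) (by omega)
      have e2 : A ⊔ y = A ⊔ x' :=
        Submodule.eq_of_le_of_finrank_eq (sup_le le_sup_left hyx') (by omega)
      have hxx' : x ⊔ x' = L := by
        refine Submodule.eq_of_le_of_finrank_eq
          (sup_le (hx.2 ▸ le_sup_right) (hx'.2 ▸ le_sup_right)) ?_
        rw [hL.2.1, finrank_sup_point (hX x' (hsX x' hx'.1)), hX x (hsX x hx.1)]
        exact fun h => hne (eq_of_point_le (hX x' (hsX x' hx'.1)) (hX x (hsX x hx.1)) h).symm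
      have hpx : p ≤ A ⊔ x := hL.1.trans (hxx' ▸ sup_le le_sup_right (by
        rw [← e1, e2]; exact le_sup_right))
      have hEe : E = A ⊔ x := Submodule.eq_of_le_of_finrank_eq (sup_le le_sup_left hpx) (by
        rw [hx1, hE, finrank_sup_point hp1 hpA])
      exact hx.1.2.1 (hEe ▸ le_sup_right)
    have hsum := sum_ncard_le_biUnion t.toFinite.toFinset
      (fun x => {y ∈ X | ¬ y ≤ A ∧ y ≤ A ⊔ x}) 0 hdisj
    rw [mul_zero, add_zero] at hsum
    have hsub : (⋃ x ∈ t.toFinite.toFinset, {y ∈ X | ¬ y ≤ A ∧ y ≤ A ⊔ x}) ⊆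
        {y ∈ X | ¬ y ≤ E ∧ y ≤ A ⊔ L} := by
      intro y hy
      simp only [Set.mem_iUnion, exists_prop, Set.Finite.mem_toFinset] at hy
      obtain ⟨x, hx, hyX, hyA, hyx⟩ := hy
      refine ⟨hyX, fun hyE => hyA ?_, hyx.trans (sup_le_sup_left (hx.2 ▸ le_sup_right) _)⟩
      have hinf : (A ⊔ x) ⊓ E = A := eq_of_rank_succ le_sup_left hAE
        (finrank_sup_point (hX x (hsX x hx.1)) (hxA x hx.1))
        fun h => hx.1.2.1 (le_sup_right.trans h)
      rw [← hinf]
      exact le_inf hyx hyE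
    have hle := hsum.trans (Set.ncard_le_ncard hsub (Set.toFinite _))
    have hcard : t.ncard = t.toFinite.toFinset.card := by rw [← Set.ncard_coe_finset, htf]
    have hge : (t.ncard : ℝ) * a ≤
        ∑ x ∈ t.toFinite.toFinset, ({y ∈ X | ¬ y ≤ A ∧ y ≤ A ⊔ x}.ncard : ℝ) := by
      rw [hcard, ← nsmul_eq_mul]
      refine Finset.card_nsmul_le_sum _ _ _ fun x hx => ?_
      rw [Set.Finite.mem_toFinset] at hx
      exact hGA x hx.1.1
    have hle' : (∑ x ∈ t.toFinite.toFinset, ({y ∈ X | ¬ y ≤ A ∧ y ≤ A ⊔ x}.ncard : ℝ)) ≤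
        ({y ∈ X | ¬ y ≤ E ∧ y ≤ A ⊔ L}.ncard : ℝ) := by exact_mod_cast hle
    exact le_of_mul_le_mul_right (hge.trans (hle'.trans hbound.le)) ha
  have hcov := ncard_le_mul_of_cover (s := s) (t := linesThrough X p) (fun L x => p ⊔ x = L)
    (n := ⌊b⌋₊) (by
      intro x hx
      refine ⟨p ⊔ x, ⟨le_sup_left, ?_, x, hsX x hx, ?_, le_sup_right⟩, rfl⟩
      · rw [finrank_sup_point (hX x (hsX x hx)), hp1]
        intro h
        exact hx.2.1 (h.trans hpE)
      · rintro rfl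
        exact hx.2.1 hpE) hfib
  have h1 : s.ncard ≤ n * ⌊b⌋₊ := hcov.trans (Nat.mul_le_mul_right _ hΛ)
  have h2 : (s.ncard : ℝ) ≤ n * (⌊b⌋₊ : ℝ) := by exact_mod_cast h1
  exact h2.trans (mul_le_mul_of_nonneg_left (Nat.floor_le hb) (by positivity))

/-- A point set of the size of a subspace of rank `d + 2` that is nearly a packing with respect to
flags has positive density in some subspace of rank `d + 2`. -/
theorem exists_dense_subspace (hd : 3 ≤ d) (hV : finrank K V = 2 * d + 1)
    (hq : 160 * (d + 1) ≤ Nat.card K) (X : Finset (Submodule K V))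
    (hX : ∀ p ∈ X, finrank K p = 1) (hXc : Nat.card K ^ (d + 1) ≤ 3 * X.card)
    (hB : ∑ p ∈ X, (multipleFlags d (X : Set (Submodule K V)) p).ncard ≤
      6 * Nat.card K ^ d * genericCard K d) :
    ∃ U : Submodule K V, finrank K U = d + 2 ∧
      (Nat.card K : ℝ) ^ (d + 1) / (320 * (d + 1)) ^ (d + 1) ≤ {x | x ∈ X ∧ x ≤ U}.ncard := by
  classical
  have hq160 : 160 ≤ Nat.card K := by nlinarith
  have hbad := ncard_many_lines_le hd hV hq160 X hX hB
  set bad := {p | p ∈ X ∧ 80 * Nat.card K ^ d ≤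
    (linesThrough (X : Set (Submodule K V)) p).ncard} with hbaddef
  set Q : ℝ := (Nat.card K : ℝ) with hQ
  have hQpos : 0 < Q := by rw [hQ]; exact_mod_cast (by omega : 0 < Nat.card K)
  -- Chosen so that 80 q^d · η = q^(d+1)/(4(d+1)): over d + 1 steps the discarded points total
  -- q^(d+1)/4 plus lower order, which stays below |X| ≥ q^(d+1)/3.
  set η : ℝ := Q / (320 * (d + 1)) with hη
  have hηpos : 0 < η := by positivity
  have hgood : ∀ A : Submodule K V, finrank K A ≤ d → ∃ p ∈ X, p ∉ bad ∧ ¬ p ≤ A := by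
    intro A hA
    by_contra hcon
    push Not at hcon
    have h1 : (X : Set (Submodule K V)) ⊆ bad ∪ {x | x ≤ A ∧ finrank K x = 1} := by
      intro p hp
      by_cases h : p ∈ bad
      · exact Or.inl h
      · exact Or.inr ⟨hcon p hp h, hX p hp⟩
    have h2 := (Set.ncard_le_ncard h1 (Set.toFinite _)).trans (Set.ncard_union_le _ _)
    rw [Set.ncard_coe_finset, points_ncard] at h2
    have h3 := qNum_add_one_le (K := K) (finrank K A)
    have h4 : Nat.card K ^ finrank K A ≤ Nat.card K ^ d := Nat.pow_le_pow_right (by omega) hA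
    have h5 : 160 * Nat.card K ^ d ≤ Nat.card K ^ (d + 1) := by
      rw [pow_succ']; gcongr
    omega
  -- `A` is spanned by `k` points that are not bad. For the points `x` of `G`, which are nearly all
  -- of `X`, the number of points of `X` in `A ⊔ x` outside `A` gains a factor `η` with each step.
  have key : ∀ k, k ≤ d + 1 → ∃ A : Submodule K V, finrank K A = k ∧ ∃ G : Set (Submodule K V),
      G ⊆ X ∧ (∀ x ∈ G, ¬ x ≤ A ∧ η ^ k ≤
        {y ∈ (X : Set (Submodule K V)) | ¬ y ≤ A ∧ y ≤ A ⊔ x}.ncard) ∧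
      (((X : Set (Submodule K V)) \ G).ncard : ℝ) ≤
        k * (Q ^ (d + 1) / (4 * (d + 1)) + 2 * Q ^ d) := by
    intro k
    induction k with
    | zero =>
      intro _
      refine ⟨⊥, finrank_bot K V, X, subset_rfl, ?_, by simp⟩
      intro x hx
      have h0 : ¬ x ≤ ⊥ := by
        intro h
        have h1 : finrank K x = 1 := hX x hx
        rw [le_bot_iff.1 h, finrank_bot] at h1
        omega
      refine ⟨h0, ?_⟩
      rw [pow_zero]
      have : 0 < {y ∈ (X : Set (Submodule K V)) | ¬ y ≤ ⊥ ∧ y ≤ ⊥ ⊔ x}.ncard := by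
        rw [Set.ncard_pos (Set.toFinite _)]
        exact ⟨x, hx, h0, le_sup_right⟩
      exact_mod_cast this
    | succ k ih =>
      intro hk
      obtain ⟨A, hA, G, hGX, hG, hGc⟩ := ih (by omega)
      obtain ⟨p, hp, hpb, hpA⟩ := hgood A (by omega)
      have hΛ : (linesThrough (X : Set (Submodule K V)) p).ncard ≤ 80 * Nat.card K ^ d := by
        by_contra h
        exact hpb ⟨hp, by omega⟩
      have hstep := dense_step (X := (X : Set (Submodule K V))) (fun x hx => hX x hx) hp hpA
        (a := η ^ k) (b := η) (by positivity) hηpos.le hGX (fun x hx => (hG x hx).2) hΛ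
      have hE : finrank K ↥(A ⊔ p) = k + 1 := by rw [finrank_sup_point (hX p hp) hpA, hA]
      refine ⟨A ⊔ p, hE, {x ∈ G | ¬ x ≤ A ⊔ p ∧ η ^ (k + 1) ≤
        {y ∈ (X : Set (Submodule K V)) | ¬ y ≤ A ⊔ p ∧ y ≤ (A ⊔ p) ⊔ x}.ncard},
        fun x hx => hGX hx.1, fun x hx => hx.2, ?_⟩
      set N := {x ∈ G | ¬ x ≤ A ⊔ p ∧ ({y ∈ (X : Set (Submodule K V)) | ¬ y ≤ A ⊔ p ∧
        y ≤ (A ⊔ p) ⊔ x}.ncard : ℝ) < η * η ^ k}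
      have hcov : (X : Set (Submodule K V)) \ {x ∈ G | ¬ x ≤ A ⊔ p ∧ η ^ (k + 1) ≤
          {y ∈ (X : Set (Submodule K V)) | ¬ y ≤ A ⊔ p ∧ y ≤ (A ⊔ p) ⊔ x}.ncard} ⊆
          ((X : Set (Submodule K V)) \ G ∪ {x | x ≤ A ⊔ p ∧ finrank K x = 1}) ∪ N := by
        rintro x ⟨hx, hnot⟩
        by_cases h1 : x ∈ G
        · by_cases h2 : x ≤ A ⊔ p
          · exact Or.inl (Or.inr ⟨h2, hX x hx⟩)
          · refine Or.inr ⟨h1, h2, ?_⟩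
            by_contra h3
            refine hnot ⟨h1, h2, ?_⟩
            rw [pow_succ']
            exact not_lt.1 h3
        · exact Or.inl (Or.inl ⟨hx, h1⟩)
      have hc := (Set.ncard_le_ncard hcov (Set.toFinite _)).trans ((Set.ncard_union_le _ _).trans
        (Nat.add_le_add_right (Set.ncard_union_le _ _) _))
      rw [points_ncard, hE] at hc
      have hc' : (((X : Set (Submodule K V)) \ {x ∈ G | ¬ x ≤ A ⊔ p ∧ η ^ (k + 1) ≤
          {y ∈ (X : Set (Submodule K V)) | ¬ y ≤ A ⊔ p ∧ y ≤ (A ⊔ p) ⊔ x}.ncard}).ncard : ℝ) ≤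
          ((X : Set (Submodule K V)) \ G).ncard + qNum K (k + 1) + N.ncard := by
        exact_mod_cast hc
      have hqn : (qNum K (k + 1) : ℝ) ≤ 2 * Q ^ d := by
        have h1 := qNum_succ_le (K := K) k
        have h2 : Nat.card K ^ k ≤ Nat.card K ^ d := Nat.pow_le_pow_right (by omega) (by omega)
        rw [hQ]
        exact_mod_cast h1.trans (Nat.mul_le_mul_left 2 h2)
      have hN : (N.ncard : ℝ) ≤ Q ^ (d + 1) / (4 * (d + 1)) := by
        refine hstep.trans (le_of_eq ?_)
        rw [hη]
        push_cast
        rw [← hQ]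
        field_simp
        ring
      push_cast
      linarith
  obtain ⟨A, hA, G, hGX, hG, hGc⟩ := key (d + 1) le_rfl
  have hne : G.Nonempty := by
    by_contra h
    rw [Set.not_nonempty_iff_eq_empty] at h
    rw [h, Set.sdiff_empty, Set.ncard_coe_finset] at hGc
    have h1 : Q ^ (d + 1) ≤ 3 * X.card := by rw [hQ]; exact_mod_cast hXc
    have h2 : 160 * ((d : ℝ) + 1) ≤ Q := by rw [hQ]; exact_mod_cast hq
    have h3 : 0 < Q ^ d := by positivity
    have h4 : ((d + 1 : ℕ) : ℝ) * (Q ^ (d + 1) / (4 * (d + 1)) + 2 * Q ^ d) =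
        Q ^ (d + 1) / 4 + 2 * (d + 1) * Q ^ d := by
      push_cast; field_simp
    rw [h4] at hGc
    have h5 : 160 * ((d : ℝ) + 1) * Q ^ d ≤ Q ^ (d + 1) := by
      rw [pow_succ']; gcongr
    have h6 : 0 < ((d : ℝ) + 1) * Q ^ d := by positivity
    linarith
  obtain ⟨x, hx⟩ := hne
  obtain ⟨h1, h2⟩ := hG x hx
  refine ⟨A ⊔ x, by rw [finrank_sup_point (hX x (hGX hx)) h1, hA], ?_⟩
  rw [← div_pow]
  refine h2.trans ?_
  refine Nat.cast_le.2 (Set.ncard_le_ncard ?_ (Set.toFinite _))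
  exact fun y hy => ⟨hy.1, hy.2.2⟩

end Dense

/-! ### Non-generic parts, and flags meeting a subspace in a prescribed point. -/

section Bounds

variable {K V : Type*} [Field K] [Finite K] [AddCommGroup V] [Module K V] [FiniteDimensional K V]
  {d : ℕ}

theorem IsBasedOnPoint.subset {F : Set (TypeFlag K V d)} {P : Submodule K V}
    (h : IsBasedOnPoint F P) : {f | P ≤ f.pi} ⊆ F := by
  obtain ⟨_, 𝒰, _, _, rfl⟩ := h
  exact fun f hf => Or.inl hf

theorem IsBasedOnHyperplane.subset {F : Set (TypeFlag K V d)} {H : Submodule K V}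
    (h : IsBasedOnHyperplane F H) : {f | f.tau ≤ H} ⊆ F := by
  obtain ⟨_, ℰ, _, _, rfl⟩ := h
  exact fun f hf => Or.inl hf

/-- Modulo `P` the members are rank `d` subspaces of a space of rank `2d` that pairwise meet
nontrivially. -/
theorem ncard_pointFamily_le (hV : finrank K V = 2 * d + 1) (h4 : 4 ≤ Nat.card K)
    {P : Submodule K V} (hP : finrank K P = 1) {𝒰 : Set (Submodule K V)}
    (h1 : ∀ τ ∈ 𝒰, finrank K τ = d + 1 ∧ P ≤ τ)
    (h2 : ∀ τ ∈ 𝒰, ∀ τ' ∈ 𝒰, 2 ≤ finrank K ↥(τ ⊓ τ')) :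
    𝒰.ncard ≤ 2 ^ (d + 1) * Nat.card K ^ (d * (d - 1)) := by
  refine ncard_intersecting_le (A := P) (B := ⊤) (by rw [finrank_top, hV, hP]; ring) h4 𝒰 ?_ ?_
  · intro τ hτ
    exact ⟨(h1 τ hτ).2, le_top, by rw [(h1 τ hτ).1, hP]; ring⟩
  · intro τ hτ τ' hτ' h
    have := h2 τ hτ τ' hτ'
    rw [h, hP] at this
    omega

theorem extra_bound (hd : 1 ≤ d) {n : ℕ} (h : n ≤ 2 ^ (d + 1) * Nat.card K ^ (d * (d - 1))) :
    n * qNum K (d + 1) ≤ 2 ^ (d + 2) * Nat.card K ^ (d * d) := by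
  have h2 : d * d = d * (d - 1) + d := by
    obtain ⟨e, rfl⟩ : ∃ e, d = e + 1 := ⟨d - 1, by omega⟩
    rw [Nat.add_sub_cancel]; ring
  calc n * qNum K (d + 1)
      ≤ (2 ^ (d + 1) * Nat.card K ^ (d * (d - 1))) * (2 * Nat.card K ^ d) :=
        Nat.mul_le_mul h (qNum_succ_le d)
    _ = 2 ^ (d + 2) * Nat.card K ^ (d * d) := by rw [h2, pow_add]; ring

theorem IsBasedOnPoint.extra_le (hd : 1 ≤ d) (hV : finrank K V = 2 * d + 1)
    (h4 : 4 ≤ Nat.card K) {F : Set (TypeFlag K V d)} {P : Submodule K V}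
    (h : IsBasedOnPoint F P) :
    {f ∈ F | ¬ P ≤ f.pi}.ncard ≤ 2 ^ (d + 2) * Nat.card K ^ (d * d) := by
  obtain ⟨hP, 𝒰, h1, h2, rfl⟩ := h
  refine le_trans (Set.ncard_le_ncard (t := {f | f.tau ∈ 𝒰}) ?_ (Set.toFinite _)) ?_
  · rintro f ⟨hf | hf, hn⟩
    · exact absurd hf hn
    · exact hf
  · rw [ncard_flags_tau_mem 𝒰 fun τ hτ => (h1 τ hτ).1]
    exact extra_bound hd (ncard_pointFamily_le hV h4 hP h1 h2)

theorem IsBasedOnHyperplane.extra_le (hd : 1 ≤ d) (hV : finrank K V = 2 * d + 1)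
    (h4 : 4 ≤ Nat.card K) {F : Set (TypeFlag K V d)} {H : Submodule K V}
    (h : IsBasedOnHyperplane F H) :
    {f ∈ F | ¬ f.tau ≤ H}.ncard ≤ 2 ^ (d + 2) * Nat.card K ^ (d * d) := by
  obtain ⟨hH, ℰ, h1, h2, rfl⟩ := h
  refine le_trans (Set.ncard_le_ncard (t := {f | f.pi ∈ ℰ}) ?_ (Set.toFinite _)) ?_
  · rintro f ⟨hf | hf, hn⟩
    · exact absurd hf hn
    · exact hf
  · rw [ncard_flags_pi_mem hV ℰ fun τ hτ => (h1 τ hτ).1]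
    refine extra_bound hd (ncard_intersecting_le (A := ⊥) (B := H) ?_ h4 ℰ ?_ h2)
    · rw [hH, finrank_bot]; ring
    · intro π hπ
      exact ⟨bot_le, (h1 π hπ).2, by rw [(h1 π hπ).1, finrank_bot]; ring⟩

/-- The flags `(π, τ)` such that `π` meets `U` in a member of `Z`. -/
def meetFlags (d : ℕ) (U : Submodule K V) (Z : Set (Submodule K V)) : Set (TypeFlag K V d) :=
  {f | f.pi ⊓ U ∈ Z}

/-- Modulo a point of `U`, rank `d` is complementary to `U`, so the number of possible π per point
is an exact power of q. -/
theorem ncard_meetFlags (hd : 1 ≤ d) (hV : finrank K V = 2 * d + 1) {U : Submodule K V}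
    (hU : finrank K U = d + 2) {Z : Set (Submodule K V)}
    (hZ : ∀ z ∈ Z, finrank K z = 1 ∧ z ≤ U) :
    (meetFlags d U Z).ncard =
      Z.ncard * Nat.card K ^ ((d + 1) * (d - 1)) * qNum K (d + 1) := by
  have h1 : {π : Submodule K V | π ⊓ U ∈ Z ∧ finrank K π = d}.ncard =
      Z.ncard * Nat.card K ^ ((d + 1) * (d - 1)) := by
    refine ncard_eq_mul_of_fibers (fun π => π ⊓ U) (fun π hπ => hπ.1) fun z hz => ?_
    have h := ncard_inf_eq (hZ z hz).2 (k := d) (by rw [hV, hU, (hZ z hz).1]; ring)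
    rw [(hZ z hz).1, hU, show d + 2 - 1 = d + 1 by omega] at h
    rw [← h]
    congr 1; ext π
    constructor
    · rintro ⟨⟨_, h3⟩, h2⟩
      exact ⟨h2, h3⟩
    · rintro ⟨rfl, h3⟩
      exact ⟨⟨hz, h3⟩, rfl⟩
  rw [← h1, ← ncard_flags_pi_mem hV _ fun π hπ => hπ.2]
  congr 1; ext f
  constructor
  · exact fun h => ⟨h, f.finrank_pi⟩
  · exact fun h => h.1

theorem ncard_point_meetFlags_le (hd : 2 ≤ d) (hV : finrank K V = 2 * d + 1)
    {U P : Submodule K V} (hP : finrank K P = 1) (hPU : ¬ P ≤ U) {Z : Set (Submodule K V)}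
    (hZ : ∀ z ∈ Z, finrank K z = 1 ∧ z ≤ U) :
    {f ∈ meetFlags d U Z | P ≤ f.pi}.ncard ≤
      Z.ncard * (grassCard K (2 * d - 1) (d - 2) * qNum K (d + 1)) := by
  refine ncard_le_mul_of_cover (fun z f => z ≤ f.pi) ?_ ?_
  · rintro f ⟨hf, _⟩
    exact ⟨_, hf, inf_le_left⟩
  · intro z hz
    have hPz : ¬ P ≤ z := fun h => hPU (h.trans (hZ z hz).2)
    have hr := finrank_sup_point hP hPz
    rw [(hZ z hz).1] at hr
    have h := ncard_flags_ge (d := d) hV (R := z ⊔ P) (by omega)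
    rw [hr, show 2 * d + 1 - (1 + 1) = 2 * d - 1 by omega] at h
    rw [← h]
    refine Set.ncard_le_ncard ?_ (Set.toFinite _)
    rintro f ⟨⟨_, h1⟩, h2⟩
    exact (sup_le h2 h1 : z ⊔ P ≤ f.pi)

theorem ncard_hyperplane_meetFlags_le (hd : 1 ≤ d) {U H : Submodule K V}
    (hH : finrank K H = 2 * d) {Z : Set (Submodule K V)}
    (hZ : ∀ z ∈ Z, finrank K z = 1 ∧ z ≤ U) :
    {f ∈ meetFlags d U Z | f.tau ≤ H}.ncard ≤
      {z ∈ Z | z ≤ H}.ncard * (grassCard K (2 * d - 1) (d - 1) * qNum K d) := by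
  refine ncard_le_mul_of_cover (fun z f => z ≤ f.pi) ?_ ?_
  · rintro f ⟨hf, h⟩
    exact ⟨_, ⟨hf, inf_le_left.trans (f.pi_le_tau.trans h)⟩, inf_le_left⟩
  · rintro z ⟨hz, hzH⟩
    have h := ncard_flags_between (d := d) hzH (by rw [(hZ z hz).1]; exact hd)
    rw [(hZ z hz).1, hH, show 2 * d - d = d by omega] at h
    rw [← h]
    refine Set.ncard_le_ncard ?_ (Set.toFinite _)
    rintro f ⟨⟨_, h1⟩, h2⟩
    exact ⟨h2, h1⟩

/-! ### The second moment of the number of points in a hyperplane. -/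

theorem ncard_hyperplanes_ge {n : ℕ} (hV : finrank K V = n + 1) {R : Submodule K V}
    (hR : finrank K R ≤ n) :
    {H : Submodule K V | R ≤ H ∧ finrank K H = n}.ncard = qNum K (n + 1 - finrank K R) := by
  have h := ncard_ge R (n - finrank K R)
  rw [hV, show n + 1 - finrank K R = n - finrank K R + 1 by omega, grassCard_succ_self] at h
  rw [show n + 1 - finrank K R = n - finrank K R + 1 by omega, ← h]
  congr 1; ext H
  simp only [Set.mem_ofPred_eq]
  rw [show finrank K R + (n - finrank K R) = n by omega]

/-- The variance of the number of points of `Z` in a hyperplane. -/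
theorem sum_sq_hyperplanes_le {n : ℕ} (hV : finrank K V = n + 3) (Z 𝓗 : Finset (Submodule K V))
    (hZ : ∀ z ∈ Z, finrank K z = 1) (h𝓗 : ∀ H, H ∈ 𝓗 ↔ finrank K H = n + 2)
    [∀ H : Submodule K V, DecidablePred fun z => z ≤ H] :
    ∑ H ∈ 𝓗, (((Z.filter (· ≤ H)).card : ℝ) - Z.card / (Nat.card K : ℝ)) ^ 2 ≤
      Z.card * (Nat.card K : ℝ) ^ (n + 1) := by
  classical
  have hone : ∀ z ∈ Z, ∑ H ∈ 𝓗, (if z ≤ H then (1 : ℝ) else 0) = qNum K (n + 2) := by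
    intro z hz
    have h := ncard_hyperplanes_ge hV (R := z) (by rw [hZ z hz]; omega)
    rw [hZ z hz] at h
    rw [Finset.sum_boole, show n + 2 = n + 2 + 1 - 1 by omega, ← h, ← Set.ncard_coe_finset]
    congr 2; ext H; simp [h𝓗, and_comm]
  have htwo : ∀ z ∈ Z, ∀ z' ∈ Z, ∑ H ∈ 𝓗, (if z ≤ H then (1 : ℝ) else 0) *
      (if z' ≤ H then (1 : ℝ) else 0) =
        if z = z' then (qNum K (n + 2) : ℝ) else qNum K (n + 1) := by
    intro z hz z' hz'
    split_ifs with heq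
    · subst heq
      rw [← hone z hz]
      exact Finset.sum_congr rfl fun H _ => by split_ifs <;> simp
    · have hr : finrank K ↥(z ⊔ z') = 2 := by
        rw [finrank_sup_point (hZ z' hz'), hZ z hz]
        exact fun h => heq (eq_of_point_le (hZ z' hz') (hZ z hz) h).symm
      have h := ncard_hyperplanes_ge hV (R := z ⊔ z') (by omega)
      rw [hr] at h
      have hprod : ∀ H ∈ 𝓗, (if z ≤ H then (1 : ℝ) else 0) * (if z' ≤ H then (1 : ℝ) else 0) =
          if z ⊔ z' ≤ H then (1 : ℝ) else 0 := by
        intro H _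
        by_cases h1 : z ≤ H <;> by_cases h2 : z' ≤ H <;> simp [h1, h2]
      rw [Finset.sum_congr rfl hprod, Finset.sum_boole, show n + 1 = n + 2 + 1 - 2 by omega, ← h,
        ← Set.ncard_coe_finset]
      congr 2; ext H
      simp [h𝓗, and_comm]
  have hcard : (𝓗.card : ℝ) = qNum K (n + 3) := by
    have h := ncard_hyperplanes_ge hV (R := ⊥) (by simp)
    rw [finrank_bot, Nat.sub_zero] at h
    rw [← h, ← Set.ncard_coe_finset]
    congr 2; ext H; simp [h𝓗]
  have hX : ∀ H, ((Z.filter (· ≤ H)).card : ℝ) = ∑ z ∈ Z, if z ≤ H then (1 : ℝ) else 0 := by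
    intro H
    rw [Finset.sum_boole]
  have hS1 : ∑ H ∈ 𝓗, ((Z.filter (· ≤ H)).card : ℝ) = Z.card * qNum K (n + 2) := by
    simp_rw [hX]
    rw [Finset.sum_comm, Finset.sum_congr rfl hone, Finset.sum_const, nsmul_eq_mul]
  have hS2 : ∑ H ∈ 𝓗, ((Z.filter (· ≤ H)).card : ℝ) ^ 2 =
      Z.card * (qNum K (n + 2) + (Z.card - 1) * qNum K (n + 1)) := by
    have hrow : ∀ z ∈ Z, ∑ z' ∈ Z, (if z = z' then (qNum K (n + 2) : ℝ) else qNum K (n + 1)) =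
        qNum K (n + 2) + (Z.card - 1) * qNum K (n + 1) := by
      intro z hz
      have : ∀ z' ∈ Z, (if z = z' then (qNum K (n + 2) : ℝ) else qNum K (n + 1)) =
          (if z = z' then ((qNum K (n + 2) : ℝ) - qNum K (n + 1)) else 0) + qNum K (n + 1) := by
        intro z' _; split_ifs <;> ring
      rw [Finset.sum_congr rfl this, Finset.sum_add_distrib, Finset.sum_ite_eq, if_pos hz,
        Finset.sum_const, nsmul_eq_mul]
      ring
    have : ∀ H ∈ 𝓗, ((Z.filter (· ≤ H)).card : ℝ) ^ 2 = ∑ z ∈ Z, ∑ z' ∈ Z,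
        (if z ≤ H then (1 : ℝ) else 0) * (if z' ≤ H then (1 : ℝ) else 0) := by
      intro H _
      rw [hX, sq, Finset.sum_mul_sum]
    rw [Finset.sum_congr rfl this, Finset.sum_comm]
    rw [Finset.sum_congr rfl fun z hz => by
      rw [Finset.sum_comm, Finset.sum_congr rfl fun z' hz' => htwo z hz z' hz', hrow z hz]]
    rw [Finset.sum_const, nsmul_eq_mul]
  have hQ : (2 : ℝ) ≤ Nat.card K := by exact_mod_cast (Finite.one_lt_card : 1 < Nat.card K)
  have q1 : (qNum K (n + 2) : ℝ) = Nat.card K * qNum K (n + 1) + 1 := by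
    rw [qNum_succ']; push_cast; rfl
  have q2 : (qNum K (n + 3) : ℝ) = Nat.card K * qNum K (n + 2) + 1 := by
    rw [qNum_succ']; push_cast; rfl
  have q3 : (qNum K (n + 2) : ℝ) = qNum K (n + 1) + (Nat.card K : ℝ) ^ (n + 1) := by
    rw [qNum_succ (n + 1)]; push_cast; rfl
  have hexp : ∑ H ∈ 𝓗, (((Z.filter (· ≤ H)).card : ℝ) - Z.card / (Nat.card K : ℝ)) ^ 2 =
      Z.card * (qNum K (n + 2) + (Z.card - 1) * qNum K (n + 1)) -
        2 * (Z.card / (Nat.card K : ℝ)) * (Z.card * qNum K (n + 2)) +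
        qNum K (n + 3) * (Z.card / (Nat.card K : ℝ)) ^ 2 := by
    rw [← hS1, ← hS2, ← hcard, Finset.mul_sum, ← Finset.sum_sub_distrib, ← nsmul_eq_mul,
      ← Finset.sum_const, ← Finset.sum_add_distrib]
    exact Finset.sum_congr rfl fun H _ => by ring
  rw [hexp]
  set Q : ℝ := (Nat.card K : ℝ)
  set z : ℝ := (Z.card : ℝ)
  have hz : 0 ≤ z := by positivity
  have hQ0 : Q ≠ 0 := by linarith
  -- Deviations are taken from z/q instead of the exact mean; the resulting error term has a
  -- favourable sign.
  have e : z * (qNum K (n + 2) + (z - 1) * qNum K (n + 1)) -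
      2 * (z / Q) * (z * qNum K (n + 2)) + qNum K (n + 3) * (z / Q) ^ 2 =
      z * Q ^ (n + 1) - z ^ 2 * (Q - 1) / Q ^ 2 := by
    have q4 : Q ^ (n + 1) = Q * qNum K (n + 1) + 1 - qNum K (n + 1) := by linarith
    rw [q2, q4, q1]
    field_simp
    ring
  rw [e]
  have : 0 ≤ z ^ 2 * (Q - 1) / Q ^ 2 := by
    have : 0 ≤ Q - 1 := by linarith
    positivity
  linarith

/-- Few hyperplanes contain many more points of `Z` than expected. -/
theorem ncard_rich_hyperplanes {n : ℕ} (hV : finrank K V = n + 3) {Z : Set (Submodule K V)}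
    (hZ : ∀ z ∈ Z, finrank K z = 1) {t : ℝ} (ht : 0 ≤ t) :
    ({H : Submodule K V | finrank K H = n + 2 ∧
      Z.ncard / (Nat.card K : ℝ) + t ≤ {z ∈ Z | z ≤ H}.ncard}.ncard : ℝ) * t ^ 2 ≤
      Z.ncard * (Nat.card K : ℝ) ^ (n + 1) := by
  classical
  have := Fintype.ofFinite (Submodule K V)
  lift Z to Finset (Submodule K V) using Set.toFinite Z
  set 𝓗 : Finset (Submodule K V) := Finset.univ.filter fun H => finrank K H = n + 2
  have h := sum_sq_hyperplanes_le hV Z 𝓗 (fun z hz => hZ z hz) (fun H => by simp [𝓗])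
  have hf : ∀ H, {z ∈ (Z : Set (Submodule K V)) | z ≤ H}.ncard = (Z.filter (· ≤ H)).card := by
    intro H
    rw [← Set.ncard_coe_finset]; congr 1; ext; simp
  simp_rw [hf]
  rw [Set.ncard_coe_finset]
  set 𝓑 : Finset (Submodule K V) := 𝓗.filter fun H =>
    Z.card / (Nat.card K : ℝ) + t ≤ (Z.filter (· ≤ H)).card with h𝓑
  have hB : {H : Submodule K V | finrank K H = n + 2 ∧
      Z.card / (Nat.card K : ℝ) + t ≤ (Z.filter (· ≤ H)).card} = (𝓑 : Set (Submodule K V)) := by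
    ext; simp [h𝓑, 𝓗]
  rw [hB, Set.ncard_coe_finset, ← nsmul_eq_mul]
  refine (Finset.card_nsmul_le_sum 𝓑 _ _ fun H hH => ?_).trans
    ((Finset.sum_le_sum_of_subset_of_nonneg (Finset.filter_subset _ _)
      fun _ _ _ => sq_nonneg _).trans h)
  rw [Finset.mem_filter] at hH
  have := hH.2
  exact pow_le_pow_left₀ ht (by linarith) 2

end Bounds

/-! ### Flags selected on the lines that meet the set of free points. -/

section Secants

variable {K V : Type*} [Field K] [Finite K] [AddCommGroup V] [Module K V] [FiniteDimensional K V]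
  {d : ℕ}

/-- The lines of `U` that meet `Z`. -/
def secants (U : Submodule K V) (Z : Set (Submodule K V)) : Set (Submodule K V) :=
  {L | L ≤ U ∧ finrank K L = 2 ∧ ∃ z ∈ Z, z ≤ L}

/-- The flags `(π, τ)` such that `τ` meets `U` in a line `L` that meets `Z` and `π` meets `L` in
the chosen point `ζ L`. -/
def selectedFlags (d : ℕ) (U : Submodule K V) (Z : Set (Submodule K V))
    (ζ : Submodule K V → Submodule K V) : Set (TypeFlag K V d) :=
  {f | f.tau ⊓ U ∈ secants U Z ∧ ζ (f.tau ⊓ U) ≤ f.pi ∧ ¬ f.tau ⊓ U ≤ f.pi}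

/-- Bonferroni for the pencils of lines at the points of `Z`: two pencils share at most one line. -/
theorem le_ncard_secants {U : Submodule K V} (hU : finrank K U = d + 2) {Z : Set (Submodule K V)}
    (hZ : ∀ z ∈ Z, finrank K z = 1 ∧ z ≤ U) :
    Z.ncard * qNum K (d + 1) ≤ (secants U Z).ncard + Z.ncard ^ 2 := by
  classical
  lift Z to Finset (Submodule K V) using Set.toFinite Z
  rw [Set.ncard_coe_finset]
  have h := sum_ncard_le_biUnion Z
    (fun z => {L : Submodule K V | z ≤ L ∧ L ≤ U ∧ finrank K L = 2}) 1 (by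
      intro z hz z' hz' hne
      rw [Set.ncard_le_one (Set.toFinite _)]
      have hr : finrank K ↥(z ⊔ z') = 2 := by
        rw [finrank_sup_point (hZ z' hz').1, (hZ z hz).1]
        exact fun h => hne (eq_of_point_le (hZ z' hz').1 (hZ z hz).1 h).symm
      have huniq : ∀ L, L ∈ {L : Submodule K V | z ≤ L ∧ L ≤ U ∧ finrank K L = 2} ∩
          {L : Submodule K V | z' ≤ L ∧ L ≤ U ∧ finrank K L = 2} → z ⊔ z' = L := by
        rintro L ⟨⟨h1, _, h2⟩, h3, _⟩
        exact Submodule.eq_of_le_of_finrank_eq (sup_le h1 h3) (by rw [hr, h2])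
      intro L hL L' hL'
      rw [← huniq L hL, ← huniq L' hL'])
  have hs : ∑ z ∈ Z, {L : Submodule K V | z ≤ L ∧ L ≤ U ∧ finrank K L = 2}.ncard =
      Z.card * qNum K (d + 1) := by
    refine Finset.sum_const_nat fun z hz => ?_
    have h1 := ncard_interval (hZ z hz).2 1
    rw [(hZ z hz).1, hU, grassCard_one, show d + 2 - 1 = d + 1 by omega] at h1
    exact h1
  rw [hs, mul_one] at h
  refine h.trans (Nat.add_le_add_right (Set.ncard_le_ncard ?_ (Set.toFinite _)) _)
  intro L hL
  simp only [Set.mem_iUnion, exists_prop] at hL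
  obtain ⟨z, hz, h1, h2, h3⟩ := hL
  exact ⟨h2, h3, z, hz, h1⟩

variable {U : Submodule K V} {Z : Set (Submodule K V)} {ζ : Submodule K V → Submodule K V}

theorem selectedFlags_subset (hZ : ∀ z ∈ Z, finrank K z = 1 ∧ z ≤ U)
    (hζ : ∀ L ∈ secants U Z, ζ L ∈ Z ∧ ζ L ≤ L) {f : TypeFlag K V d}
    (hf : f ∈ selectedFlags d U Z ζ) : f.pi ⊓ U = ζ (f.tau ⊓ U) := by
  obtain ⟨h1, h2, h3⟩ := hf
  obtain ⟨h4, h5⟩ := hζ _ h1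
  have h6 := eq_of_rank_succ h5 h2 (by rw [h1.2.1, (hZ _ h4).1]) h3
  rw [← h6]
  refine le_antisymm (le_inf (inf_le_inf_right _ f.pi_le_tau) inf_le_left)
    (le_inf inf_le_right (inf_le_left.trans inf_le_right))

/-- The hyperplanes of `τ` through the chosen point but not through the line number `qNum K d - qNum
K (d - 1)`, that is q^(d-1). -/
theorem ncard_selectedFlags_fiber (hd : 2 ≤ d) (hZ : ∀ z ∈ Z, finrank K z = 1 ∧ z ≤ U)
    (hζ : ∀ L ∈ secants U Z, ζ L ∈ Z ∧ ζ L ≤ L) {τ : Submodule K V} (hτ : finrank K τ = d + 1)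
    (hL : τ ⊓ U ∈ secants U Z) :
    {f ∈ selectedFlags d U Z ζ | f.tau = τ}.ncard = Nat.card K ^ (d - 1) := by
  obtain ⟨h4, h5⟩ := hζ _ hL
  have c1 := ncard_flags_tau_eq (d := d) hτ (h5.trans inf_le_left) (by rw [(hZ _ h4).1]; omega)
  have c2 := ncard_flags_tau_eq (d := d) hτ (R := τ ⊓ U) inf_le_left (by rw [hL.2.1]; omega)
  rw [(hZ _ h4).1] at c1
  rw [hL.2.1] at c2
  have hset : {f ∈ selectedFlags d U Z ζ | f.tau = τ} =
      {f : TypeFlag K V d | f.tau = τ ∧ ζ (τ ⊓ U) ≤ f.pi} \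
        {f : TypeFlag K V d | f.tau = τ ∧ τ ⊓ U ≤ f.pi} := by
    ext f
    constructor
    · rintro ⟨⟨_, h2, h3⟩, rfl⟩
      exact ⟨⟨rfl, h2⟩, fun h => h3 h.2⟩
    · rintro ⟨⟨rfl, h2⟩, h3⟩
      exact ⟨⟨hL, h2, fun h => h3 ⟨rfl, h⟩⟩, rfl⟩
  have h := Set.ncard_sdiff_add_ncard_of_subset (s := {f : TypeFlag K V d | f.tau = τ ∧ τ ⊓ U ≤ f.pi})
    (t := {f : TypeFlag K V d | f.tau = τ ∧ ζ (τ ⊓ U) ≤ f.pi})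
    (fun f hf => ⟨hf.1, h5.trans hf.2⟩) (Set.toFinite _)
  rw [← hset, c1, c2] at h
  obtain ⟨e, rfl⟩ : ∃ e, d = e + 1 := ⟨d - 1, by omega⟩
  rw [show e + 1 + 1 - 1 = e + 1 by omega, show e + 1 + 1 - 2 = e by omega, qNum_succ] at h
  rw [Nat.add_sub_cancel]
  omega

theorem ncard_selectedFlags (hd : 2 ≤ d) (hV : finrank K V = 2 * d + 1) (hU : finrank K U = d + 2)
    (hZ : ∀ z ∈ Z, finrank K z = 1 ∧ z ≤ U) (hζ : ∀ L ∈ secants U Z, ζ L ∈ Z ∧ ζ L ≤ L) :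
    (selectedFlags d U Z ζ).ncard =
      (secants U Z).ncard * Nat.card K ^ (d * (d - 1)) * Nat.card K ^ (d - 1) := by
  have h1 : {τ : Submodule K V | τ ⊓ U ∈ secants U Z ∧ finrank K τ = d + 1}.ncard =
      (secants U Z).ncard * Nat.card K ^ (d * (d - 1)) := by
    refine ncard_eq_mul_of_fibers (fun τ => τ ⊓ U) (fun τ hτ => hτ.1) fun L hL => ?_
    have h := ncard_inf_eq hL.1 (k := d + 1) (by rw [hV, hU, hL.2.1]; ring)
    rw [hL.2.1, hU, show d + 2 - 2 = d by omega, show d + 1 - 2 = d - 1 by omega] at h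
    rw [← h]
    congr 1; ext τ
    constructor
    · rintro ⟨⟨_, h3⟩, h2⟩
      exact ⟨h2, h3⟩
    · rintro ⟨rfl, h3⟩
      exact ⟨⟨hL, h3⟩, rfl⟩
  rw [← h1]
  exact ncard_eq_mul_of_fibers (fun f => f.tau) (fun f hf => ⟨hf.1, f.finrank_tau⟩)
    fun τ hτ => ncard_selectedFlags_fiber hd hZ hζ hτ.2 hτ.1

/-- For a selected flag, `π` meets `U` only in a point of `Z`, hence `P ≰ π` and the generic part of
`F` contributes nothing. What remains comes from `τ ∈ 𝒰`, with q^(d-1) selected flags each. The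
crude bound on `t` first makes `Z` small; the sharp one then decides the final count. -/
theorem exists_family_selectedFlags (hd : 3 ≤ d) (hV : finrank K V = 2 * d + 1)
    (h8 : 8 ≤ Nat.card K) (hU : finrank K U = d + 2)
    (hZ : ∀ z ∈ Z, finrank K z = 1 ∧ z ≤ U) (hζ : ∀ L ∈ secants U Z, ζ L ∈ Z ∧ ζ L ≤ L)
    {F : Set (TypeFlag K V d)} {P : Submodule K V} (hF : IsBasedOnPoint F P) (hPU : P ≤ U)
    (hPZ : P ∉ Z) :
    ∃ t : ℕ, (F ∩ selectedFlags d U Z ζ).ncard ≤ t * Nat.card K ^ (d - 1) ∧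
      t ≤ 2 ^ (d + 1) * Nat.card K ^ (d * (d - 1)) ∧
      (8 * Z.ncard ≤ Nat.card K ^ 2 → t ≤ Nat.card K ^ (d * (d - 1))) := by
  obtain ⟨hP, 𝒰, h1, h2, rfl⟩ := hF
  refine ⟨{τ ∈ 𝒰 | τ ⊓ U ∈ secants U Z}.ncard, ?_, ?_, ?_⟩
  · refine ncard_le_mul_of_cover (fun τ f => f.tau = τ) ?_ ?_
    · rintro f ⟨hf | hf, hsel⟩
      · exfalso
        have h3 := selectedFlags_subset hZ hζ hsel
        have h4 := (hζ _ hsel.1).1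
        have h5 : P ≤ ζ (f.tau ⊓ U) := h3 ▸ le_inf hf hPU
        exact hPZ (eq_of_point_le hP (hZ _ h4).1 h5 ▸ h4)
      · exact ⟨_, ⟨hf, hsel.1⟩, rfl⟩
    · rintro τ ⟨hτ, hL⟩
      rw [← ncard_selectedFlags_fiber (by omega) hZ hζ (h1 τ hτ).1 hL]
      refine Set.ncard_le_ncard ?_ (Set.toFinite _)
      rintro f ⟨⟨_, h3⟩, h4⟩
      exact ⟨h3, h4⟩
  · exact ncard_pointFamily_le hV (by omega) hP (fun τ hτ => h1 τ hτ.1)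
      fun τ hτ τ' hτ' => h2 τ hτ.1 τ' hτ'.1
  · intro hZc
    refine ncard_le_of_meets_line hd hV h8 hP hPU hU hZ hPZ hZc _ ?_
      fun τ hτ τ' hτ' => h2 τ hτ.1 τ' hτ'.1
    rintro τ ⟨hτ, _, hr, z, hz, hzL⟩
    exact ⟨(h1 τ hτ).1, (h1 τ hτ).2, hr, z, hz, hzL.trans inf_le_left⟩

end Secants

/-! ### Intersections with the test flags, in units of one point's worth. -/

section Estimates

variable {K V : Type*} [Field K] [Finite K] [AddCommGroup V] [Module K V] [FiniteDimensional K V]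
  {d : ℕ}

/-- The number of flags `(π, τ)` such that `π` meets a given subspace of rank `d + 2` in a given
point. -/
noncomputable def meetCard (K : Type*) (d : ℕ) : ℝ :=
  (Nat.card K : ℝ) ^ ((d + 1) * (d - 1)) * qNum K (d + 1)

/-- An upper bound for the number of flags of an example outside its generic part. -/
noncomputable def extraCard (K : Type*) (d : ℕ) : ℝ :=
  2 ^ (d + 2) * (Nat.card K : ℝ) ^ (d * d)

theorem genericCard_le_meetCard (hd : 1 ≤ d) (h4 : 4 ≤ Nat.card K) :
    (genericCard K d : ℝ) ≤ (1 + 2 / (Nat.card K : ℝ)) * meetCard K d := by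
  have h := grassCard_le (K := K) (d + 1) (d - 1) h4
  rw [show d + 1 + (d - 1) = 2 * d by omega, mul_comm (d - 1)] at h
  rw [genericCard, meetCard]
  push_cast
  rw [← mul_assoc]
  gcongr

theorem le_meetCard (hd : 1 ≤ d) :
    (Nat.card K : ℝ) ^ (d * d + d - 1) ≤ meetCard K d := by
  have h : (Nat.card K : ℝ) ^ d ≤ qNum K (d + 1) := by exact_mod_cast pow_le_qNum d
  obtain ⟨e, rfl⟩ : ∃ e, d = e + 1 := ⟨d - 1, by omega⟩
  rw [meetCard]
  calc (Nat.card K : ℝ) ^ ((e + 1) * (e + 1) + (e + 1) - 1)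
      = (Nat.card K : ℝ) ^ ((e + 1 + 1) * (e + 1 - 1)) * (Nat.card K : ℝ) ^ (e + 1) := by
        rw [← pow_add]; congr 1
        rw [show (e + 1) * (e + 1) + (e + 1) - 1 = (e + 1) * (e + 1) + e by omega,
          Nat.add_sub_cancel]; ring
    _ ≤ _ := by gcongr

/-- Non-generic parts are negligible: they are smaller than `meetCard` by q^(d-1), up to the
constant 2^(d+2). -/
theorem extraCard_mul_le (hd : 1 ≤ d) :
    extraCard K d * (Nat.card K : ℝ) ^ (d - 1) ≤ 2 ^ (d + 2) * meetCard K d := by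
  rw [extraCard, mul_assoc, ← pow_add]
  have := le_meetCard (K := K) hd
  rw [show d * d + (d - 1) = d * d + d - 1 by omega]
  gcongr

theorem card_pos_real : (0 : ℝ) < Nat.card K := by
  exact_mod_cast Nat.card_pos

/-- In the generic part, `π` contains the line joining `P` to a point of `Z`. For each such point
this leaves a fraction of about q^(-(d+1)) of `meetCard`. -/
theorem IsBasedOnPoint.inter_meetFlags_le (hd : 2 ≤ d) (hV : finrank K V = 2 * d + 1)
    (h4 : 4 ≤ Nat.card K) {U P : Submodule K V} {F : Set (TypeFlag K V d)}
    (hF : IsBasedOnPoint F P) (hPU : ¬ P ≤ U) {Z : Set (Submodule K V)}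
    (hZ : ∀ z ∈ Z, finrank K z = 1 ∧ z ≤ U) :
    ((F ∩ meetFlags d U Z).ncard : ℝ) ≤ extraCard K d +
      Z.ncard * (1 + 2 / (Nat.card K : ℝ)) / (Nat.card K : ℝ) ^ (d + 1) * meetCard K d := by
  have h1 := hF.extra_le (by omega) hV h4
  have h2 := ncard_point_meetFlags_le hd hV hF.1 hPU hZ
  have h3 : (F ∩ meetFlags d U Z).ncard ≤ {f ∈ F | ¬ P ≤ f.pi}.ncard +
      {f ∈ meetFlags d U Z | P ≤ f.pi}.ncard := by
    refine le_trans (Set.ncard_le_ncard ?_ (Set.toFinite _)) (Set.ncard_union_le _ _)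
    rintro f ⟨hf, hm⟩
    by_cases h : P ≤ f.pi
    · exact Or.inr ⟨hm, h⟩
    · exact Or.inl ⟨hf, h⟩
  have h5 : ((F ∩ meetFlags d U Z).ncard : ℝ) ≤ 2 ^ (d + 2) * (Nat.card K : ℝ) ^ (d * d) +
      Z.ncard * (grassCard K (2 * d - 1) (d - 2) * qNum K (d + 1)) := by
    exact_mod_cast h3.trans (Nat.add_le_add h1 h2)
  have h := grassCard_le (K := K) (d + 1) (d - 2) h4
  rw [show d + 1 + (d - 2) = 2 * d - 1 by omega] at h
  refine h5.trans ?_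
  rw [extraCard]
  have hQ := card_pos_real (K := K)
  have e : (Z.ncard : ℝ) * (1 + 2 / (Nat.card K : ℝ)) / (Nat.card K : ℝ) ^ (d + 1) * meetCard K d =
      Z.ncard * ((1 + 2 / (Nat.card K : ℝ)) * (Nat.card K : ℝ) ^ ((d - 2) * (d + 1)) *
        qNum K (d + 1)) := by
    rw [meetCard, show (d + 1) * (d - 1) = (d + 1) + (d - 2) * (d + 1) by
      rw [show d - 1 = 1 + (d - 2) by omega]; ring, pow_add]
    field_simp
    ring
  rw [e]
  gcongr

/-- Only the points of `Z` in `H` matter, each with a fraction of about q^(-d) of `meetCard`. The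
second bound is the size of the whole set, for hyperplanes with too many points of `Z`. -/
theorem IsBasedOnHyperplane.inter_meetFlags_le (hd : 2 ≤ d) (hV : finrank K V = 2 * d + 1)
    (h4 : 4 ≤ Nat.card K) {U H : Submodule K V} {F : Set (TypeFlag K V d)}
    (hF : IsBasedOnHyperplane F H) {Z : Set (Submodule K V)}
    (hZ : ∀ z ∈ Z, finrank K z = 1 ∧ z ≤ U) :
    ((F ∩ meetFlags d U Z).ncard : ℝ) ≤ extraCard K d +
      {z ∈ Z | z ≤ H}.ncard * (1 + 2 / (Nat.card K : ℝ)) / (Nat.card K : ℝ) ^ d * meetCard K d ∧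
    ((F ∩ meetFlags d U Z).ncard : ℝ) ≤ extraCard K d +
      (1 + 2 / (Nat.card K : ℝ)) * meetCard K d := by
  have h1 := hF.extra_le (by omega) hV h4
  have h2 := ncard_hyperplane_meetFlags_le (by omega : 1 ≤ d) hF.1 hZ
  have h2' : {f ∈ meetFlags d U Z | f.tau ≤ H}.ncard ≤ genericCard K d := by
    rw [← ncard_flags_hyperplane (by omega : 1 ≤ d) hF.1]
    exact Set.ncard_le_ncard (fun f hf => hf.2) (Set.toFinite _)
  have h3 : (F ∩ meetFlags d U Z).ncard ≤ {f ∈ F | ¬ f.tau ≤ H}.ncard +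
      {f ∈ meetFlags d U Z | f.tau ≤ H}.ncard := by
    refine le_trans (Set.ncard_le_ncard ?_ (Set.toFinite _)) (Set.ncard_union_le _ _)
    rintro f ⟨hf, hm⟩
    by_cases h : f.tau ≤ H
    · exact Or.inr ⟨hm, h⟩
    · exact Or.inl ⟨hf, h⟩
  have hQ := card_pos_real (K := K)
  constructor
  · have h5 : ((F ∩ meetFlags d U Z).ncard : ℝ) ≤ 2 ^ (d + 2) * (Nat.card K : ℝ) ^ (d * d) +
        {z ∈ Z | z ≤ H}.ncard * (grassCard K (2 * d - 1) (d - 1) * qNum K d) := by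
      exact_mod_cast h3.trans (Nat.add_le_add h1 h2)
    have h := grassCard_le (K := K) d (d - 1) h4
    rw [show d + (d - 1) = 2 * d - 1 by omega] at h
    refine h5.trans ?_
    rw [extraCard]
    have h6 : (Nat.card K : ℝ) * qNum K d ≤ qNum K (d + 1) := by
      have := qNum_succ' (K := K) d
      exact_mod_cast (by omega : Nat.card K * qNum K d ≤ qNum K (d + 1))
    have e : ({z ∈ Z | z ≤ H}.ncard : ℝ) * (1 + 2 / (Nat.card K : ℝ)) / (Nat.card K : ℝ) ^ d *
        ((Nat.card K : ℝ) ^ ((d + 1) * (d - 1)) * (Nat.card K * qNum K d)) =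
        {z ∈ Z | z ≤ H}.ncard * ((1 + 2 / (Nat.card K : ℝ)) * (Nat.card K : ℝ) ^ ((d - 1) * d) *
        qNum K d) := by
      have : (Nat.card K : ℝ) ^ ((d + 1) * (d - 1)) * Nat.card K =
          (Nat.card K : ℝ) ^ d * (Nat.card K : ℝ) ^ ((d - 1) * d) := by
        rw [← pow_succ, ← pow_add]; congr 1
        obtain ⟨e, rfl⟩ : ∃ e, d = e + 1 := ⟨d - 1, by omega⟩
        rw [Nat.add_sub_cancel]; ring
      rw [← mul_assoc ((Nat.card K : ℝ) ^ ((d + 1) * (d - 1))), this]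
      field_simp
    refine add_le_add le_rfl (le_trans ?_ (mul_le_mul_of_nonneg_left
      (mul_le_mul_of_nonneg_left h6 (by positivity)) (by positivity)))
    rw [e]
    gcongr
  · have h5 : ((F ∩ meetFlags d U Z).ncard : ℝ) ≤ 2 ^ (d + 2) * (Nat.card K : ℝ) ^ (d * d) +
        genericCard K d := by
      exact_mod_cast h3.trans (Nat.add_le_add h1 h2')
    exact h5.trans (add_le_add le_rfl (genericCard_le_meetCard (by omega) h4))

end Estimates

/-! ### Covers relative to a subspace of rank d + 2. -/

section Cover

variable {K V : Type*} [Field K] [Finite K] [AddCommGroup V] [Module K V] [FiniteDimensional K V]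
  {d : ℕ}

theorem ncard_le_sum_inter {ι α : Type*} [Fintype ι] [Finite α] {F : ι → Set α}
    (hcover : ⋃ i, F i = Set.univ) (G : Set α) : G.ncard ≤ ∑ i, (F i ∩ G).ncard := by
  have h : G = ⋃ i ∈ (Finset.univ : Finset ι), F i ∩ G := by
    simp only [Finset.mem_univ, Set.iUnion_true]
    rw [← Set.iUnion_inter, hcover, Set.univ_inter]
  nth_rw 1 [h]
  exact Finset.set_ncard_biUnion_le _ _

/-- The classification of a cover by independent sets relative to a subspace `U`: the members of
`J` are based on distinct points of `U`, the other sets are based on points outside of `U`, on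
distinct hyperplanes (for the indices in `J'`), or small. -/
structure IsClassified {N : ℕ} (F : Fin N → Set (TypeFlag K V d)) (U : Submodule K V)
    (J J' : Finset (Fin N)) (P H : Fin N → Submodule K V) : Prop where
  point : ∀ i ∈ J, IsBasedOnPoint (F i) (P i) ∧ P i ≤ U
  point_inj : Set.InjOn P J
  hyperplane : ∀ i ∈ J', IsBasedOnHyperplane (F i) (H i)
  hyperplane_inj : Set.InjOn H J'
  other : ∀ i, i ∉ J → i ∉ J' → (∃ Q, IsBasedOnPoint (F i) Q ∧ ¬ Q ≤ U) ∨
    8 * ((F i).ncard : ℝ) ≤ (Nat.card K : ℝ) ^ (d * d + d - 1)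

theorem add_card_eq_qNum {N : ℕ}
    (hN : N = theta (Nat.card K) (d + 1) - Nat.card K) : N + Nat.card K = qNum K (d + 2) := by
  have h1 : qNum K (d + 2) = Nat.card K * qNum K (d + 1) + 1 := qNum_succ' (d + 1)
  have h2 : 1 ≤ qNum K (d + 1) := qNum_pos d
  have h3 : Nat.card K * 1 ≤ Nat.card K * qNum K (d + 1) := Nat.mul_le_mul_left _ h2
  change N = qNum K (d + 2) - Nat.card K at hN
  omega

/-- Here `m` counts the indices outside `J`, `z` the free points and `b` the rich hyperplanes.
Cancelling `m` leaves c m/2 + q ≤ E q² + b c, and `hb` lets the term b c be absorbed. -/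
theorem few_others_arith {c m z b Q E : ℝ} (hc0 : 0 < c) (hc1 : c ≤ 1) (hm : 0 ≤ m) (hQ : 0 < Q)
    (hE : 0 ≤ E) (hz : z = m + Q) (hb : 1000 * b ≤ 16 * z)
    (h : z ≤ E * Q ^ 2 + m * (1 - c / 2) + b * c) : c * m ≤ 4 * E * Q ^ 2 := by
  have h1 : b * c ≤ 16 / 1000 * (m + Q) * c := by
    gcongr; linarith
  have h2 : c * Q ≤ Q := by nlinarith
  have h3 : 0 ≤ c * m := by positivity
  have h4 : 0 ≤ E * Q ^ 2 := by positivity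
  have h5 : m * (1 - c / 2) = m - c * m / 2 := by ring
  have h6 : 16 / 1000 * (m + Q) * c = 16 / 1000 * (c * m) + 16 / 1000 * (c * Q) := by ring
  rw [h5] at h
  rw [h6] at h1
  linarith

theorem add_sq_le_arith {m Q : ℝ} (hm : 1 ≤ m) (hQ : 1 ≤ Q) (hmQ : m ≤ Q ^ 2) :
    (m + Q) ^ 2 ≤ m * (4 * Q ^ 2) := by
  have h1 : m * m ≤ m * Q ^ 2 := by gcongr
  have h2 : m * Q ≤ m * Q ^ 2 := by
    gcongr; nlinarith
  have h3 : 1 * Q ^ 2 ≤ m * Q ^ 2 := by gcongr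
  have h4 : (m + Q) ^ 2 = m * m + 2 * (m * Q) + Q ^ 2 := by ring
  linarith

/-- The points of `U` on which no member of `J` is based. -/
def freePoints {N : ℕ} (U : Submodule K V) (J : Finset (Fin N)) (P : Fin N → Submodule K V) :
    Set (Submodule K V) :=
  {z | z ≤ U ∧ finrank K z = 1 ∧ ∀ i ∈ J, P i ≠ z}

variable {N : ℕ} {F : Fin N → Set (TypeFlag K V d)} {U : Submodule K V}
  {J J' : Finset (Fin N)} {P H : Fin N → Submodule K V}

/-- Since `N` is q less than the number of points of `U`, this shows that there are exactly q more
free points than indices outside `J`. -/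
theorem IsClassified.ncard_freePoints (h : IsClassified F U J J' P H)
    (hU : finrank K U = d + 2) : (freePoints U J P).ncard + J.card = qNum K (d + 2) := by
  classical
  have h1 : (P '' (J : Set (Fin N))).ncard = J.card := by
    rw [h.point_inj.ncard_image, Set.ncard_coe_finset]
  rw [← hU, ← points_ncard U, ← h1]
  rw [← Set.ncard_union_eq _ (Set.toFinite _) (Set.toFinite _)]
  · congr 1
    ext z
    constructor
    · rintro (⟨h2, h3, _⟩ | ⟨i, hi, rfl⟩)
      · exact ⟨h2, h3⟩
      · exact ⟨(h.point i hi).2, (h.point i hi).1.1⟩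
    · rintro ⟨h2, h3⟩
      by_cases h4 : ∃ i ∈ J, P i = z
      · obtain ⟨i, hi, rfl⟩ := h4
        exact Or.inr ⟨i, hi, rfl⟩
      · push Not at h4
        exact Or.inl ⟨h2, h3, h4⟩
  · rw [Set.disjoint_left]
    rintro _ ⟨_, _, h2⟩ ⟨i, hi, rfl⟩
    exact h2 i hi rfl

theorem freePoints_spec : ∀ z ∈ freePoints U J P, finrank K z = 1 ∧ z ≤ U :=
  fun _ hz => ⟨hz.2.1, hz.1⟩

theorem IsClassified.inter_meetFlags_le (h : IsClassified F U J J' P H) (hd : 2 ≤ d)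
    (hV : finrank K V = 2 * d + 1) (h4 : 4 ≤ Nat.card K) {i : Fin N} (hi : i ∈ J) :
    ((F i ∩ meetFlags d U (freePoints U J P)).ncard : ℝ) ≤ extraCard K d := by
  have h1 := (h.point i hi).1.extra_le (by omega) hV h4
  have h2 : F i ∩ meetFlags d U (freePoints U J P) ⊆ {f ∈ F i | ¬ P i ≤ f.pi} := by
    rintro f ⟨hf, hm⟩
    refine ⟨hf, fun hP => ?_⟩
    have h3 : P i ≤ f.pi ⊓ U := le_inf hP (h.point i hi).2
    exact hm.2.2 i hi (eq_of_point_le (h.point i hi).1.1 hm.2.1 h3)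
  rw [extraCard]
  exact_mod_cast (Set.ncard_le_ncard h2 (Set.toFinite _)).trans h1

set_option maxHeartbeats 1000000 in
/-- If the members of `J` have positive density in `U`, then only few indices are not in `J`. -/
theorem IsClassified.few_others (h : IsClassified F U J J' P H) (hd : 3 ≤ d)
    (hV : finrank K V = 2 * d + 1) (hU : finrank K U = d + 2)
    (hcover : ⋃ i, F i = Set.univ) (hN : N = theta (Nat.card K) (d + 1) - Nat.card K)
    {c : ℝ} (hc0 : 0 < c) (hc1 : c ≤ 1) (hq : 1000 ≤ c ^ 2 * Nat.card K)
    (hJ : c * (Nat.card K : ℝ) ^ (d + 1) ≤ J.card) :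
    c * (Jᶜ.card : ℝ) ≤ 2 ^ (d + 5) * (Nat.card K : ℝ) ^ 2 := by
  classical
  set Z := freePoints U J P with hZdef
  have hZ : ∀ z ∈ Z, finrank K z = 1 ∧ z ≤ U := freePoints_spec
  have hzc := h.ncard_freePoints hU
  rw [← hZdef] at hzc
  have hQpos := card_pos_real (K := K)
  have hc2 : c ^ 2 ≤ 1 := pow_le_one₀ hc0.le hc1
  have hQ1000 : (1000 : ℝ) ≤ Nat.card K := by nlinarith
  have hqn : 1000 ≤ Nat.card K := by exact_mod_cast hQ1000
  have h4 : 4 ≤ Nat.card K := by omega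
  set Q : ℝ := (Nat.card K : ℝ) with hQ
  set g := meetCard K d with hg
  set X := extraCard K d with hX
  have hgpos : 0 < g := by
    have := le_meetCard (K := K) (d := d) (by omega)
    exact lt_of_lt_of_le (by positivity) this
  have hX0 : 0 ≤ X := by rw [hX, extraCard]; positivity
  -- The hyperplanes with at least (c/4) q^d points of `Z` above the average. Without such an
  -- excess, a hyperplane-based set has at most (1 - c/2) g test flags besides its non-generic ones.
  set R := {H : Submodule K V | finrank K H = 2 * d ∧
    Z.ncard / Q + c / 4 * Q ^ d ≤ {z ∈ Z | z ≤ H}.ncard} with hR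
  set B := J'.filter fun i => H i ∈ R with hB
  have hQd : 0 < Q ^ d := by positivity
  have hinv : 1 / Q ≤ c / 1000 := by
    rw [div_le_div_iff₀ hQpos (by norm_num)]
    nlinarith
  have hz_le : (Z.ncard : ℝ) ≤ Q ^ (d + 1) * (1 + 2 / Q - c) := by
    have e1 : (Z.ncard : ℝ) + J.card = qNum K (d + 2) := by exact_mod_cast hzc
    have e2 : (qNum K (d + 2) : ℝ) ≤ Q ^ (d + 1) + 2 * Q ^ d := by
      have e3 : qNum K (d + 2) = qNum K (d + 1) + Nat.card K ^ (d + 1) := qNum_succ (d + 1)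
      have e4 := qNum_succ_le (K := K) d
      rw [hQ]
      exact_mod_cast (by omega : qNum K (d + 2) ≤ Nat.card K ^ (d + 1) + 2 * Nat.card K ^ d)
    have e5 : Q ^ (d + 1) * (1 + 2 / Q - c) = Q ^ (d + 1) + 2 * Q ^ d - c * Q ^ (d + 1) := by
      field_simp; ring
    linarith
  have hfac : (1 + 2 / Q) * (1 + 2 / Q - c + c / 4) ≤ 1 - c / 2 := by
    have e1 : 2 / Q = 2 * (1 / Q) := by ring
    have e2 : 0 < 1 / Q := by positivity
    rw [e1]
    nlinarith
  have hterm : ∀ i, ((F i ∩ meetFlags d U Z).ncard : ℝ) ≤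
      X + (if i ∈ J then 0 else (1 - c / 2) * g) + (if i ∈ B then c * g else 0) := by
    intro i
    have hB0 : 0 ≤ (if i ∈ B then c * g else 0) := by split_ifs <;> positivity
    by_cases hi : i ∈ J
    · rw [if_pos hi]
      have := h.inter_meetFlags_le (by omega) hV h4 hi
      linarith
    rw [if_neg hi]
    by_cases hi' : i ∈ J'
    · obtain ⟨b1, b2⟩ := (h.hyperplane i hi').inter_meetFlags_le (by omega) hV h4 hZ
      rw [← hQ, ← hX, ← hg] at b1 b2
      by_cases hiB : i ∈ B
      · rw [if_pos hiB]
        refine b2.trans ?_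
        have : (1 + 2 / Q) ≤ (1 - c / 2) + c := by
          have e1 : 2 / Q = 2 * (1 / Q) := by ring
          rw [e1]; linarith
        nlinarith
      · rw [if_neg hiB, add_zero]
        refine b1.trans ?_
        have hnR : ({z ∈ Z | z ≤ H i}.ncard : ℝ) ≤ Z.ncard / Q + c / 4 * Q ^ d := by
          by_contra hcon
          exact hiB (Finset.mem_filter.2 ⟨hi', (h.hyperplane i hi').1, (not_le.1 hcon).le⟩)
        have hb : (Z.ncard : ℝ) / Q + c / 4 * Q ^ d ≤ Q ^ d * (1 + 2 / Q - c + c / 4) := by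
          have : (Z.ncard : ℝ) / Q ≤ Q ^ d * (1 + 2 / Q - c) := by
            rw [div_le_iff₀ hQpos]
            calc _ ≤ _ := hz_le
              _ = _ := by ring
          linarith
        have : ({z ∈ Z | z ≤ H i}.ncard : ℝ) * (1 + 2 / Q) / Q ^ d ≤ 1 - c / 2 := by
          rw [div_le_iff₀ hQd]
          calc ({z ∈ Z | z ≤ H i}.ncard : ℝ) * (1 + 2 / Q)
              ≤ (Q ^ d * (1 + 2 / Q - c + c / 4)) * (1 + 2 / Q) := by
                gcongr
                exact hnR.trans hb
            _ = (1 + 2 / Q) * (1 + 2 / Q - c + c / 4) * Q ^ d := by ring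
            _ ≤ _ := by gcongr
        nlinarith
    · rcases h.other i hi hi' with ⟨P', hP', hP'U⟩ | hs
      · have b1 := hP'.inter_meetFlags_le (by omega) hV h4 hP'U hZ
        rw [← hQ, ← hX, ← hg] at b1
        have : (Z.ncard : ℝ) * (1 + 2 / Q) / Q ^ (d + 1) ≤ 1 - c / 2 := by
          rw [div_le_iff₀ (by positivity)]
          calc (Z.ncard : ℝ) * (1 + 2 / Q)
              ≤ (Q ^ (d + 1) * (1 + 2 / Q - c)) * (1 + 2 / Q) := by gcongr
            _ ≤ (Q ^ (d + 1) * (1 + 2 / Q - c + c / 4)) * (1 + 2 / Q) := by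
                gcongr; linarith
            _ = (1 + 2 / Q) * (1 + 2 / Q - c + c / 4) * Q ^ (d + 1) := by ring
            _ ≤ _ := by gcongr
        nlinarith
      · have h1 : ((F i ∩ meetFlags d U Z).ncard : ℝ) ≤ (F i).ncard := by
          exact_mod_cast Set.ncard_le_ncard Set.inter_subset_left (Set.toFinite _)
        have h2 := le_meetCard (K := K) (d := d) (by omega)
        rw [← hQ, ← hg] at h2
        nlinarith
  have hsum : ((meetFlags d U Z).ncard : ℝ) ≤
      N * X + Jᶜ.card * ((1 - c / 2) * g) + B.card * (c * g) := by
    have h1 : ((meetFlags d U Z).ncard : ℝ) ≤ ∑ i, ((F i ∩ meetFlags d U Z).ncard : ℝ) := by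
      exact_mod_cast ncard_le_sum_inter hcover _
    refine h1.trans ((Finset.sum_le_sum fun i _ => hterm i).trans (le_of_eq ?_))
    rw [Finset.sum_add_distrib, Finset.sum_add_distrib, Finset.sum_const, Finset.card_univ,
      Fintype.card_fin, nsmul_eq_mul, ← Finset.sum_filter, Finset.sum_const, nsmul_eq_mul]
    congr 2
    · rw [Finset.sum_ite, Finset.sum_const_zero, zero_add, Finset.sum_const, nsmul_eq_mul]
      congr 3
      ext; simp
    · congr 2; ext; simp
  have hcount : ((meetFlags d U Z).ncard : ℝ) = Z.ncard * g := by
    rw [ncard_meetFlags (by omega) hV hU hZ, hg, meetCard]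
    push_cast; ring
  -- The variance bound; together with c² q ≥ 1000 it limits the rich hyperplanes to 16/1000 of the
  -- number of free points.
  have hbeta : (B.card : ℝ) * (c / 4 * Q ^ d) ^ 2 ≤ Z.ncard * Q ^ (2 * d - 1) := by
    have h1 := ncard_rich_hyperplanes (K := K) (V := V) (n := 2 * d - 2) (by omega)
      (fun z hz => (hZ z hz).1) (t := c / 4 * Q ^ d) (by positivity)
    rw [show 2 * d - 2 + 2 = 2 * d by omega, show 2 * d - 2 + 1 = 2 * d - 1 by omega, ← hQ] at h1
    refine le_trans ?_ h1
    gcongr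
    rw [← Set.ncard_coe_finset]
    refine Set.ncard_le_ncard_of_injOn H ?_ ?_ (Set.toFinite _)
    · intro i hi
      exact (Finset.mem_filter.1 hi).2
    · exact h.hyperplane_inj.mono fun i hi => (Finset.mem_filter.1 hi).1
  have hbeta' : 1000 * (B.card : ℝ) ≤ 16 * Z.ncard := by
    have e1 : Q ^ (2 * d) = Q ^ (2 * d - 1) * Q := by rw [← pow_succ]; congr 1; omega
    have e2 : (c / 4 * Q ^ d) ^ 2 = c ^ 2 / 16 * (Q ^ (2 * d - 1) * Q) := by
      rw [← e1]; ring
    rw [e2] at hbeta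
    have e3 : 0 < Q ^ (2 * d - 1) := by positivity
    have e4 : (B.card : ℝ) * (c ^ 2 * Q) / 16 ≤ Z.ncard := by
      refine le_of_mul_le_mul_right ?_ e3
      calc _ = (B.card : ℝ) * (c ^ 2 / 16 * (Q ^ (2 * d - 1) * Q)) := by ring
        _ ≤ _ := hbeta
    have e5 : (B.card : ℝ) * 1000 ≤ B.card * (c ^ 2 * Q) := by gcongr
    linarith
  have hNq := add_card_eq_qNum (K := K) hN
  have hzm : (Z.ncard : ℝ) = Jᶜ.card + Q := by
    have e1 : Jᶜ.card + J.card = N := by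
      rw [Finset.card_compl, Fintype.card_fin]
      have := Finset.card_le_univ J
      rw [Fintype.card_fin] at this
      omega
    rw [hQ]
    exact_mod_cast (by omega : Z.ncard = Jᶜ.card + Nat.card K)
  have hN2 : (N : ℝ) ≤ 2 * Q ^ (d + 1) := by
    have : qNum K (d + 2) ≤ 2 * Nat.card K ^ (d + 1) := qNum_succ_le (d + 1)
    rw [hQ]
    exact_mod_cast (by omega : N ≤ 2 * Nat.card K ^ (d + 1))
  have hNX : N * X ≤ 2 ^ (d + 3) * Q ^ 2 * g := by
    have e1 := extraCard_mul_le (K := K) (d := d) (by omega)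
    rw [← hX, ← hQ, ← hg] at e1
    calc N * X ≤ 2 * Q ^ (d + 1) * X := by gcongr
      _ = 2 * Q ^ 2 * (X * Q ^ (d - 1)) := by
        rw [show d + 1 = 2 + (d - 1) by omega, pow_add]; ring
      _ ≤ 2 * Q ^ 2 * (2 ^ (d + 2) * g) := by gcongr
      _ = _ := by ring
  rw [hcount] at hsum
  -- Everything is divided by g: |Z| points' worth of flags against what the non-generic parts, the
  -- ordinary indices outside `J` and the rich hyperplanes can cover.
  have hfin : (Z.ncard : ℝ) ≤ 2 ^ (d + 3) * Q ^ 2 + Jᶜ.card * (1 - c / 2) + B.card * c := by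
    refine le_of_mul_le_mul_right ?_ hgpos
    calc _ ≤ _ := hsum
      _ ≤ 2 ^ (d + 3) * Q ^ 2 * g + Jᶜ.card * ((1 - c / 2) * g) + B.card * (c * g) := by gcongr
      _ = _ := by ring
  have e32 : (2 : ℝ) ^ (d + 5) = 4 * 2 ^ (d + 3) := by
    rw [show d + 5 = d + 3 + 2 by ring, pow_add]; ring
  rw [e32]
  exact few_others_arith hc0 hc1 (by positivity) hQpos (by positivity) hzm hbeta' hfin

set_option maxHeartbeats 1000000 in
/-- If only few indices are not in `J`, then there are none. -/
theorem IsClassified.no_others (h : IsClassified F U J J' P H) (hd : 3 ≤ d)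
    (hV : finrank K V = 2 * d + 1) (hU : finrank K U = d + 2)
    (hcover : ⋃ i, F i = Set.univ) (hN : N = theta (Nat.card K) (d + 1) - Nat.card K)
    (hq : 1000 * 2 ^ (d + 4) ≤ (Nat.card K : ℝ))
    (hZs : 1000 * ((Jᶜ.card : ℝ) + Nat.card K) ≤ (Nat.card K : ℝ) ^ 3) :
    Jᶜ.card = 0 := by
  classical
  set Z := freePoints U J P with hZdef
  have hZ : ∀ z ∈ Z, finrank K z = 1 ∧ z ≤ U := freePoints_spec
  have hzc := h.ncard_freePoints hU
  rw [← hZdef] at hzc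
  have hQpos := card_pos_real (K := K)
  have hQ1000 : (1000 : ℝ) ≤ Nat.card K := by
    have : (1 : ℝ) ≤ 2 ^ (d + 4) := one_le_pow₀ (by norm_num)
    linarith
  have hqn : 1000 ≤ Nat.card K := by exact_mod_cast hQ1000
  have h4 : 4 ≤ Nat.card K := by omega
  set Q : ℝ := (Nat.card K : ℝ) with hQ
  set g := meetCard K d with hg
  set X := extraCard K d with hX
  have hgpos : 0 < g := by
    have := le_meetCard (K := K) (d := d) (by omega)
    exact lt_of_lt_of_le (by positivity) this
  have hNq := add_card_eq_qNum (K := K) hN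
  have hJN : Jᶜ.card + J.card = N := by
    rw [Finset.card_compl, Fintype.card_fin]
    have := Finset.card_le_univ J
    rw [Fintype.card_fin] at this
    omega
  have hzn : Z.ncard = Jᶜ.card + Nat.card K := by omega
  have hzm : (Z.ncard : ℝ) = Jᶜ.card + Q := by rw [hQ]; exact_mod_cast hzn
  have hQd : Q ^ 3 ≤ Q ^ d := pow_le_pow_right₀ (by linarith) hd
  have hz_le : 1000 * (Z.ncard : ℝ) ≤ Q ^ d := by rw [hzm]; linarith
  have hXg : 1000 * X ≤ g := by
    have e1 := extraCard_mul_le (K := K) (d := d) (by omega)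
    rw [← hX, ← hQ, ← hg] at e1
    have e2 : Q ^ 1 ≤ Q ^ (d - 1) := pow_le_pow_right₀ (by linarith) (by omega)
    have e3 : (2 : ℝ) ^ (d + 4) = 4 * 2 ^ (d + 2) := by
      rw [show d + 4 = d + 2 + 2 by ring, pow_add _ (d + 2)]; ring
    have hX0 : 0 ≤ X := by rw [hX, extraCard]; positivity
    have hp : (0 : ℝ) < 2 ^ (d + 2) := by positivity
    refine le_of_mul_le_mul_left ?_ hp
    have e4 : 1000 * 2 ^ (d + 2) * X ≤ Q ^ (d - 1) * X := by
      gcongr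
      rw [pow_one] at e2
      linarith
    linarith
  have h2Q : 1 + 2 / Q ≤ 2 := by
    have : 2 / Q ≤ 1 := by rw [div_le_one hQpos]; linarith
    linarith
  -- As |Z| ≤ q^d/1000, no set outside `J` covers more than a quarter of one point's worth;
  -- hyperplanes need no special treatment any more.
  have hmeet : ∀ i, i ∉ J → ((F i ∩ meetFlags d U Z).ncard : ℝ) ≤ g / 4 := by
    intro i hi
    by_cases hi' : i ∈ J'
    · obtain ⟨b1, _⟩ := (h.hyperplane i hi').inter_meetFlags_le (by omega) hV h4 hZ
      rw [← hQ, ← hX, ← hg] at b1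
      have hle : ({z ∈ Z | z ≤ H i}.ncard : ℝ) ≤ Z.ncard := by
        exact Nat.cast_le.2 (Set.ncard_le_ncard (Set.sep_subset _ _) (Set.toFinite _))
      have : ({z ∈ Z | z ≤ H i}.ncard : ℝ) * (1 + 2 / Q) / Q ^ d ≤ 1 / 8 := by
        rw [div_le_iff₀ (by positivity)]
        calc ({z ∈ Z | z ≤ H i}.ncard : ℝ) * (1 + 2 / Q) ≤ Z.ncard * 2 := by gcongr
          _ ≤ _ := by linarith
      nlinarith
    · rcases h.other i hi hi' with ⟨P', hP', hP'U⟩ | hs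
      · have b1 := hP'.inter_meetFlags_le (by omega) hV h4 hP'U hZ
        rw [← hQ, ← hX, ← hg] at b1
        have hQd1 : Q ^ d ≤ Q ^ (d + 1) := pow_le_pow_right₀ (by linarith) (by omega)
        have : (Z.ncard : ℝ) * (1 + 2 / Q) / Q ^ (d + 1) ≤ 1 / 8 := by
          rw [div_le_iff₀ (by positivity)]
          calc (Z.ncard : ℝ) * (1 + 2 / Q) ≤ Z.ncard * 2 := by gcongr
            _ ≤ _ := by linarith
        nlinarith
      · have h1 : ((F i ∩ meetFlags d U Z).ncard : ℝ) ≤ (F i).ncard := by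
          exact_mod_cast Set.ncard_le_ncard Set.inter_subset_left (Set.toFinite _)
        have h2 := le_meetCard (K := K) (d := d) (by omega)
        rw [← hQ, ← hg] at h2
        linarith
  have hζ : ∃ ζ : Submodule K V → Submodule K V, ∀ L ∈ secants U Z, ζ L ∈ Z ∧ ζ L ≤ L := by
    have : ∀ L, ∃ z, L ∈ secants U Z → z ∈ Z ∧ z ≤ L := by
      intro L
      by_cases hL : L ∈ secants U Z
      · obtain ⟨z, hz⟩ := hL.2.2
        exact ⟨z, fun _ => hz⟩
      · exact ⟨⊥, fun h => absurd h hL⟩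
    choose ζ hζ using this
    exact ⟨ζ, hζ⟩
  obtain ⟨ζ, hζ⟩ := hζ
  have hsel : selectedFlags d U Z ζ ⊆ meetFlags d U Z := by
    intro f hf
    have := selectedFlags_subset hZ hζ hf
    exact (this ▸ (hζ _ hf.1).1 : f.pi ⊓ U ∈ Z)
  have hsec := le_ncard_secants hU hZ
  set B : ℝ := Q ^ (d * (d - 1)) * Q ^ (d - 1) with hBdef
  have hBpos : 0 < B := by positivity
  -- `B` is the number of selected flags on one secant, and `qNum K (d + 1)` is the number of lines
  -- of `U` through a point.
  have hgB : g = B * qNum K (d + 1) := by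
    rw [hg, meetCard, hBdef, ← pow_add, ← hQ]
    congr 2
    obtain ⟨e, rfl⟩ : ∃ e, d = e + 1 := ⟨d - 1, by omega⟩
    rw [Nat.add_sub_cancel]; ring
  have main : ∀ k : ℝ, (∀ i ∈ J, ((F i ∩ selectedFlags d U Z ζ).ncard : ℝ) ≤ k * B) →
      (Z.ncard : ℝ) * qNum K (d + 1) ≤
        J.card * k + Jᶜ.card * (qNum K (d + 1) / 4) + (Z.ncard : ℝ) ^ 2 := by
    intro k hk
    have h1 : ((selectedFlags d U Z ζ).ncard : ℝ) ≤
        ∑ i, ((F i ∩ selectedFlags d U Z ζ).ncard : ℝ) := by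
      exact_mod_cast ncard_le_sum_inter hcover _
    rw [← Finset.sum_add_sum_compl J] at h1
    have h2 : ∑ i ∈ J, ((F i ∩ selectedFlags d U Z ζ).ncard : ℝ) ≤ J.card * (k * B) := by
      rw [← nsmul_eq_mul]
      exact Finset.sum_le_card_nsmul _ _ _ hk
    have h3 : ∑ i ∈ Jᶜ, ((F i ∩ selectedFlags d U Z ζ).ncard : ℝ) ≤ Jᶜ.card * (g / 4) := by
      rw [← nsmul_eq_mul]
      refine Finset.sum_le_card_nsmul _ _ _ fun i hi => ?_
      refine le_trans ?_ (hmeet i (Finset.mem_compl.1 hi))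
      exact_mod_cast Set.ncard_le_ncard (Set.inter_subset_inter_right _ hsel) (Set.toFinite _)
    have h5 : ((selectedFlags d U Z ζ).ncard : ℝ) = (secants U Z).ncard * B := by
      rw [ncard_selectedFlags (by omega) hV hU hZ hζ, hBdef]
      push_cast; ring
    have h6 : (Z.ncard : ℝ) * qNum K (d + 1) ≤ (secants U Z).ncard + (Z.ncard : ℝ) ^ 2 := by
      exact_mod_cast hsec
    have h7 : ((secants U Z).ncard : ℝ) ≤ J.card * k + Jᶜ.card * (qNum K (d + 1) / 4) := by
      refine le_of_mul_le_mul_right ?_ hBpos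
      rw [← h5]
      calc _ ≤ _ := h1
        _ ≤ J.card * (k * B) + Jᶜ.card * (g / 4) := add_le_add h2 h3
        _ = _ := by rw [hgB]; ring
    linarith
  have hfam : ∀ i ∈ J, ∃ t : ℕ, (F i ∩ selectedFlags d U Z ζ).ncard ≤ t * Nat.card K ^ (d - 1) ∧
      t ≤ 2 ^ (d + 1) * Nat.card K ^ (d * (d - 1)) ∧
      (8 * Z.ncard ≤ Nat.card K ^ 2 → t ≤ Nat.card K ^ (d * (d - 1))) := by
    intro i hi
    obtain ⟨h1, h2⟩ := h.point i hi
    exact exists_family_selectedFlags hd hV (by omega) hU hZ hζ h1 h2 fun h3 => h3.2.2 i hi rfl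
  have hq1 : Q ^ d ≤ qNum K (d + 1) := by rw [hQ]; exact_mod_cast pow_le_qNum d
  set θ : ℝ := (qNum K (d + 1) : ℝ) with hθ
  have hθpos : 0 < θ := lt_of_lt_of_le (by positivity) hq1
  have hNθ : (N : ℝ) = Q * θ + 1 - Q := by
    have e1 : qNum K (d + 2) = Nat.card K * qNum K (d + 1) + 1 := qNum_succ' (d + 1)
    have e2 : (N : ℝ) + Q = Q * θ + 1 := by
      rw [hQ, hθ]; exact_mod_cast (by omega : N + Nat.card K = Nat.card K * qNum K (d + 1) + 1)
    linarith
  have hJr : (J.card : ℝ) = N - Jᶜ.card := by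
    have : (Jᶜ.card : ℝ) + J.card = N := by exact_mod_cast hJN
    linarith
  have hm0 : (0 : ℝ) ≤ Jᶜ.card := by positivity
  have hz0 : (0 : ℝ) ≤ Z.ncard := by positivity
  -- The general bound k = 2^(d+1) yields only |Z| = O(q). This meets the requirement 8|Z| ≤ q²
  -- under which `main` can be applied again with k = 1.
  have hround1 : (Z.ncard : ℝ) ≤ 2 ^ (d + 2) * Q := by
    have h1 := main (2 ^ (d + 1)) (by
      intro i hi
      obtain ⟨t, h1, h2, _⟩ := hfam i hi
      have : (F i ∩ selectedFlags d U Z ζ).ncard ≤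
          2 ^ (d + 1) * (Nat.card K ^ (d * (d - 1)) * Nat.card K ^ (d - 1)) := by
        refine h1.trans ((Nat.mul_le_mul_right _ h2).trans (le_of_eq ?_))
        ring
      rw [hBdef, hQ]
      exact_mod_cast this)
    have h2 : (Z.ncard : ℝ) ^ 2 ≤ Z.ncard * (θ / 1000) := by
      rw [sq]; gcongr; linarith
    have h3 : (J.card : ℝ) * 2 ^ (d + 1) ≤ Q * θ * 2 ^ (d + 1) := by
      gcongr
      rw [hJr, hNθ]; linarith
    have h5 : (Jᶜ.card : ℝ) * (θ / 4) ≤ Z.ncard * (θ / 4) := by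
      refine mul_le_mul_of_nonneg_right ?_ (by positivity)
      rw [hzm]; linarith
    refine le_of_mul_le_mul_right ?_ hθpos
    rw [pow_succ 2 (d + 1)]
    have h6 : 0 ≤ (Z.ncard : ℝ) * θ := by positivity
    have h7 : (Z.ncard : ℝ) * (θ / 1000) = Z.ncard * θ / 1000 := by ring
    have h8 : (Z.ncard : ℝ) * (θ / 4) = Z.ncard * θ / 4 := by ring
    have h9 : 2 ^ (d + 1) * 2 * Q * θ = 2 * (Q * θ * 2 ^ (d + 1)) := by ring
    rw [h9]
    linarith
  have hZ8 : 8 * (Z.ncard : ℝ) ≤ Q ^ 2 := by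
    have : (2 : ℝ) ^ (d + 4) = 4 * 2 ^ (d + 2) := by
      rw [show d + 4 = d + 2 + 2 by ring, pow_add _ (d + 2)]; ring
    rw [sq]
    have h2 : 8 * 2 ^ (d + 2) * Q ≤ Q * Q := by
      gcongr
      have : (0 : ℝ) < 2 ^ (d + 2) := by positivity
      linarith
    linarith
  have h1 := main 1 (by
    intro i hi
    obtain ⟨t, h1, _, h2⟩ := hfam i hi
    have h3 : 8 * Z.ncard ≤ Nat.card K ^ 2 := by rw [hQ] at hZ8; exact_mod_cast hZ8
    have : (F i ∩ selectedFlags d U Z ζ).ncard ≤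
        Nat.card K ^ (d * (d - 1)) * Nat.card K ^ (d - 1) :=
      h1.trans (Nat.mul_le_mul_right _ (h2 h3))
    rw [one_mul, hBdef, hQ]
    exact_mod_cast this)
  -- With θ = `qNum K (d + 1)` one has |J| = qθ + 1 - q - m, so qθ cancels and mθ ≤ 1 - q - m + mθ/4
  -- + (m+q)² is left. For m ≥ 1 the square is at most mθ/4, a contradiction.
  by_contra hne
  have hm1 : (1 : ℝ) ≤ Jᶜ.card := by exact_mod_cast Nat.one_le_iff_ne_zero.2 hne
  rw [hJr, hNθ, hzm] at h1
  rw [hzm] at hZ8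
  set m : ℝ := (Jᶜ.card : ℝ)
  have h5 : (m + Q) ^ 2 ≤ m * (4 * Q ^ 2) :=
    add_sq_le_arith hm1 (by linarith) (by linarith)
  have h6 : m * (4 * Q ^ 2) ≤ m * (θ / 4) := by
    gcongr
    have h8 : Q ^ 2 * 1000 ≤ Q ^ 3 := by rw [pow_succ Q 2]; gcongr
    have h9 : 0 ≤ Q ^ 2 := by positivity
    linarith
  have h7 : 0 ≤ m * θ := by positivity
  have h8 : (m + Q) * θ = m * θ + Q * θ := by ring
  have h9 : m * (θ / 4) = m * θ / 4 := by ring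
  rw [h8, mul_one] at h1
  linarith

end Cover

/-! ### The numerical condition on q. -/

/-- The form in which the lower bound on q is needed: c² q ≥ 1000 for the density c =
1/(320(d+1))^(d+1) supplied by `exists_dense_subspace`. -/
theorem large_card_of_le {d : ℕ} (hd : 3 ≤ d) {Q : ℝ}
    (h : (3 : ℝ) * 112 ^ (2 ^ (d + 1) - 1) / 2 ^ (d + 1) < Q) :
    1000 * ((320 * ((d : ℝ) + 1)) ^ (d + 1)) ^ 2 ≤ Q := by
  refine le_trans ?_ h.le
  obtain ⟨e, rfl⟩ : ∃ e, d = e + 3 := ⟨d - 3, by omega⟩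
  set n := e + 3 + 1 with hn
  have h4n : 4 * n ≤ 2 ^ n := by
    have : ∀ e : ℕ, 4 * (e + 4) ≤ 2 ^ (e + 4) := by
      intro e
      induction e with
      | zero => norm_num
      | succ e ih => rw [show e + 1 + 4 = e + 4 + 1 by ring, pow_succ]; omega
    exact this e
  have hnn : n * n ≤ 2 ^ n := by
    have : ∀ e : ℕ, (e + 4) * (e + 4) ≤ 2 ^ (e + 4) := by
      intro e
      induction e with
      | zero => norm_num
      | succ e ih => rw [show e + 1 + 4 = e + 4 + 1 by ring, pow_succ]; nlinarith
    exact this e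
  have hn4 : 4 ≤ n := by omega
  have hcast : ((e + 3 : ℕ) : ℝ) + 1 = n := by rw [hn]; push_cast; ring
  rw [hcast, le_div_iff₀ (by positivity)]
  -- The extra 112 completes the exponent to 2^n. From 320n ≤ 80·2^n one gets a factor 4^(n²) times
  -- powers of constants; the latter fit into 28^(n²), as 28^4 ≥ 614400 = 48·12800, and 112 = 28·4.
  have key : 112 * (1000 * ((320 * n) ^ n) ^ 2 * 2 ^ n) ≤ 3 * 112 ^ (2 ^ n) := by
    calc 112 * (1000 * ((320 * n) ^ n) ^ 2 * 2 ^ n)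
        ≤ 112 * (1000 * ((80 * 2 ^ n) ^ n) ^ 2 * 2 ^ n) := by
          have : 320 * n ≤ 80 * 2 ^ n := by omega
          gcongr
      _ = 112000 * (12800 ^ n * (4 ^ n) ^ n) := by
          have h4 : (4 ^ n) ^ n = ((2 ^ n) ^ n) ^ 2 := by
            rw [show (4 : ℕ) = 2 ^ 2 by norm_num]
            simp only [← pow_mul]
            congr 1
            ring
          have h12800 : (12800 : ℕ) ^ n = (80 ^ n) ^ 2 * 2 ^ n := by
            rw [show (12800 : ℕ) = 80 ^ 2 * 2 by norm_num, mul_pow (80 ^ 2), pow_right_comm]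
          rw [h4, h12800, mul_pow 80]
          ring
      _ ≤ 3 * 48 ^ n * (12800 ^ n * (4 ^ n) ^ n) := by
          have : 48 ^ 4 ≤ 48 ^ n := Nat.pow_le_pow_right (by norm_num) hn4
          gcongr
          omega
      _ = 3 * ((614400 : ℕ) ^ n * (4 ^ n) ^ n) := by
          rw [show (614400 : ℕ) = 48 * 12800 by norm_num, mul_pow 48]; ring
      _ ≤ 3 * ((28 ^ n) ^ n * (4 ^ n) ^ n) := by
          have : 28 ^ 4 ≤ 28 ^ n := Nat.pow_le_pow_right (by norm_num) hn4
          gcongr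
          omega
      _ = 3 * 112 ^ (n * n) := by
          rw [← mul_pow, ← mul_pow, ← pow_mul]
          norm_num
      _ ≤ _ := by gcongr; norm_num
  have e : 112 ^ (2 ^ n) = 112 * 112 ^ (2 ^ n - 1) := by
    rw [← pow_succ', Nat.sub_add_cancel Nat.one_le_two_pow]
  rw [e] at key
  have : 1000 * ((320 * n) ^ n) ^ 2 * 2 ^ n ≤ 3 * 112 ^ (2 ^ n - 1) := by linarith
  exact_mod_cast this

/-! ### Near-partition by the generic parts, and the conclusion. -/

section Main

variable {K V : Type*} [Field K] [Finite K] [AddCommGroup V] [Module K V] [FiniteDimensional K V]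
  {d : ℕ}

theorem meetCard_le_genericCard (hd : 1 ≤ d) : meetCard K d ≤ genericCard K d := by
  have h := pow_le_grassCard (K := K) (d + 1) (d - 1)
  rw [show d + 1 + (d - 1) = 2 * d by omega, mul_comm (d - 1)] at h
  rw [meetCard, genericCard]
  push_cast
  gcongr
  exact_mod_cast h

theorem IsBasedOnPoint.isGenericPart {F : Set (TypeFlag K V d)} {P : Submodule K V}
    (h : IsBasedOnPoint F P) : IsGenericPart F {f | P ≤ f.pi} :=
  Or.inl ⟨P, h, Set.Subset.antisymm (fun _ hf => ⟨h.subset hf, hf⟩) fun _ hf => hf.2⟩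

theorem IsBasedOnHyperplane.isGenericPart {F : Set (TypeFlag K V d)} {H : Submodule K V}
    (h : IsBasedOnHyperplane F H) : IsGenericPart F {f | f.tau ≤ H} :=
  Or.inr ⟨H, h, Set.Subset.antisymm (fun _ hf => ⟨h.subset hf, hf⟩) fun _ hf => hf.2⟩

set_option maxHeartbeats 1000000 in
/-- The generic parts of a cover by examples and small sets: there are many of them, and they
overlap little. -/
theorem generic_cover (hd : 3 ≤ d) (hV : finrank K V = 2 * d + 1)
    (hq : 1000 * 2 ^ (d + 4) ≤ (Nat.card K : ℝ)) {N : ℕ}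
    (hN : N = theta (Nat.card K) (d + 1) - Nat.card K) (F A : Fin N → Set (TypeFlag K V d))
    (hcover : ⋃ i, F i = Set.univ) (S : Finset (Fin N))
    (hA : ∀ i ∈ S, (A i).ncard = genericCard K d)
    (hFA : ∀ i ∈ S, (F i \ A i).ncard ≤ 2 ^ (d + 2) * Nat.card K ^ (d * d))
    (hsmall : ∀ i, i ∉ S → 8 * ((F i).ncard : ℝ) ≤ (Nat.card K : ℝ) ^ (d * d + d - 1)) :
    2 * (Nat.card K : ℝ) ^ (d + 1) ≤ 3 * S.card ∧
      ∑ i ∈ S, {f ∈ A i | ∃ j ∈ S, j ≠ i ∧ f ∈ A j}.ncard ≤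
        6 * Nat.card K ^ d * genericCard K d := by
  classical
  have hQpos := card_pos_real (K := K)
  have hQ1000 : (1000 : ℝ) ≤ Nat.card K := by
    have : (1 : ℝ) ≤ 2 ^ (d + 4) := one_le_pow₀ (by norm_num)
    linarith
  set Q : ℝ := (Nat.card K : ℝ) with hQ
  set X := extraCard K d with hX
  set g : ℝ := (genericCard K d : ℝ) with hg
  have hX0 : 0 ≤ X := by rw [hX, extraCard]; positivity
  have hmg : meetCard K d ≤ g := meetCard_le_genericCard (by omega)
  have hsg : Q ^ (d * d + d - 1) ≤ g := (le_meetCard (by omega)).trans hmg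
  have hgpos : 0 < g := lt_of_lt_of_le (by positivity) hsg
  have hNq := add_card_eq_qNum (K := K) hN
  have hN1 : (N : ℝ) ≤ Q ^ (d + 1) + 2 * Q ^ d := by
    have e3 : qNum K (d + 2) = qNum K (d + 1) + Nat.card K ^ (d + 1) := qNum_succ (d + 1)
    have e4 := qNum_succ_le (K := K) d
    rw [hQ]
    exact_mod_cast (by omega : N ≤ Nat.card K ^ (d + 1) + 2 * Nat.card K ^ d)
  have hQd : 1000 * Q ^ d ≤ Q ^ (d + 1) := by rw [pow_succ']; gcongr
  have hQd0 : 0 < Q ^ d := by positivity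
  have hXQ : X * Q ^ (d - 1) ≤ 2 ^ (d + 2) * g := by
    have e1 := extraCard_mul_le (K := K) (d := d) (by omega)
    rw [← hX, ← hQ] at e1
    refine e1.trans ?_
    gcongr
  have hXg : 1000 * (N * X) ≤ Q ^ d * g := by
    calc 1000 * (N * X) ≤ 1000 * ((2 * Q ^ (d + 1)) * X) := by
          gcongr; linarith
      _ = 2000 * Q ^ 2 * (X * Q ^ (d - 1)) := by
          rw [show d + 1 = 2 + (d - 1) by omega, pow_add]; ring
      _ ≤ 2000 * Q ^ 2 * (2 ^ (d + 2) * g) := by gcongr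
      _ = Q ^ 2 * (500 * 2 ^ (d + 4)) * g := by
          rw [show d + 4 = d + 2 + 2 by ring, pow_add _ (d + 2)]; ring
      _ ≤ Q ^ 2 * Q * g := by
          gcongr
          have : (0 : ℝ) < 2 ^ (d + 4) := by positivity
          linarith
      _ = Q ^ 3 * g := by ring
      _ ≤ Q ^ d * g := by
          gcongr
          linarith
  have hT : Q ^ (d + 1) * g ≤ ((Set.univ : Set (TypeFlag K V d)).ncard : ℝ) := by
    have h1 := ncard_flags_mul_qNum (K := K) (by omega : 1 ≤ d) hV
    have h2 := pow_mul_qNum_le (K := K) (d + 1) d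
    rw [show d + 1 + d = 2 * d + 1 by ring] at h2
    have h3 : Nat.card K ^ (d + 1) * genericCard K d ≤
        (Set.univ : Set (TypeFlag K V d)).ncard := by
      obtain ⟨e, rfl⟩ : ∃ e, d = e + 1 := ⟨d - 1, by omega⟩
      refine Nat.le_of_mul_le_mul_right (c := qNum K (e + 1)) ?_ (qNum_pos e)
      rw [h1]
      calc _ = Nat.card K ^ (e + 1 + 1) * qNum K (e + 1) * genericCard K (e + 1) := by ring
        _ ≤ _ := by gcongr
    rw [hQ, hg]
    exact_mod_cast h3
  set T : ℝ := ((Set.univ : Set (TypeFlag K V d)).ncard : ℝ) with hTdef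
  set W : ℝ := ((⋃ i ∈ S, A i).ncard : ℝ) with hW
  have hTle : T ≤ W + (S.card * X + Sᶜ.card * (g / 8)) := by
    have h1 : (Set.univ : Set (TypeFlag K V d)) ⊆
        (⋃ i ∈ S, A i) ∪ ((⋃ i ∈ S, F i \ A i) ∪ ⋃ i ∈ Sᶜ, F i) := by
      intro f _
      have hf : f ∈ ⋃ i, F i := by rw [hcover]; trivial
      obtain ⟨i, hi⟩ := Set.mem_iUnion.1 hf
      by_cases hiS : i ∈ S
      · by_cases hfA : f ∈ A i
        · exact Or.inl (Set.mem_biUnion hiS hfA)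
        · exact Or.inr (Or.inl (Set.mem_biUnion (x := i) hiS ⟨hi, hfA⟩))
      · exact Or.inr (Or.inr (Set.mem_biUnion (x := i) (Finset.mem_compl.2 hiS) hi))
    have h2 := (Set.ncard_le_ncard h1 (Set.toFinite _)).trans ((Set.ncard_union_le _ _).trans
      (Nat.add_le_add_left ((Set.ncard_union_le _ _).trans (Nat.add_le_add
        (Finset.set_ncard_biUnion_le _ _) (Finset.set_ncard_biUnion_le _ _))) _))
    have h3 : T ≤ W + (∑ i ∈ S, ((F i \ A i).ncard : ℝ) + ∑ i ∈ Sᶜ, ((F i).ncard : ℝ)) := by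
      rw [hTdef, hW]
      exact_mod_cast h2
    refine h3.trans (add_le_add le_rfl (add_le_add ?_ ?_))
    · rw [← nsmul_eq_mul]
      refine Finset.sum_le_card_nsmul _ _ _ fun i hi => ?_
      rw [hX, extraCard]
      exact_mod_cast hFA i hi
    · rw [← nsmul_eq_mul]
      refine Finset.sum_le_card_nsmul _ _ _ fun i hi => ?_
      have := hsmall i (Finset.mem_compl.1 hi)
      linarith
  have hSN : (S.card : ℝ) + Sᶜ.card = N := by
    have := Finset.card_add_card_compl S
    rw [Fintype.card_fin] at this
    exact_mod_cast this
  have hS0 : (0 : ℝ) ≤ S.card := by positivity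
  have hSc0 : (0 : ℝ) ≤ Sᶜ.card := by positivity
  have hSX : S.card * X ≤ N * X := mul_le_mul_of_nonneg_right (by linarith) hX0
  have hsumA : ∑ i ∈ S, (A i).ncard = S.card * genericCard K d :=
    Finset.sum_const_nat hA
  have hmult := sum_ncard_multiple_le S A
  rw [hsumA] at hmult
  have hWle : W ≤ S.card * g := by
    have := Finset.set_ncard_biUnion_le S A
    rw [hsumA] at this
    rw [hW, hg]
    exact_mod_cast this
  have hprod : Q ^ d * g * 1000 ≤ Q ^ (d + 1) * g := by nlinarith
  have hQg : 0 < Q ^ d * g := by positivity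
  have hNg : N * g ≤ Q ^ (d + 1) * g + 2 * (Q ^ d * g) := by
    have := mul_le_mul_of_nonneg_right hN1 hgpos.le
    linarith
  have hSNg : S.card * g + Sᶜ.card * g = N * g := by rw [← hSN]; ring
  have hScg : 0 ≤ Sᶜ.card * g := by positivity
  have h8 : (Sᶜ.card : ℝ) * (g / 8) = Sᶜ.card * g / 8 := by ring
  rw [h8] at hTle
  -- N g exceeds the number of flags by at most 2 q^d g, and the non-generic parts add at most q^d
  -- g/1000. As an index outside `S` wastes 7g/8, this bounds their number as well as the excess |S|
  -- g - W, and multiply covered flags cost at most twice that excess.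
  constructor
  · refine le_of_mul_le_mul_right ?_ hgpos
    have e1 : 2 * Q ^ (d + 1) * g = 2 * (Q ^ (d + 1) * g) := by ring
    have e2 : 3 * (S.card : ℝ) * g = 3 * (S.card * g) := by ring
    rw [e1, e2]
    linarith
  · have h9 : ((∑ i ∈ S, {f ∈ A i | ∃ j ∈ S, j ≠ i ∧ f ∈ A j}.ncard : ℕ) : ℝ) + 2 * W ≤
        2 * (S.card * g) := by
      rw [hW, hg]
      exact_mod_cast hmult
    have h10 : ((∑ i ∈ S, {f ∈ A i | ∃ j ∈ S, j ≠ i ∧ f ∈ A j}.ncard : ℕ) : ℝ) ≤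
        6 * (Q ^ d * g) := by linarith
    have e1 : 6 * (Q ^ d * g) = ((6 * Nat.card K ^ d * genericCard K d : ℕ) : ℝ) := by
      rw [hQ, hg]; push_cast; ring
    rw [e1] at h10
    exact_mod_cast h10

end Main

theorem mainTheorem3 {K V : Type*} [Field K] [Fintype K] [AddCommGroup V] [Module K V]
    (d α q : ℕ) (hd : 3 ≤ d) (hα : 5 ≤ α) (hq : q = Fintype.card K)
    (hV : finrank K V = 2 * d + 1)
    (F : Fin (theta q (d + 1) - q) → Set (TypeFlag K V d))
    (hF : ∀ i, (flagKneserGraph K V d).IsIndepSet (F i))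
    (hcover : ⋃ i, F i = Set.univ)
    (S : Set (Fin (theta q (d + 1) - q)))
    (hS : S = {i | α * q ^ (d ^ 2 + d - 2) < (F i).ncard})
    (hI : (3 : ℝ) * 112 ^ (2 ^ (d + 1) - 1) / 2 ^ (d + 1) < q)
    (hI' : (3 / 2 : ℝ) * (α : ℝ) ^ 2 + 21 / 2 * (α : ℝ) + 17 ≤ q)
    (hII : ∀ i ∈ S, (∃ P, IsBasedOnPoint (F i) P) ∨ (∃ H, IsBasedOnHyperplane (F i) H))
    (hIII : ∀ i ∈ S, ∀ j ∈ S, i ≠ j → ∀ Gi Gj : Set (TypeFlag K V d),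
      IsGenericPart (F i) Gi → IsGenericPart (F j) Gj → Gi ≠ Gj)
    (hIV : (1 / 2 : ℝ) * (S.ncard : ℝ) ≤ ({i ∈ S | ∃ P, IsBasedOnPoint (F i) P}.ncard : ℝ)) :
    ∃ P : Fin (theta q (d + 1) - q) → Submodule K V,
      (∀ i, IsBasedOnPoint (F i) (P i)) ∧
      Function.Injective P ∧
      ∃ U : Submodule K V, finrank K U = d + 2 ∧ ∀ i, P i ≤ U := by
  classical
  rw [← Nat.card_eq_fintype_card] at hq
  subst hq
  have : FiniteDimensional K V := FiniteDimensional.of_finrank_pos (by omega)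
  have hnum := large_card_of_le hd hI
  have hQpos := card_pos_real (K := K)
  set D : ℝ := (320 * ((d : ℝ) + 1)) ^ (d + 1) with hD
  have hD2 : (2 : ℝ) ^ (d + 6) ≤ D := by
    have h1 : (2 : ℝ) ^ (d + 6) ≤ (2 ^ 8) ^ (d + 1) := by
      rw [← pow_mul]
      exact pow_le_pow_right₀ (by norm_num) (by omega)
    refine h1.trans (pow_le_pow_left₀ (by norm_num) ?_ _)
    have : (0 : ℝ) ≤ d := by positivity
    linarith
  have hD1 : 1 ≤ D := le_trans (one_le_pow₀ (by norm_num)) hD2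
  have hDD : D ≤ D ^ 2 := by nlinarith
  have h24 : (2 : ℝ) ^ (d + 6) = 4 * 2 ^ (d + 4) := by
    rw [show d + 6 = d + 4 + 2 by ring, pow_add _ (d + 4)]; ring
  have hp4 : (0 : ℝ) < 2 ^ (d + 4) := by positivity
  have hq4 : 1000 * 2 ^ (d + 4) ≤ (Nat.card K : ℝ) := by linarith
  have hq1000 : (1000 : ℝ) ≤ Nat.card K := by linarith
  have h4 : 4 ≤ Nat.card K := by
    have : (4 : ℝ) ≤ Nat.card K := by linarith
    exact_mod_cast this
  -- The quadratic condition on α enters only through 8α ≤ q, which puts the sets with index outside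
  -- `S` below g/8.
  have hα8 : 8 * (α : ℝ) ≤ Nat.card K := by
    have : (5 : ℝ) ≤ α := by exact_mod_cast hα
    nlinarith
  have hsmall : ∀ i, i ∉ S → 8 * ((F i).ncard : ℝ) ≤ (Nat.card K : ℝ) ^ (d * d + d - 1) := by
    intro i hi
    have h1 : (F i).ncard ≤ α * Nat.card K ^ (d ^ 2 + d - 2) := by
      by_contra hcon
      exact hi (by rw [hS]; exact not_le.1 hcon)
    have h2 : ((F i).ncard : ℝ) ≤ α * (Nat.card K : ℝ) ^ (d ^ 2 + d - 2) := by exact_mod_cast h1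
    have h3 : d * d + d - 1 = (d ^ 2 + d - 2) + 1 := by
      rw [← sq]
      have : 0 < d ^ 2 := by positivity
      omega
    rw [h3, pow_succ']
    calc 8 * ((F i).ncard : ℝ) ≤ 8 * (α * (Nat.card K : ℝ) ^ (d ^ 2 + d - 2)) := by gcongr
      _ = 8 * α * (Nat.card K : ℝ) ^ (d ^ 2 + d - 2) := by ring
      _ ≤ _ := by gcongr
  -- The value `⊥` is a dummy for indices that are not based on a point; `hHex` proceeds in the same
  -- way.
  have hPex : ∀ i, ∃ P, (∃ P', IsBasedOnPoint (F i) P') → IsBasedOnPoint (F i) P := by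
    intro i
    by_cases h : ∃ P', IsBasedOnPoint (F i) P'
    · obtain ⟨P, hP⟩ := h
      exact ⟨P, fun _ => hP⟩
    · exact ⟨⊥, fun h' => absurd h' h⟩
  choose P hP using hPex
  have hHex : ∀ i, ∃ H, (∃ H', IsBasedOnHyperplane (F i) H') → IsBasedOnHyperplane (F i) H := by
    intro i
    by_cases h : ∃ H', IsBasedOnHyperplane (F i) H'
    · obtain ⟨H, hH⟩ := h
      exact ⟨H, fun _ => hH⟩
    · exact ⟨⊥, fun h' => absurd h' h⟩
  choose H hH using hHex
  set S' : Finset (Fin (theta (Nat.card K) (d + 1) - Nat.card K)) := S.toFinite.toFinset with hS'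
  have hS'mem : ∀ i, i ∈ S' ↔ i ∈ S := fun i => by simp [hS']
  -- A set that is an example of both kinds is treated as based on a point.
  set I : Finset (Fin (theta (Nat.card K) (d + 1) - Nat.card K)) := S'.filter fun i => ∃ P', IsBasedOnPoint (F i) P' with hIdef
  have hImem : ∀ i, i ∈ I ↔ i ∈ S ∧ ∃ P', IsBasedOnPoint (F i) P' := fun i => by
    rw [hIdef, Finset.mem_filter, hS'mem]
  have hIP : ∀ i ∈ I, IsBasedOnPoint (F i) (P i) := fun i hi => hP i ((hImem i).1 hi).2
  have hIH : ∀ i ∈ S, i ∉ I → IsBasedOnHyperplane (F i) (H i) := by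
    intro i hi hiI
    refine hH i ((hII i hi).resolve_left fun h => hiI ((hImem i).2 ⟨hi, h⟩))
  have hPinj : Set.InjOn P I := by
    intro i hi j hj hij
    by_contra hne
    refine hIII i ((hImem i).1 hi).1 j ((hImem j).1 hj).1 hne _ _ (hIP i hi).isGenericPart
      (hIP j hj).isGenericPart ?_
    rw [hij]
  set A : Fin (theta (Nat.card K) (d + 1) - Nat.card K) → Set (TypeFlag K V d) := fun i =>
    if i ∈ I then {f | P i ≤ f.pi} else {f | f.tau ≤ H i} with hA
  have hAI : ∀ i ∈ I, A i = {f | P i ≤ f.pi} := fun i hi => if_pos hi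
  have hAH : ∀ i, i ∉ I → A i = {f | f.tau ≤ H i} := fun i hi => if_neg hi
  obtain ⟨hScard, hmult⟩ := generic_cover hd hV hq4 rfl F A hcover S'
    (by
      intro i hi
      by_cases hiI : i ∈ I
      · rw [hAI i hiI]
        exact ncard_flags_point (by omega) hV (hIP i hiI).1
      · rw [hAH i hiI]
        exact ncard_flags_hyperplane (by omega) (hIH i ((hS'mem i).1 hi) hiI).1)
    (by
      intro i hi
      by_cases hiI : i ∈ I
      · rw [hAI i hiI]
        exact (hIP i hiI).extra_le (by omega) hV h4
      · rw [hAH i hiI]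
        exact (hIH i ((hS'mem i).1 hi) hiI).extra_le (by omega) hV h4)
    (fun i hi => hsmall i fun h => hi ((hS'mem i).2 h))
  have hIcard : (Nat.card K) ^ (d + 1) ≤ 3 * I.card := by
    have e1 : S.ncard = S'.card := by rw [← Set.ncard_coe_finset]; simp [hS']
    have e2 : {i ∈ S | ∃ P, IsBasedOnPoint (F i) P}.ncard = I.card := by
      rw [← Set.ncard_coe_finset]; congr 1; ext i
      rw [Finset.mem_coe, hImem]; rfl
    rw [e1, e2] at hIV
    have : (Nat.card K : ℝ) ^ (d + 1) ≤ 3 * I.card := by linarith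
    exact_mod_cast this
  set X : Finset (Submodule K V) := I.image P with hX
  have hXcard : X.card = I.card := Finset.card_image_of_injOn hPinj
  obtain ⟨U, hU, hdense⟩ := exists_dense_subspace hd hV
    (by
      have h1 : 320 * ((d : ℝ) + 1) ≤ D :=
        le_self_pow₀ (by have : (0 : ℝ) ≤ d := by positivity
                         linarith) (by omega)
      have : 160 * ((d : ℝ) + 1) ≤ Nat.card K := by
        have : (0 : ℝ) ≤ d := by positivity
        linarith
      exact_mod_cast this)
    X
    (by
      intro p hp
      obtain ⟨i, hi, rfl⟩ := Finset.mem_image.1 hp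
      exact (hIP i hi).1)
    (by rw [hXcard]; exact hIcard)
    (by
      refine le_trans ?_ hmult
      rw [hX, Finset.sum_image hPinj]
      refine (Finset.sum_le_sum fun i hi => ?_).trans
        (Finset.sum_le_sum_of_subset (Finset.filter_subset _ _))
      refine Set.ncard_le_ncard ?_ (Set.toFinite _)
      rintro f ⟨h1, x, hx, hne, hxf⟩
      obtain ⟨j, hj, rfl⟩ := Finset.mem_image.1 (Finset.mem_coe.1 hx)
      refine ⟨by rw [hAI i hi]; exact h1, j, (hS'mem j).2 ((hImem j).1 hj).1, ?_,
        by rw [hAI j hj]; exact hxf⟩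
      rintro rfl
      exact hne rfl)
  set J : Finset (Fin (theta (Nat.card K) (d + 1) - Nat.card K)) := I.filter fun i => P i ≤ U with hJ
  have hJI : ∀ i ∈ J, i ∈ I ∧ P i ≤ U := fun i hi => Finset.mem_filter.1 hi
  have hclass : IsClassified F U J (S' \ I) P H :=
    { point := fun i hi => ⟨hIP i (hJI i hi).1, (hJI i hi).2⟩
      point_inj := hPinj.mono fun i hi => (hJI i hi).1
      hyperplane := by
        intro i hi
        rw [Finset.mem_sdiff, hS'mem] at hi
        exact hIH i hi.1 hi.2
      hyperplane_inj := by
        intro i hi j hj hij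
        rw [Finset.mem_coe, Finset.mem_sdiff, hS'mem] at hi hj
        by_contra hne
        refine hIII i hi.1 j hj.1 hne _ _ (hIH i hi.1 hi.2).isGenericPart
          (hIH j hj.1 hj.2).isGenericPart ?_
        rw [hij]
      other := by
        intro i hi hi'
        by_cases hiS : i ∈ S
        · have hiI : i ∈ I := by
            by_contra h
            exact hi' (Finset.mem_sdiff.2 ⟨(hS'mem i).2 hiS, h⟩)
          exact Or.inl ⟨P i, hIP i hiI, fun h => hi (Finset.mem_filter.2 ⟨hiI, h⟩)⟩
        · exact Or.inr (hsmall i hiS) }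
  have hJcard : {x | x ∈ X ∧ x ≤ U}.ncard = J.card := by
    rw [← Finset.card_image_of_injOn hclass.point_inj, ← Set.ncard_coe_finset]
    congr 1; ext x
    simp only [Set.mem_ofPred_eq, hX, hJ, Finset.coe_image, Set.mem_image, Finset.mem_image,
      Finset.mem_coe, Finset.mem_filter]
    constructor
    · rintro ⟨⟨i, hi, rfl⟩, h⟩
      exact ⟨i, ⟨hi, h⟩, rfl⟩
    · rintro ⟨i, ⟨hi, h⟩, rfl⟩
      exact ⟨⟨i, hi, rfl⟩, h⟩
  rw [hJcard, ← hD] at hdense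
  have hDpos : 0 < D := by linarith
  have hfew := hclass.few_others hd hV hU hcover rfl (c := 1 / D) (by positivity)
    (by rw [div_le_one hDpos]; exact hD1)
    (by
      rw [div_pow, one_pow, div_mul_eq_mul_div, one_mul, le_div_iff₀ (by positivity)]
      exact hnum)
    (by rw [div_mul_eq_mul_div, one_mul]; exact hdense)
  -- From m ≤ 2^(d+5) D q² and 1000 D² ≤ q, with 2^(d+6) ≤ D, each of 1000 m and 1000 q is at most
  -- q³/2.
  have hJ0 := hclass.no_others hd hV hU hcover rfl hq4 (by
    rw [div_mul_eq_mul_div, one_mul, div_le_iff₀ hDpos] at hfew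
    have e1 : (2 : ℝ) ^ (d + 6) = 2 * 2 ^ (d + 5) := by
      rw [show d + 6 = d + 5 + 1 by ring, pow_succ _ (d + 5)]; ring
    set Q : ℝ := (Nat.card K : ℝ)
    have e2 : 2 * 2 ^ (d + 5) * D ≤ D * D := by gcongr; linarith
    have e3 : 1000 * 2 ^ (d + 5) * D ≤ Q / 2 := by
      rw [← sq] at e2
      linarith
    have e4 : 1000 * (2 ^ (d + 5) * Q ^ 2 * D) ≤ Q / 2 * Q ^ 2 := by
      calc _ = 1000 * 2 ^ (d + 5) * D * Q ^ 2 := by ring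
        _ ≤ _ := by gcongr
    have e5 : 1000 * Q ≤ Q / 2 * Q ^ 2 := by
      have : 1000 * Q ≤ Q * Q := by gcongr
      nlinarith
    have e6 : Q ^ 3 = Q / 2 * Q ^ 2 + Q / 2 * Q ^ 2 := by ring
    rw [e6]
    linarith)
  have hJall : ∀ i, i ∈ J := by
    intro i
    by_contra hi
    rw [Finset.card_eq_zero] at hJ0
    have : i ∈ Jᶜ := Finset.mem_compl.2 hi
    rw [hJ0] at this
    exact absurd this (Finset.notMem_empty i)
  exact ⟨P, fun i => (hclass.point i (hJall i)).1,
    fun i j hij => hclass.point_inj (hJall i) (hJall j) hij,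
    U, hU, fun i => (hclass.point i (hJall i)).2⟩
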